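/- Let $n,m,Q\ge 1$, let $\mathcal A_Q(\mathbb R^m)$ be the space of unordered $Q$-tuples $T=\sum_{i=1}^Q[\![P_i]\!]$ of points of $\mathbb R^m$ with the metric $\mathcal G(\sum_i[\![P_i]\!],\sum_i[\![S_i]\!])=\min_\sigma(\sum_i|P_i-S_{\sigma(i)}|^2)^{1/2}$, and let $B_1\subset\mathbb R^n$ be the open unit ball. Let $f=\sum_i[\![f_i]\!]\in W^{1,2}(B_1;\mathcal A_Q(\mathbb R^m))$, that is, there are $\varphi_1,\dots,\varphi_n\in L^2(B_1)$ such that $\mathcal G(f,T)\in W^{1,2}(B_1)$ and $|\partial_j\mathcal G(f,T)|\le\varphi_j$ a.e. for all $T\in\mathcal A_Q(\mathbb R^m)$ and all $j$; let $Df_i$ denote the approximate differentials of $f$, which exist a.e., and put $|f|^2=\sum_i|f_i|^2$, $|Df|^2=\sum_i|Df_i|^2$. Suppose that $f$ is Dir-stationary in $\Omega=B_1$, that is, $$\int_\Omega\sum_i\big[\langle Df_i: D_x\psi(x,f_i)\rangle+\langle Df_i: D_u\psi(x,f_i)\,Df_i\rangle\big]\,dx=0$$ for all $\psi\in C^\infty(\Omega\times\mathbb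 R^m;\mathbb R^m)$ with compact support in $x$ such that, for some constant $C$, $|D_u\psi|\le C$ and $|\psi|+|D_x\psi|\le C(1+|u|)$, and $$2\int_\Omega\sum_i\langle Df_i: Df_i\,D\phi\rangle\,dx-\int_\Omega|Df|^2\,\mathrm{div}\,\phi\,dx=0\qquad\text{for all }\phi\in C_c^\infty(\Omega;\mathbb R^n).$$ Suppose also that $f$ is nontrivial, i.e. it is not a.e. equal to $Q[\![0]\!]$ in $B_1$. Then for every $x\in B_1$ the vanishing order $$\kappa_x=\limsup_{r\to0}\frac{\log\big(\frac1{|A_r(x)|}\int_{A_r(x)}|f|^2\big)}{2\log r}$$ is a finite real number, the upper limit is a limit, and there are radii $r_j>0$ with $r_j\to0$ and $B_{2r_j}(x)\subset B_1$, and constants $\epsilon_j\ge0$ with $\epsilon_j\to0$, such that for all $j$ $$\int_{B_{2r_j}(x)\setminus B_{r_j}(x)}\sum_{i=1}^Q|Df_i(y)\,(y-x)-\kappa_x f_i(y)|^2\,dy\le\epsilon_j\int_{B_{2r_j}(x)\setminus B_{r_j}(x)}\sum_{i=1}^Q|f_i(y)|^2\,dy .$$ Here $A_r(x)=B_{2r}(x)\setminus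 B_r(x)$ and $|A_r(x)|$ is its Lebesgue measure. -/

import Mathlib

open MeasureTheory Filter Topology Asymptotics Metric
open scoped ENNReal NNReal ContDiff

/-- Euclidean space `ℝⁿ` with its Euclidean norm. -/
abbrev Euc (n : ℕ) : Type := EuclideanSpace ℝ (Fin n)

/-- The space `𝒜_Q(ℝᵐ)` of unordered `Q`-tuples of points of `ℝᵐ`, repetitions allowed. -/
abbrev AQ (Q m : ℕ) : Type := Sym (Euc m) Q

namespace QValued

/-- The unordered tuple `∑ᵢ ⟦vᵢ⟧`. -/
def ofFn {α : Type*} {Q : ℕ} (v : Fin Q → α) : Sym α Q :=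
  ⟨(Finset.univ : Finset (Fin Q)).val.map v, by simp⟩

/-- `∑ᵢ F(aᵢ)` for an unordered tuple `∑ᵢ ⟦aᵢ⟧`. -/
def sum {α : Type*} {Q : ℕ} (s : Sym α Q) (F : α → ℝ) : ℝ :=
  ((s : Multiset α).map F).sum

/-- The distance `𝒢(S, T) = min (∑ᵢ |Pᵢ - Sᵢ|²)^{1/2}` on `𝒜_Q(ℝᵐ)`, the minimum being over
all numberings of the two tuples. -/
noncomputable def dist {Q m : ℕ} (S T : AQ Q m) : ℝ :=
  sInf {d : ℝ | ∃ v w : Fin Q → Euc m, ofFn v = S ∧ ofFn w = T ∧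
    d = Real.sqrt (∑ i, ‖v i - w i‖ ^ 2)}

/-- `|T|² = ∑ᵢ |Pᵢ|²`. -/
noncomputable def sqNorm {Q m : ℕ} (T : AQ Q m) : ℝ := sum T fun P => ‖P‖ ^ 2

/-- The `j`-th standard basis vector. -/
noncomputable def basisVec {n : ℕ} (j : Fin n) : Euc n := EuclideanSpace.single j 1

/-- The Hilbert–Schmidt product `⟨A : B⟩` of linear maps `ℝⁿ → ℝᵐ`. -/
noncomputable def hsInner {n m : ℕ} (A B : Euc n →L[ℝ] Euc m) : ℝ :=
  ∑ j, inner ℝ (A (basisVec j)) (B (basisVec j))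

/-- The divergence of a vector field. -/
noncomputable def divergence {n : ℕ} (φ : Euc n → Euc n) (x : Euc n) : ℝ :=
  ∑ j, (fderiv ℝ φ x (basisVec j)) j

/-- `g` is the `j`-th weak partial derivative of `u` in `Ω`. (Used only for `u, g ∈ L²(Ω)`.) -/
def IsWeakPartial {n : ℕ} (Ω : Set (Euc n)) (j : Fin n) (u g : Euc n → ℝ) : Prop :=
  ∀ φ : Euc n → ℝ, ContDiff ℝ ∞ φ → HasCompactSupport φ → tsupport φ ⊆ Ω →
    ∫ x in Ω, u x * fderiv ℝ φ x (basisVec j) = - ∫ x in Ω, g x * φ x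

/-- The Sobolev class `W^{1,2}(Ω; 𝒜_Q(ℝᵐ))`: there are `φ₁, …, φₙ ∈ L²(Ω)` such that for every
`T ∈ 𝒜_Q(ℝᵐ)` the real function `x ↦ 𝒢(f(x), T)` lies in `W^{1,2}(Ω)` and
`|∂ⱼ 𝒢(f, T)| ≤ φⱼ` a.e. in `Ω`. Measurability of `f` is contained in that of all the
functions `𝒢(f, T)`, since `𝒢` is a separable metric. -/
def MemW12 {n m Q : ℕ} (Ω : Set (Euc n)) (f : Euc n → AQ Q m) : Prop :=
  ∃ φ : Fin n → Euc n → ℝ, (∀ j, MemLp (φ j) 2 (volume.restrict Ω)) ∧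
    ∀ T : AQ Q m, MemLp (fun x => dist (f x) T) 2 (volume.restrict Ω) ∧
      ∀ j, ∃ g : Euc n → ℝ, MemLp g 2 (volume.restrict Ω) ∧
        IsWeakPartial Ω j (fun x => dist (f x) T) g ∧
        ∀ᵐ x ∂(volume.restrict Ω), |g x| ≤ φ j x

/-- `S` has Lebesgue density one at `x`. -/
def HasDensityOne {n : ℕ} (S : Set (Euc n)) (x : Euc n) : Prop :=
  Tendsto (fun r : ℝ => volume (S ∩ closedBall x r) / volume (closedBall x r)) (𝓝[>] 0) (𝓝 1)

/-- An unordered `Q`-tuple of pairs (value, linear map), `∑ᵢ ⟦(Pᵢ, Lᵢ)⟧`. -/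
abbrev Jet (n m Q : ℕ) : Type := Sym (Euc m × (Euc n →L[ℝ] Euc m)) Q

/-- `f` is approximately differentiable at `x`, with `f(x) = ∑ᵢ ⟦Pᵢ⟧` and approximate
differentials `Df_i(x) = Lᵢ`, where `J = ∑ᵢ ⟦(Pᵢ, Lᵢ)⟧`: one has `Lᵢ = Lⱼ` whenever `Pᵢ = Pⱼ`,
and `𝒢(f(y), ∑ᵢ ⟦Pᵢ + Lᵢ (y - x)⟧) = o(|y - x|)` as `y → x` inside some measurable set that
contains `x` and has density one there. -/
def IsApproxJet {n m Q : ℕ} (f : Euc n → AQ Q m) (x : Euc n) (J : Jet n m Q) : Prop :=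
  J.map Prod.fst = f x ∧
  (∀ p ∈ J, ∀ q ∈ J, p.1 = q.1 → p.2 = q.2) ∧
  ∃ S : Set (Euc n), MeasurableSet S ∧ x ∈ S ∧ HasDensityOne S x ∧
    (fun y => dist (f y) (J.map fun p => p.1 + p.2 (y - x))) =o[𝓝[S] x] fun y => y - x

open Classical in
/-- The tuple of pairs `∑ᵢ ⟦(f_i(x), Df_i(x))⟧` at a point `x` of approximate differentiability
(almost every point, for Sobolev `f`; there the tuple is unique). Elsewhere the
differentials are put equal to `0`. -/
noncomputable def jet {n m Q : ℕ} (f : Euc n → AQ Q m) (x : Euc n) : Jet n m Q :=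
  if h : ∃ J : Jet n m Q, IsApproxJet f x J then h.choose else (f x).map fun P => (P, 0)

/-- Vanishing of all outer variations of the Dirichlet energy in `Ω`. The test fields on
`Ω × ℝᵐ` with compact support in `x` are extended by zero. -/
def OuterStationary {n m Q : ℕ} (Ω : Set (Euc n)) (f : Euc n → AQ Q m) : Prop :=
  ∀ ψ : Euc n × Euc m → Euc m, ContDiff ℝ ∞ ψ →
    (∃ K : Set (Euc n), IsCompact K ∧ K ⊆ Ω ∧ ∀ x, x ∉ K → ∀ u, ψ (x, u) = 0) →
    (∃ C : ℝ, ∀ x u, ‖fderiv ℝ (fun v => ψ (x, v)) u‖ ≤ C ∧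
      ‖ψ (x, u)‖ + ‖fderiv ℝ (fun y => ψ (y, u)) x‖ ≤ C * (1 + ‖u‖)) →
    ∫ x in Ω, sum (jet f x) (fun p =>
      hsInner p.2 (fderiv ℝ (fun y => ψ (y, p.1)) x) +
        hsInner p.2 ((fderiv ℝ (fun v => ψ (x, v)) p.1).comp p.2)) = 0

/-- Vanishing of all inner variations of the Dirichlet energy in `Ω`. -/
def InnerStationary {n m Q : ℕ} (Ω : Set (Euc n)) (f : Euc n → AQ Q m) : Prop :=
  ∀ φ : Euc n → Euc n, ContDiff ℝ ∞ φ → HasCompactSupport φ → tsupport φ ⊆ Ω →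
    2 * (∫ x in Ω, sum (jet f x) fun p => hsInner p.2 (p.2.comp (fderiv ℝ φ x))) -
      ∫ x in Ω, sum (jet f x) (fun p => hsInner p.2 p.2) * divergence φ x = 0

/-- `f ∈ W^{1,2}(Ω; 𝒜_Q(ℝᵐ))` is Dir-stationary. -/
structure DirStationary {n m Q : ℕ} (Ω : Set (Euc n)) (f : Euc n → AQ Q m) : Prop where
  memW12 : MemW12 Ω f
  outer : OuterStationary Ω f
  inner : InnerStationary Ω f

/-- The annulus `B_{2r}(x) \ B_r(x)`. -/
def annulus {n : ℕ} (x : Euc n) (r : ℝ) : Set (Euc n) := ball x (2 * r) \ ball x r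

/-- `log (⨍_{B_{2r}(x) \ B_r(x)} |f|²) / (2 log r)`, with `log 0 = -∞`, so that the quotient is
`+∞` if `f` vanishes on the annulus and `0 < r < 1`. -/
noncomputable def vanishingQuotient {n m Q : ℕ} (f : Euc n → AQ Q m) (x : Euc n) (r : ℝ) :
    EReal :=
  ENNReal.log (⨍⁻ y in annulus x r, ENNReal.ofReal (sqNorm (f y)) ∂volume) /
    ((2 * Real.log r : ℝ) : EReal)

/-- The vanishing order `κ_{x,f}`, as an upper limit. -/
noncomputable def vanishingOrder {n m Q : ℕ} (f : Euc n → AQ Q m) (x : Euc n) : EReal :=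
  limsup (vanishingQuotient f x) (𝓝[>] 0)

end QValued

/-! Fix a centre `x`. Let `H(s)` be the integral of `|f|²` over the sphere of radius `s` about `x`,
and `E(s)` the Dirichlet energy in the ball. The proof rests on Almgren's frequency `N(s) = s E(s) /
H(s)`. Outer variations `η(y) u` with `η` radial identify `E` with the integral of `⟨f, ∂_ν f⟩` over
the sphere. Inner variations along `η(y) (y - x)` give a formula for `s E'`, and the chain rule for
`|f|²` gives `H' = (n - 1) H / s + 2 E`. Together they yield `N' = 2 s (∫ |∂_ν f|² - E² / H) / H`,
which is nonnegative by Cauchy–Schwarz. So `N` decreases to a limit `κ ≥ 0` as `s → 0`.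

A bounded frequency bounds the logarithmic derivative of `H`, so `H` cannot have a zero at a
positive radius unless it vanishes identically. Connectedness of the ball turns this into unique
continuation, which excludes vanishing at every centre when `f` is nontrivial. Integrating `(log H)'
= (n - 1) / s + 2 N / s` identifies `κ` with the vanishing order, as a limit. The spherical integral
of `|s ∂_ν f - κ f|²` equals `(s / 2) H N' + H (N - κ)²`. Integrated over `(r, 2 r)`, with the
doubling bound for `H`, this is at most a constant times `N(2 r) - N(r) + (N(2 r) - κ)²` times the
integral of `|f|²` over the annulus. The factor tends to `0`, so all small radii are admissible.

The one-variable analysis is `RadialSystem.asymptotics`; the reduction to it is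
`EnergyDensities.radialSystem`.

The tuple-valued part has to derive, from the metric definition of Sobolev functions, the
integrability of `∑ᵢ ⟨∂ⱼ fᵢ, ∂ₖ fᵢ⟩` and the chain rule `∂ⱼ |f|² = 2 ∑ᵢ ⟨fᵢ, ∂ⱼ fᵢ⟩`. By a maximal
function argument `f` is Lipschitz on countably many measurable sets that exhaust the ball up to a
null set (`HasGradientBound.exists_lipschitz_cover`). On each of them a Rademacher theorem provides
approximate differentials (`ae_exists_isApproxJet`). Difference quotients along translations that
return to the set compare these differentials with the weak gradients of the scalar functions `𝒢(f,
T)` (`HasGradientBound.jetControlled`). The result is collected in `DirStationary.energyDensities`.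
-/

/-- The relations between the spherical integrals `h` of `|f|²`, `d` of `|Df|²`, `v` of
`⟨f, ∂_ν f⟩` and `e` of `|∂_ν f|²` of a stationary function in dimension `m + 1`. -/
structure RadialSystem (m : ℕ) (R : ℝ) (h d v e : ℝ → ℝ) : Prop where
  pos : 0 < R
  int_h : IntegrableOn h (Set.Ioo 0 R)
  int_d : IntegrableOn d (Set.Ioo 0 R)
  h_nonneg : ∀ᵐ s ∂volume.restrict (Set.Ioo 0 R), 0 ≤ h s
  d_nonneg : ∀ᵐ s ∂volume.restrict (Set.Ioo 0 R), 0 ≤ d s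
  v_eq : ∀ᵐ s ∂volume.restrict (Set.Ioo 0 R), v s = ∫ t in (0 : ℝ)..s, d t
  h_eq : ∀ᵐ s ∂volume.restrict (Set.Ioo 0 R),
    s * h s = (m + 1) * (∫ t in (0 : ℝ)..s, h t) + 2 * ∫ t in (0 : ℝ)..s, t * v t
  d_eq : ∀ᵐ s ∂volume.restrict (Set.Ioo 0 R),
    s * d s = (m - 1) * (∫ t in (0 : ℝ)..s, d t) + 2 * (s * e s)
  cauchy_schwarz : ∀ᵐ s ∂volume.restrict (Set.Ioo 0 R), v s ^ 2 ≤ h s * e s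

/-! ### Monotonicity of the frequency of a radial system. -/

namespace RadialSystem

variable {m : ℕ} {R : ℝ} {h d v e : ℝ → ℝ}

/-- The Dirichlet energy in the ball of radius `s`. -/
noncomputable def energy (d : ℝ → ℝ) (s : ℝ) : ℝ := ∫ t in (0 : ℝ)..s, d t

/-- The continuous representative of `h`. -/
noncomputable def height (m : ℕ) (h d : ℝ → ℝ) (s : ℝ) : ℝ :=
  ((m + 1) * (∫ t in (0 : ℝ)..s, h t) + 2 * ∫ t in (0 : ℝ)..s, t * energy d t) / s

/-- Almgren's frequency. -/
noncomputable def frequency (m : ℕ) (h d : ℝ → ℝ) (s : ℝ) : ℝ :=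
  energy d s * (s / height m h d s)

theorem intervalIntegrable_of_Ioo {F : ℝ → ℝ} (hF : IntegrableOn F (Set.Ioo 0 R)) {a b : ℝ}
    (ha : 0 ≤ a) (hab : a ≤ b) (hb : b ≤ R) : IntervalIntegrable F volume a b := by
  rw [intervalIntegrable_iff_integrableOn_Ioo_of_le hab]
  exact hF.mono_set (Set.Ioo_subset_Ioo ha hb)

theorem continuousOn_primitive_Icc (hR : 0 ≤ R) {F : ℝ → ℝ} (hF : IntegrableOn F (Set.Ioo 0 R)) :
    ContinuousOn (fun s => ∫ t in (0 : ℝ)..s, F t) (Set.Icc 0 R) := by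
  have := intervalIntegral.continuousOn_primitive_interval (μ := volume) (f := F) (a := 0) (b := R)
    (by rw [Set.uIcc_of_le hR, integrableOn_Icc_iff_integrableOn_Ioo]; exact hF)
  rwa [Set.uIcc_of_le hR] at this

theorem integral_congr_Ioo {F G : ℝ → ℝ} (hFG : ∀ᵐ s ∂volume.restrict (Set.Ioo 0 R), F s = G s)
    {a b : ℝ} (ha : 0 ≤ a) (hab : a ≤ b) (hb : b ≤ R) :
    ∫ t in a..b, F t = ∫ t in a..b, G t := by
  rw [intervalIntegral.integral_of_le hab, intervalIntegral.integral_of_le hab,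
    integral_Ioc_eq_integral_Ioo, integral_Ioc_eq_integral_Ioo]
  exact integral_congr_ae (ae_restrict_of_ae_restrict_of_subset (Set.Ioo_subset_Ioo ha hb) hFG)

theorem continuousOn_energy (S : RadialSystem m R h d v e) :
    ContinuousOn (energy d) (Set.Icc 0 R) :=
  continuousOn_primitive_Icc S.pos.le S.int_d

theorem energy_nonneg (S : RadialSystem m R h d v e) {s : ℝ} (h0 : 0 ≤ s) (hs : s ≤ R) :
    0 ≤ energy d s := by
  unfold energy
  rw [intervalIntegral.integral_of_le h0, integral_Ioc_eq_integral_Ioo]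
  exact integral_nonneg_of_ae
    (ae_restrict_of_ae_restrict_of_subset (Set.Ioo_subset_Ioo le_rfl hs) S.d_nonneg)

theorem integrableOn_mul_energy (S : RadialSystem m R h d v e) :
    IntegrableOn (fun t => t * energy d t) (Set.Ioo 0 R) :=
  ((continuousOn_id.mul S.continuousOn_energy).integrableOn_Icc).mono_set Set.Ioo_subset_Icc_self

theorem continuousOn_height (S : RadialSystem m R h d v e) :
    ContinuousOn (height m h d) (Set.Ioo 0 R) := by
  unfold height
  refine ContinuousOn.div ?_ continuousOn_id fun x hx => hx.1.ne'
  exact ((continuousOn_const.mul (continuousOn_primitive_Icc S.pos.le S.int_h)).add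
    (continuousOn_const.mul (continuousOn_primitive_Icc S.pos.le
      S.integrableOn_mul_energy))).mono Set.Ioo_subset_Icc_self

theorem height_nonneg (S : RadialSystem m R h d v e) {s : ℝ} (h0 : 0 < s) (hs : s ≤ R) :
    0 ≤ height m h d s := by
  unfold height
  have h1 : 0 ≤ ∫ t in (0 : ℝ)..s, h t := by
    rw [intervalIntegral.integral_of_le h0.le, integral_Ioc_eq_integral_Ioo]
    exact integral_nonneg_of_ae
      (ae_restrict_of_ae_restrict_of_subset (Set.Ioo_subset_Ioo le_rfl hs) S.h_nonneg)
  have h2 : 0 ≤ ∫ t in (0 : ℝ)..s, t * energy d t :=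
    intervalIntegral.integral_nonneg h0.le fun t ht =>
      mul_nonneg ht.1 (S.energy_nonneg ht.1 (ht.2.trans hs))
  positivity

/-- Only integrable functions are given, but `h_eq`, with `v` replaced by the energy, expresses `h`
through primitives. This supplies the continuous representative on which all pointwise arguments are
carried out. -/
theorem ae_eq_height (S : RadialSystem m R h d v e) :
    ∀ᵐ s ∂volume.restrict (Set.Ioo 0 R), h s = height m h d s := by
  filter_upwards [S.h_eq, ae_restrict_mem measurableSet_Ioo] with s hs hm
  unfold height
  have : ∫ t in (0 : ℝ)..s, t * v t = ∫ t in (0 : ℝ)..s, t * energy d t := by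
    apply integral_congr_Ioo (R := R) _ le_rfl hm.1.le hm.2.le
    filter_upwards [S.v_eq] with t ht
    rw [ht, energy]
  rw [← this, ← hs]
  field_simp [hm.1.ne']

theorem hasDerivAt_primitive_of_continuousOn {F G : ℝ → ℝ}
    (hF : IntegrableOn F (Set.Ioo 0 R))
    (hFG : ∀ᵐ s ∂volume.restrict (Set.Ioo 0 R), F s = G s) (hG : ContinuousOn G (Set.Ioo 0 R))
    {s : ℝ} (hs : s ∈ Set.Ioo 0 R) :
    HasDerivAt (fun s => ∫ t in (0 : ℝ)..s, F t) (G s) s := by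
  have hGi : IntegrableOn G (Set.Ioo 0 R) := hF.congr hFG
  have h1 : HasDerivAt (fun s => ∫ t in (0 : ℝ)..s, G t) (G s) s :=
    intervalIntegral.integral_hasDerivAt_right (intervalIntegrable_of_Ioo hGi le_rfl hs.1.le hs.2.le)
      (ContinuousOn.stronglyMeasurableAtFilter isOpen_Ioo hG s hs)
      (hG.continuousAt (isOpen_Ioo.mem_nhds hs))
  refine h1.congr_of_eventuallyEq ?_
  filter_upwards [isOpen_Ioo.mem_nhds hs] with x hx
  exact integral_congr_Ioo hFG le_rfl hx.1.le hx.2.le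

/-- Bootstrap: `h` agrees almost everywhere with a continuous function, so both primitives in the
height are differentiable at every interior radius. Differentiating `s H = (m + 1) ∫ h + 2 ∫ t E`
gives `H + s H' = (m + 1) H + 2 s E`. -/
theorem hasDerivAt_height (S : RadialSystem m R h d v e) {s : ℝ} (hs : s ∈ Set.Ioo 0 R) :
    HasDerivAt (height m h d) (m / s * height m h d s + 2 * energy d s) s := by
  have h1 := hasDerivAt_primitive_of_continuousOn S.int_h S.ae_eq_height
    S.continuousOn_height hs
  have h2 := hasDerivAt_primitive_of_continuousOn S.integrableOn_mul_energy
    (ae_of_all _ fun _ => rfl)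
    ((continuousOn_id.mul S.continuousOn_energy).mono Set.Ioo_subset_Icc_self) hs
  have h3 := ((h1.const_mul ((m : ℝ) + 1)).add (h2.const_mul 2)).div (hasDerivAt_id s) hs.1.ne'
  convert! h3 using 1
  have e1 : height m h d s * s = ((m : ℝ) + 1) * (∫ t in (0 : ℝ)..s, h t) +
      2 * ∫ t in (0 : ℝ)..s, t * energy d t := by
    rw [height]; field_simp [hs.1.ne']
  simp only [id, Pi.add_apply]
  rw [← e1]
  field_simp [hs.1.ne']
  ring

/-- `s^{-m}` times the height is nondecreasing. -/
theorem monotoneOn_height_div (S : RadialSystem m R h d v e) :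
    MonotoneOn (fun s => height m h d s / s ^ m) (Set.Ioo 0 R) := by
  have hd : ∀ s ∈ Set.Ioo 0 R, HasDerivAt (fun s => height m h d s / s ^ m)
      (2 * energy d s / s ^ m) s := by
    intro s hs
    convert! (S.hasDerivAt_height hs).div (hasDerivAt_pow m s) (pow_ne_zero _ hs.1.ne') using 1
    rcases m with _ | m
    · simp
    · have := hs.1.ne'
      simp only [Nat.add_sub_cancel]
      field_simp
      ring
  refine monotoneOn_of_deriv_nonneg (convex_Ioo 0 R)
    (fun s hs => (hd s hs).continuousAt.continuousWithinAt)
    (fun s hs => (hd s (interior_subset hs)).differentiableAt.differentiableWithinAt) ?_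
  intro s hs
  have hs' := interior_subset hs
  rw [(hd s hs').deriv]
  have := S.energy_nonneg hs'.1.le hs'.2.le
  have := hs'.1
  positivity

theorem absolutelyContinuous_div_height (S : RadialSystem m R h d v e) {a b : ℝ} (ha : 0 < a) (hb : b < R)
    (hab : a ≤ b) (hpos : ∀ s ∈ Set.Icc a b, 0 < height m h d s) :
    AbsolutelyContinuousOnInterval (fun s => s / height m h d s) a b := by
  have hsub : Set.Icc a b ⊆ Set.Ioo 0 R := fun x hx => ⟨ha.trans_le hx.1, hx.2.trans_lt hb⟩
  have hc : ContDiffOn ℝ 1 (height m h d) (Set.Ioo 0 R) := by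
    rw [show (1 : ℕ∞ω) = 0 + 1 from rfl, contDiffOn_succ_iff_deriv_of_isOpen isOpen_Ioo]
    refine ⟨fun s hs => (S.hasDerivAt_height hs).differentiableAt.differentiableWithinAt,
      by simp, ?_⟩
    rw [contDiffOn_zero]
    refine ContinuousOn.congr (f := fun s => m / s * height m h d s + 2 * energy d s) ?_
      fun s hs => (S.hasDerivAt_height hs).deriv
    exact ((continuousOn_const.div continuousOn_id fun x hx => hx.1.ne').mul
      S.continuousOn_height).add
      (continuousOn_const.mul (S.continuousOn_energy.mono Set.Ioo_subset_Icc_self))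
  apply ContDiffOn.absolutelyContinuousOnInterval
  rw [Set.uIcc_of_le hab]
  exact contDiffOn_id.div (hc.mono hsub) fun x hx => (hpos x hx).ne'

/-- The height is `C¹`, but the energy is only the primitive of an integrable function. Absolute
continuity is the regularity that survives, and it suffices for integrating a derivative known
almost everywhere. -/
theorem absolutelyContinuous_frequency (S : RadialSystem m R h d v e) {a b : ℝ} (ha : 0 < a)
    (hb : b < R) (hab : a ≤ b) (hpos : ∀ s ∈ Set.Icc a b, 0 < height m h d s) :
    AbsolutelyContinuousOnInterval (frequency m h d) a b := by
  have h1 : AbsolutelyContinuousOnInterval (energy d) 0 R :=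
    (intervalIntegrable_of_Ioo S.int_d le_rfl S.pos.le
      le_rfl).absolutelyContinuousOnInterval_intervalIntegral (by simp)
  have h2 : AbsolutelyContinuousOnInterval (energy d) a b := by
    apply h1.mono
    rw [Set.uIcc_of_le hab, Set.uIcc_of_le S.pos.le]
    exact Set.Icc_subset_Icc ha.le hb.le
  exact h2.mul (S.absolutelyContinuous_div_height ha hb hab hpos)

/-- In the quotient rule for `s E / H` the terms in `E / H` have coefficients `(m - 1) + 1 - m = 0`:
the dimensional term of the inner variation is cancelled by that of the height. Only a
Cauchy–Schwarz defect remains. -/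
theorem ae_hasDerivAt_frequency (S : RadialSystem m R h d v e) :
    ∀ᵐ s ∂volume.restrict (Set.Ioo 0 R), 0 < height m h d s →
      HasDerivAt (frequency m h d)
        (2 * s * (e s - energy d s ^ 2 / height m h d s) / height m h d s) s := by
  have h1 := (intervalIntegrable_of_Ioo S.int_d le_rfl S.pos.le le_rfl).ae_hasDerivAt_integral
  filter_upwards [ae_restrict_of_ae h1, S.d_eq, ae_restrict_mem measurableSet_Ioo]
    with s hs hd hm hpos
  have hs' : HasDerivAt (energy d) (d s) s := by
    have : s ∈ Set.uIcc 0 R := by rw [Set.uIcc_of_le S.pos.le]; exact ⟨hm.1.le, hm.2.le⟩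
    exact hs this 0 (by simp)
  have h2 := hs'.mul ((hasDerivAt_id s).div (S.hasDerivAt_height hm) hpos.ne')
  convert! h2 using 1
  simp only [id, Pi.div_apply]
  have hs0 := hm.1.ne'
  change s * d s = (m - 1) * energy d s + 2 * (s * e s) at hd
  have : d s = ((m - 1) * energy d s + 2 * (s * e s)) / s := by rw [← hd]; field_simp
  rw [this]
  field_simp
  ring

theorem ae_deriv_frequency_nonneg (S : RadialSystem m R h d v e) :
    ∀ᵐ s ∂volume.restrict (Set.Ioo 0 R), 0 < height m h d s → 0 ≤ deriv (frequency m h d) s := by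
  filter_upwards [S.ae_hasDerivAt_frequency, S.v_eq, S.cauchy_schwarz, S.ae_eq_height,
    ae_restrict_mem measurableSet_Ioo] with s hs hv hc hh hm hpos
  rw [(hs hpos).deriv]
  rw [hv, hh] at hc
  have : energy d s ^ 2 / height m h d s ≤ e s := by
    rw [div_le_iff₀ hpos, mul_comm]; exact hc
  have h0 := hm.1
  have : 0 ≤ e s - energy d s ^ 2 / height m h d s := by linarith
  positivity

theorem frequency_le (S : RadialSystem m R h d v e) {a b : ℝ} (ha : 0 < a)
    (hb : b < R) (hab : a ≤ b) (hpos : ∀ s ∈ Set.Icc a b, 0 < height m h d s) :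
    frequency m h d a ≤ frequency m h d b := by
  have h1 := (S.absolutelyContinuous_frequency ha hb hab hpos).integral_deriv_eq_sub
  have h2 : 0 ≤ ∫ x in a..b, deriv (frequency m h d) x := by
    rw [intervalIntegral.integral_of_le hab]
    apply integral_nonneg_of_ae
    have hsub : Set.Ioc a b ⊆ Set.Ioo 0 R := fun x hx => ⟨ha.trans hx.1, hx.2.trans_lt hb⟩
    filter_upwards [ae_restrict_of_ae_restrict_of_subset hsub S.ae_deriv_frequency_nonneg,
      ae_restrict_mem measurableSet_Ioc] with x hx hm
    exact hx (hpos x ⟨hm.1.le, hm.2⟩)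
  linarith

theorem frequency_nonneg (S : RadialSystem m R h d v e) {s : ℝ} (h0 : 0 < s) (hs : s ≤ R) :
    0 ≤ frequency m h d s :=
  mul_nonneg (S.energy_nonneg h0.le hs) (div_nonneg h0.le (S.height_nonneg h0 hs))

/-- Logarithmic derivative of the normalized height. -/
theorem hasDerivAt_log_height (S : RadialSystem m R h d v e) {s : ℝ} (hs : s ∈ Set.Ioo 0 R)
    (hpos : 0 < height m h d s) :
    HasDerivAt (fun s => Real.log (height m h d s) - m * Real.log s)
      (2 * frequency m h d s / s) s := by
  have h1 := ((S.hasDerivAt_height hs).log hpos.ne').sub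
    ((Real.hasDerivAt_log hs.1.ne').const_mul (m : ℝ))
  convert! h1 using 1
  unfold frequency
  have := hs.1.ne'
  field_simp
  ring

/-- The derivative of `log (s^{-m} H)` with respect to `log s` is `2 N(s)`, so a bound for the
frequency is a bound for a slope. -/
theorem log_height_le (S : RadialSystem m R h d v e) {a b N : ℝ} (ha : 0 < a)
    (hb : b < R) (hab : a ≤ b) (hpos : ∀ s ∈ Set.Icc a b, 0 < height m h d s)
    (hN : ∀ s ∈ Set.Icc a b, frequency m h d s ≤ N) :
    Real.log (height m h d b) - m * Real.log b ≤
      Real.log (height m h d a) - m * Real.log a + 2 * N * (Real.log b - Real.log a) := by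
  have hsub : Set.Icc a b ⊆ Set.Ioo 0 R := fun x hx => ⟨ha.trans_le hx.1, hx.2.trans_lt hb⟩
  have hd : ∀ s ∈ Set.Icc a b, HasDerivAt
      (fun s => 2 * N * Real.log s - (Real.log (height m h d s) - m * Real.log s))
      (2 * N * s⁻¹ - 2 * frequency m h d s / s) s := fun s hs =>
    ((Real.hasDerivAt_log (hsub hs).1.ne').const_mul (2 * N)).sub
      (S.hasDerivAt_log_height (hsub hs) (hpos s hs))
  have hm : MonotoneOn
      (fun s => 2 * N * Real.log s - (Real.log (height m h d s) - m * Real.log s))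
      (Set.Icc a b) := by
    refine monotoneOn_of_deriv_nonneg (convex_Icc a b)
      (fun s hs => (hd s hs).continuousAt.continuousWithinAt)
      (fun s hs => (hd s (interior_subset hs)).differentiableAt.differentiableWithinAt) ?_
    intro s hs
    have hs' := interior_subset hs
    rw [(hd s hs').deriv]
    have h0 := (hsub hs').1
    have : 2 * N * s⁻¹ - 2 * frequency m h d s / s = 2 * (N - frequency m h d s) / s := by
      field_simp
    rw [this]
    have := hN s hs'
    have : 0 ≤ N - frequency m h d s := by linarith
    positivity
  have := hm ⟨le_rfl, hab⟩ ⟨hab, le_rfl⟩ hab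
  simp only at this
  linarith

theorem le_log_height (S : RadialSystem m R h d v e) {a b N : ℝ} (ha : 0 < a)
    (hb : b < R) (hab : a ≤ b) (hpos : ∀ s ∈ Set.Icc a b, 0 < height m h d s)
    (hN : ∀ s ∈ Set.Icc a b, N ≤ frequency m h d s) :
    Real.log (height m h d a) - m * Real.log a + 2 * N * (Real.log b - Real.log a) ≤
      Real.log (height m h d b) - m * Real.log b := by
  have hsub : Set.Icc a b ⊆ Set.Ioo 0 R := fun x hx => ⟨ha.trans_le hx.1, hx.2.trans_lt hb⟩
  have hd : ∀ s ∈ Set.Icc a b, HasDerivAt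
      (fun s => (Real.log (height m h d s) - m * Real.log s) - 2 * N * Real.log s)
      (2 * frequency m h d s / s - 2 * N * s⁻¹) s := fun s hs =>
    (S.hasDerivAt_log_height (hsub hs) (hpos s hs)).sub
      ((Real.hasDerivAt_log (hsub hs).1.ne').const_mul (2 * N))
  have hm : MonotoneOn
      (fun s => (Real.log (height m h d s) - m * Real.log s) - 2 * N * Real.log s)
      (Set.Icc a b) := by
    refine monotoneOn_of_deriv_nonneg (convex_Icc a b)
      (fun s hs => (hd s hs).continuousAt.continuousWithinAt)
      (fun s hs => (hd s (interior_subset hs)).differentiableAt.differentiableWithinAt) ?_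
    intro s hs
    have hs' := interior_subset hs
    rw [(hd s hs').deriv]
    have h0 := (hsub hs').1
    have : 2 * frequency m h d s / s - 2 * N * s⁻¹ = 2 * (frequency m h d s - N) / s := by
      field_simp
    rw [this]
    have := hN s hs'
    have : 0 ≤ frequency m h d s - N := by linarith
    positivity
  have := hm ⟨le_rfl, hab⟩ ⟨hab, le_rfl⟩ hab
  simp only at this
  linarith

end RadialSystem

/-! ### Radial unique continuation, growth exponent and homogeneity defect. -/

namespace RadialSystem

variable {m : ℕ} {R : ℝ} {h d v e : ℝ → ℝ}

/-- Unique continuation along the radius: the height has no zeros or vanishes identically. -/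
theorem height_pos_or_eq_zero (S : RadialSystem m R h d v e) :
    (∀ s ∈ Set.Ioo 0 R, height m h d s = 0) ∨ ∀ s ∈ Set.Ioo 0 R, 0 < height m h d s := by
  by_cases hz : ∀ s ∈ Set.Ioo 0 R, height m h d s = 0
  · exact Or.inl hz
  right
  push Not at hz
  obtain ⟨r, hr, hr0⟩ := hz
  have hrpos : 0 < height m h d r := lt_of_le_of_ne (S.height_nonneg hr.1 hr.2.le) hr0.symm
  intro s hs
  by_contra hneg
  have hs0 : height m h d s = 0 := le_antisymm (not_lt.1 hneg) (S.height_nonneg hs.1 hs.2.le)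
  rcases le_total r s with hrs | hsr
  · have := S.monotoneOn_height_div hr hs hrs
    simp only [hs0, zero_div] at this
    have h2 : 0 < height m h d r / r ^ m := by have := hr.1; positivity
    linarith
  -- the last zero below `r`
  have hsub : Set.Icc s r ⊆ Set.Ioo 0 R := fun x hx => ⟨hs.1.trans_le hx.1, hx.2.trans_lt hr.2⟩
  have hcl : IsCompact (Set.Icc s r ∩ height m h d ⁻¹' {0}) :=
    isCompact_Icc.of_isClosed_subset
      ((S.continuousOn_height.mono hsub).preimage_isClosed_of_isClosed isClosed_Icc
        isClosed_singleton) Set.inter_subset_left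
  obtain ⟨a, ha, hmax⟩ := hcl.exists_isGreatest ⟨s, ⟨le_rfl, hsr⟩, hs0⟩
  have haR := hsub ha.1
  have har : a < r := lt_of_le_of_ne ha.1.2 (by rintro rfl; exact hr0 ha.2)
  have hpos : ∀ x ∈ Set.Ioc a r, 0 < height m h d x := by
    intro x hx
    have hxs : x ∈ Set.Icc s r := ⟨ha.1.1.trans hx.1.le, hx.2⟩
    refine lt_of_le_of_ne (S.height_nonneg (hsub hxs).1 (hsub hxs).2.le) fun h0 => ?_
    exact absurd (hmax ⟨hxs, h0.symm⟩) (not_le.2 hx.1)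
  -- On `(a, r]` the height is positive, hence the frequency is at most its value at `r`. This keeps
  -- the logarithm of the height bounded below down to `a > 0`, against the zero at `a`.
  set N := frequency m h d r
  have hlow : ∀ x ∈ Set.Ioc a r, Real.exp (Real.log (height m h d r) - m * Real.log r -
      2 * N * (Real.log r - Real.log x) + m * Real.log x) ≤ height m h d x := by
    intro x hx
    have hx0 : 0 < x := haR.1.trans hx.1
    have := S.log_height_le hx0 hr.2 hx.2 (N := N)
      (fun y hy => hpos y ⟨hx.1.trans_le hy.1, hy.2⟩)
      (fun y hy => S.frequency_le (hx0.trans_le hy.1) hr.2 hy.2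
        fun z hz => hpos z ⟨(hx.1.trans_le hy.1).trans_le hz.1, hz.2⟩)
    rw [← Real.le_log_iff_exp_le (hpos x hx)]
    linarith
  have hcont : ContinuousWithinAt (height m h d) (Set.Ioc a r) a :=
    ((S.continuousOn_height a haR).mono fun x hx => hsub ⟨ha.1.1.trans hx.1.le, hx.2⟩)
  have hlog : ContinuousAt Real.log a := Real.continuousAt_log haR.1.ne'
  have hcont2 : ContinuousWithinAt (fun x => Real.exp (Real.log (height m h d r) - m * Real.log r -
      2 * N * (Real.log r - Real.log x) + m * Real.log x)) (Set.Ioc a r) a := by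
    apply ContinuousAt.continuousWithinAt
    fun_prop
  have hne : (𝓝[Set.Ioc a r] a).NeBot := by
    rw [nhdsWithin_Ioc_eq_nhdsGT har]; infer_instance
  have := le_of_tendsto_of_tendsto hcont2.tendsto hcont.tendsto
    (eventually_nhdsWithin_of_forall hlow)
  have h0 : height m h d a = 0 := ha.2
  rw [h0] at this
  exact absurd (Real.exp_pos _) (not_lt.2 this)

/-- The limit of the frequency at `0`. -/
noncomputable def order (m : ℕ) (R : ℝ) (h d : ℝ → ℝ) : ℝ := sInf (frequency m h d '' Set.Ioo 0 R)

theorem bddBelow_frequency (S : RadialSystem m R h d v e) :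
    BddBelow (frequency m h d '' Set.Ioo 0 R) :=
  ⟨0, by rintro _ ⟨s, hs, rfl⟩; exact S.frequency_nonneg hs.1 hs.2.le⟩

theorem monotoneOn_frequency (S : RadialSystem m R h d v e)
    (hpos : ∀ s ∈ Set.Ioo 0 R, 0 < height m h d s) :
    MonotoneOn (frequency m h d) (Set.Ioo 0 R) := fun _ ha _ hb hab =>
  S.frequency_le ha.1 hb.2 hab fun s hs => hpos s ⟨ha.1.trans_le hs.1, hs.2.trans_lt hb.2⟩

theorem tendsto_frequency (S : RadialSystem m R h d v e)
    (hpos : ∀ s ∈ Set.Ioo 0 R, 0 < height m h d s) :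
    Tendsto (frequency m h d) (𝓝[>] 0) (𝓝 (order m R h d)) :=
  (S.monotoneOn_frequency hpos).tendsto_nhdsWithin_Ioo_right (Set.nonempty_Ioo.2 S.pos)
    S.bddBelow_frequency

theorem order_le_frequency (S : RadialSystem m R h d v e) {s : ℝ} (hs : s ∈ Set.Ioo 0 R) :
    order m R h d ≤ frequency m h d s :=
  csInf_le S.bddBelow_frequency ⟨s, hs, rfl⟩

/-- As a function of `log s`, the normalized logarithm of the height lies between the lines of
slopes `2 κ` and `2 N(r)` through its value at a fixed `r`. Dividing by `log s → -∞` kills the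
constants, and `N(r)` is as close to `κ` as desired. -/
theorem tendsto_log_height (S : RadialSystem m R h d v e)
    (hpos : ∀ s ∈ Set.Ioo 0 R, 0 < height m h d s) :
    Tendsto (fun s => (Real.log (height m h d s) - m * Real.log s) / Real.log s) (𝓝[>] 0)
      (𝓝 (2 * order m R h d)) := by
  set κ := order m R h d
  set L := fun s => Real.log (height m h d s) - m * Real.log s with hL
  have hlog : Tendsto Real.log (𝓝[>] 0) atBot := Real.tendsto_log_nhdsGT_zero
  have hIoo : ∀ r, 0 < r → ∀ᶠ s in 𝓝[>] (0 : ℝ), s ∈ Set.Ioo 0 r := fun r hr =>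
    Ioo_mem_nhdsGT hr
  have key : ∀ r ∈ Set.Ioo 0 R, ∀ N, Tendsto
      (fun s => 2 * N + (L r - 2 * N * Real.log r) / Real.log s) (𝓝[>] 0) (𝓝 (2 * N)) := by
    intro r _ N
    have : Tendsto (fun s => (L r - 2 * N * Real.log r) / Real.log s) (𝓝[>] 0) (𝓝 0) :=
      hlog.const_div_atBot _
    simpa using this.const_add (2 * N)
  have hneg : ∀ᶠ s in 𝓝[>] (0 : ℝ), Real.log s < 0 := hlog.eventually_lt_atBot 0
  rw [tendsto_order]
  constructor
  · intro a ha
    set r := R / 2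
    have hr : r ∈ Set.Ioo 0 R := ⟨half_pos S.pos, half_lt_self S.pos⟩
    filter_upwards [(key r hr κ).eventually_const_lt ha, hneg, hIoo r hr.1] with s h1 h2 h3
    refine h1.trans_le ?_
    rw [← sub_nonneg]
    have hle := S.le_log_height h3.1 hr.2 h3.2.le (N := κ)
      (fun y hy => hpos y ⟨h3.1.trans_le hy.1, hy.2.trans_lt hr.2⟩)
      (fun y hy => S.order_le_frequency ⟨h3.1.trans_le hy.1, hy.2.trans_lt hr.2⟩)
    have e1 : L s / Real.log s - (2 * κ + (L r - 2 * κ * Real.log r) / Real.log s) =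
        (L s - (L r - 2 * κ * Real.log r + 2 * κ * Real.log s)) / Real.log s := by
      field_simp [h2.ne]; ring
    change 0 ≤ L s / Real.log s - _
    rw [e1]
    apply div_nonneg_of_nonpos _ h2.le
    simp only [hL]
    linarith
  · intro b hb
    have : ∀ᶠ r in 𝓝[>] (0 : ℝ), 2 * frequency m h d r < b :=
      ((S.tendsto_frequency hpos).const_mul 2).eventually_lt_const hb
    obtain ⟨r, hrb, hr⟩ := (this.and (hIoo R S.pos)).exists
    set N := frequency m h d r
    filter_upwards [(key r hr N).eventually_lt_const hrb, hneg, hIoo r hr.1] with s h1 h2 h3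
    refine lt_of_le_of_lt ?_ h1
    rw [← sub_nonneg]
    have hle := S.log_height_le h3.1 hr.2 h3.2.le (N := N)
      (fun y hy => hpos y ⟨h3.1.trans_le hy.1, hy.2.trans_lt hr.2⟩)
      (fun y hy => S.monotoneOn_frequency hpos ⟨h3.1.trans_le hy.1, hy.2.trans_lt hr.2⟩ hr hy.2)
    have e1 : (2 * N + (L r - 2 * N * Real.log r) / Real.log s) - L s / Real.log s =
        ((L r - 2 * N * Real.log r + 2 * N * Real.log s) - L s) / Real.log s := by
      field_simp [h2.ne]; ring
    change 0 ≤ _ - L s / Real.log s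
    rw [e1]
    apply div_nonneg_of_nonpos _ h2.le
    simp only [hL]
    linarith

theorem intervalIntegrable_pow_Icc (a b : ℝ) (m : ℕ) :
    IntervalIntegrable (fun s : ℝ => s ^ m) volume a b := (continuous_pow m).intervalIntegrable _ _

theorem integral_pow_pos {r : ℝ} (hr : 0 < r) (m : ℕ) : 0 < ∫ s in r..(2 * r), s ^ m := by
  apply intervalIntegral.intervalIntegral_pos_of_pos_on (intervalIntegrable_pow_Icc _ _ _) _
    (by linarith)
  intro x hx
  have : 0 < x := hr.trans hx.1
  positivity

/-- The quotient of integrals is the mean of `h / s^m` with weight `s^m`, and `h / s^m` agrees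
almost everywhere with a nondecreasing function. -/
theorem average_bounds (S : RadialSystem m R h d v e) {r : ℝ} (hr : 0 < r) (hrR : 2 * r < R) :
    height m h d r / r ^ m ≤ (∫ s in r..(2 * r), h s) / ∫ s in r..(2 * r), s ^ m ∧
    (∫ s in r..(2 * r), h s) / (∫ s in r..(2 * r), s ^ m) ≤
      height m h d (2 * r) / (2 * r) ^ m := by
  have hp := integral_pow_pos hr m
  have hr2 : r ≤ 2 * r := by linarith
  have hsub : Set.Icc r (2 * r) ⊆ Set.Ioo 0 R := fun x hx =>
    ⟨hr.trans_le hx.1, hx.2.trans_lt hrR⟩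
  rw [integral_congr_Ioo S.ae_eq_height hr.le hr2 hrR.le]
  have hi : IntervalIntegrable (height m h d) volume r (2 * r) := by
    apply ContinuousOn.intervalIntegrable
    rw [Set.uIcc_of_le hr2]
    exact S.continuousOn_height.mono hsub
  have h1 := S.monotoneOn_height_div
  rw [le_div_iff₀ hp, div_le_iff₀ hp, ← intervalIntegral.integral_const_mul,
    ← intervalIntegral.integral_const_mul]
  constructor
  · apply intervalIntegral.integral_mono_on hr2
      ((intervalIntegrable_pow_Icc _ _ _).const_mul _) hi
    intro x hx
    have hx0 : 0 < x ^ m := pow_pos (hsub hx).1 m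
    rw [← le_div_iff₀ hx0]
    exact h1 (hsub ⟨le_rfl, hr2⟩) (hsub hx) hx.1
  · apply intervalIntegral.integral_mono_on hr2 hi
      ((intervalIntegrable_pow_Icc _ _ _).const_mul _)
    intro x hx
    have hx0 : 0 < x ^ m := pow_pos (hsub hx).1 m
    rw [← div_le_iff₀ hx0]
    exact h1 (hsub hx) (hsub ⟨hr2, le_rfl⟩) hx.2

/-- The average is squeezed between the normalized heights at `r` and `2 r`; doubling the radius and
multiplying by `c` change logarithms by bounded amounts only. The constant `c` makes room for the
total mass of the sphere measure. -/
theorem tendsto_log_average (S : RadialSystem m R h d v e)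
    (hpos : ∀ s ∈ Set.Ioo 0 R, 0 < height m h d s) {c : ℝ} (hc : 0 < c) :
    Tendsto (fun r => Real.log (c * ((∫ s in r..(2 * r), h s) / ∫ s in r..(2 * r), s ^ m)) /
      (2 * Real.log r)) (𝓝[>] 0) (𝓝 (order m R h d)) := by
  set κ := order m R h d
  set L := fun s => Real.log (height m h d s) - m * Real.log s with hL
  have hlog : Tendsto Real.log (𝓝[>] 0) atBot := Real.tendsto_log_nhdsGT_zero
  have hneg : ∀ᶠ s in 𝓝[>] (0 : ℝ), Real.log s < 0 := hlog.eventually_lt_atBot 0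
  have t1 := S.tendsto_log_height hpos
  have h2 : Tendsto (fun r : ℝ => 2 * r) (𝓝[>] 0) (𝓝[>] 0) := by
    refine tendsto_nhdsWithin_iff.2 ⟨?_, ?_⟩
    · have : Tendsto (fun r : ℝ => 2 * r) (𝓝 0) (𝓝 (2 * 0)) := tendsto_id.const_mul 2
      rw [mul_zero] at this
      exact this.mono_left nhdsWithin_le_nhds
    · filter_upwards [self_mem_nhdsWithin] with r hr
      exact mul_pos two_pos (Set.mem_Ioi.1 hr)
  have hlogc : Tendsto (fun r => Real.log c / Real.log r) (𝓝[>] 0) (𝓝 0) :=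
    hlog.const_div_atBot _
  have hlog2 : Tendsto (fun r => Real.log 2 / Real.log r) (𝓝[>] 0) (𝓝 0) :=
    hlog.const_div_atBot _
  have t2 : Tendsto (fun r => L (2 * r) / Real.log r) (𝓝[>] 0) (𝓝 (2 * κ)) := by
    have h3 := ((t1.comp h2).mul (hlog2.add_const 1))
    rw [zero_add, mul_one] at h3
    refine h3.congr' ?_
    filter_upwards [hneg, h2.eventually hneg, self_mem_nhdsWithin] with r hr hr2 hr0
    have : Real.log (2 * r) = Real.log 2 + Real.log r := Real.log_mul two_ne_zero hr0.ne'
    have h5 : Real.log 2 / Real.log r + 1 = Real.log (2 * r) / Real.log r := by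
      rw [this]; field_simp [hr.ne]
    simp only [Function.comp]
    rw [h5]
    have := hr.ne
    have := hr2.ne
    change L (2 * r) / Real.log (2 * r) * _ = _
    field_simp
  have u1 := (t1.add hlogc).div_const 2
  have u2 := (t2.add hlogc).div_const 2
  rw [add_zero, mul_div_cancel_left₀ _ two_ne_zero] at u1 u2
  have hR2 : ∀ᶠ r in 𝓝[>] (0 : ℝ), r ∈ Set.Ioo 0 (R / 2) := Ioo_mem_nhdsGT (half_pos S.pos)
  refine tendsto_of_tendsto_of_tendsto_of_le_of_le' u2 u1 ?_ ?_
  · filter_upwards [hneg, hR2] with r hr hr2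
    have hrR : 2 * r < R := by linarith [hr2.2]
    have hb := (S.average_bounds hr2.1 hrR)
    have hp : 0 < height m h d r / r ^ m :=
      div_pos (hpos r ⟨hr2.1, by linarith [hr2.1]⟩) (pow_pos hr2.1 m)
    have hp2 := hpos (2 * r) ⟨by linarith [hr2.1], hrR⟩
    have h0 := hr2.1
    have := Real.log_le_log (hp.trans_le hb.1) hb.2
    rw [Real.log_div hp2.ne' (pow_pos (by linarith) m).ne', Real.log_pow] at this
    rw [Real.log_mul hc.ne' (hp.trans_le hb.1).ne']
    have e1 : (L (2 * r) / Real.log r + Real.log c / Real.log r) / 2 =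
      (Real.log c + L (2 * r)) / (2 * Real.log r) := by field_simp; ring
    rw [e1]
    apply div_le_div_of_nonpos_of_le (by linarith)
    simp only [hL]
    linarith
  · filter_upwards [hneg, hR2] with r hr hr2
    have hrR : 2 * r < R := by linarith [hr2.2]
    have hb := (S.average_bounds hr2.1 hrR)
    have hp' := hpos r ⟨hr2.1, by linarith [hr2.1]⟩
    have hp : 0 < height m h d r / r ^ m := div_pos hp' (pow_pos hr2.1 m)
    have h0 := hr2.1
    have := Real.log_le_log hp hb.1
    rw [Real.log_div hp'.ne' (pow_pos (by linarith) m).ne', Real.log_pow] at this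
    rw [Real.log_mul hc.ne' (hp.trans_le hb.1).ne']
    change _ ≤ (L r / Real.log r + Real.log c / Real.log r) / 2
    have e1 : (L r / Real.log r + Real.log c / Real.log r) / 2 =
      (Real.log c + L r) / (2 * Real.log r) := by field_simp; ring
    rw [e1]
    apply div_le_div_of_nonpos_of_le (by linarith)
    simp only [hL]
    linarith

/-- The defect from homogeneity on the annulus of radii `r, 2 r`. -/
theorem homogeneity_defect_le (S : RadialSystem m R h d v e)
    (hpos : ∀ s ∈ Set.Ioo 0 R, 0 < height m h d s) {r : ℝ} (hr : 0 < r) (hrR : 2 * r ≤ R / 2) :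
    ∫ s in r..(2 * r), (s ^ 2 * e s - 2 * order m R h d * (s * v s) + order m R h d ^ 2 * h s) ≤
      Real.exp ((m + 2 * frequency m h d (R / 2)) * Real.log 2) *
        ((frequency m h d (2 * r) - frequency m h d r) +
          (frequency m h d (2 * r) - order m R h d) ^ 2) * ∫ s in r..(2 * r), h s := by
  have hR := S.pos
  set κ := order m R h d
  set N := frequency m h d
  have hr2 : r ≤ 2 * r := by linarith
  have hsub : Set.Icc r (2 * r) ⊆ Set.Ioo 0 R := fun x hx =>
    ⟨hr.trans_le hx.1, by linarith [hx.2]⟩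
  have hsubo : Set.Ioo r (2 * r) ⊆ Set.Ioo 0 R := Set.Ioo_subset_Icc_self.trans hsub
  have hac := S.absolutelyContinuous_frequency hr (by linarith : 2 * r < R) hr2
    (fun s hs => hpos s (hsub hs))
  have hinc : ∀ s ∈ Set.Icc r (2 * r), height m h d s ≤ height m h d (2 * r) := by
    intro s hs
    have h1 := S.monotoneOn_height_div (hsub hs) (hsub ⟨hr2, le_rfl⟩) hs.2
    have hs0 : 0 < s := (hsub hs).1
    simp only at h1
    rw [div_le_iff₀ (pow_pos hs0 m)] at h1
    refine h1.trans ?_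
    rw [div_mul_eq_mul_div, div_le_iff₀ (pow_pos (by linarith) m)]
    gcongr
    · exact (hpos _ (hsub ⟨hr2, le_rfl⟩)).le
    · exact hs.2
  have hincr : ∀ s ∈ Set.Icc r (2 * r), height m h d r ≤ height m h d s := by
    intro s hs
    have h1 := S.monotoneOn_height_div (hsub ⟨le_rfl, hr2⟩) (hsub hs) hs.1
    have hs0 : 0 < s := (hsub hs).1
    simp only at h1
    rw [le_div_iff₀ (pow_pos hs0 m)] at h1
    refine le_trans ?_ h1
    rw [div_mul_eq_mul_div, le_div_iff₀ (pow_pos hr m)]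
    have := (hpos _ (hsub ⟨le_rfl, hr2⟩)).le
    gcongr
    exact hs.1
  set H2 := height m h d (2 * r) with hH2
  have hH2p : 0 < H2 := hpos _ (hsub ⟨hr2, le_rfl⟩)
  -- pointwise estimate
  have hpt : ∀ᵐ s ∂volume.restrict (Set.Ioo r (2 * r)),
      s ^ 2 * e s - 2 * κ * (s * v s) + κ ^ 2 * h s ≤
        r * H2 * deriv N s + H2 * (N (2 * r) - κ) ^ 2 := by
    filter_upwards [ae_restrict_of_ae_restrict_of_subset hsubo S.ae_hasDerivAt_frequency,
      ae_restrict_of_ae_restrict_of_subset hsubo S.ae_deriv_frequency_nonneg,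
      ae_restrict_of_ae_restrict_of_subset hsubo S.v_eq,
      ae_restrict_of_ae_restrict_of_subset hsubo S.ae_eq_height,
      ae_restrict_mem measurableSet_Ioo] with s hd hn hv hh hm
    have hsI : s ∈ Set.Icc r (2 * r) := Set.Ioo_subset_Icc_self hm
    have hsp := hpos s (hsub hsI)
    have hN0 : 0 ≤ deriv N s := hn hsp
    have hdN : deriv N s = _ := (hd hsp).deriv
    have hv' : v s = energy d s := hv
    -- The defect splits into two nonnegative parts: the Cauchy–Schwarz defect, which is exactly
    -- what `N'` measures, and the distance of the frequency from its limit.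
    have e1 : s ^ 2 * e s - 2 * κ * (s * v s) + κ ^ 2 * h s =
        s / 2 * height m h d s * deriv N s + height m h d s * (N s - κ) ^ 2 := by
      rw [hdN, hv', hh]
      simp only [N, frequency]
      have := hm.1
      field_simp
      ring
    rw [e1]
    have hs0 : 0 < s := hr.trans hm.1
    have k1 : s / 2 ≤ r := by linarith [hm.2]
    have k2 := hinc s hsI
    have k3 : N s ≤ N (2 * r) := S.monotoneOn_frequency hpos (hsub hsI) (hsub ⟨hr2, le_rfl⟩) hm.2.le
    have k4 : κ ≤ N s := S.order_le_frequency (hsub hsI)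
    have k5 : 0 ≤ N s - κ := by linarith
    gcongr
  -- the integral
  have hint : ∫ s in r..(2 * r), (r * H2 * deriv N s + H2 * (N (2 * r) - κ) ^ 2) =
      r * H2 * (N (2 * r) - N r) + r * (H2 * (N (2 * r) - κ) ^ 2) := by
    rw [intervalIntegral.integral_add (hac.intervalIntegrable_deriv.const_mul _) (by simp),
      intervalIntegral.integral_const_mul, hac.integral_deriv_eq_sub]
    simp only [intervalIntegral.integral_const, smul_eq_mul]
    ring
  have hNle : N r ≤ N (2 * r) :=
    S.monotoneOn_frequency hpos (hsub ⟨le_rfl, hr2⟩) (hsub ⟨hr2, le_rfl⟩) hr2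
  have hlow : r * height m h d r ≤ ∫ s in r..(2 * r), h s := by
    rw [integral_congr_Ioo S.ae_eq_height hr.le hr2 (by linarith)]
    have : ∫ s in r..(2 * r), height m h d r = r * height m h d r := by
      simp only [intervalIntegral.integral_const, smul_eq_mul]; ring
    rw [← this]
    apply intervalIntegral.integral_mono_on hr2 (by simp) _ hincr
    apply ContinuousOn.intervalIntegrable
    rw [Set.uIcc_of_le hr2]
    exact S.continuousOn_height.mono hsub
  -- Doubling with the constant `2^(m + 2 N(R/2))`, which does not depend on `r`: on `[r, 2 r]` the
  -- frequency is at most its value at `R / 2`.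
  have hdoub : H2 ≤ Real.exp ((m + 2 * N (R / 2)) * Real.log 2) * height m h d r := by
    have h1 := S.log_height_le hr (by linarith : 2 * r < R) hr2 (N := N (R / 2))
      (fun s hs => hpos s (hsub hs)) (fun s hs => S.monotoneOn_frequency hpos (hsub hs)
        ⟨half_pos hR, half_lt_self hR⟩ (hs.2.trans hrR))
    rw [Real.log_mul two_ne_zero hr.ne', ← hH2] at h1
    rw [← Real.log_le_log_iff hH2p (mul_pos (Real.exp_pos _) (hpos r (hsub ⟨le_rfl, hr2⟩))),
      Real.log_mul (Real.exp_pos _).ne' (hpos r (hsub ⟨le_rfl, hr2⟩)).ne', Real.log_exp]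
    linarith
  set K := Real.exp ((m + 2 * N (R / 2)) * Real.log 2)
  set δ := (N (2 * r) - N r) + (N (2 * r) - κ) ^ 2 with hδ
  have hδ0 : 0 ≤ δ := add_nonneg (by linarith) (sq_nonneg _)
  have hK : 0 < K := Real.exp_pos _
  have final : r * H2 * (N (2 * r) - N r) + r * (H2 * (N (2 * r) - κ) ^ 2) ≤
      K * δ * ∫ s in r..(2 * r), h s := by
    calc _ = r * δ * H2 := by rw [hδ]; ring
      _ ≤ r * δ * (K * height m h d r) := by gcongr
      _ = K * δ * (r * height m h d r) := by ring
      _ ≤ _ := by gcongr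
  refine le_trans ?_ final
  rw [← hint]
  -- Integrability of `e` is not part of the system. If the integrand is not integrable, its
  -- integral has the default value `0`, and the bound is nonnegative.
  by_cases hi : IntervalIntegrable (fun s => s ^ 2 * e s - 2 * κ * (s * v s) + κ ^ 2 * h s)
      volume r (2 * r)
  · refine intervalIntegral.integral_mono_ae_restrict hr2 hi
      ((hac.intervalIntegrable_deriv.const_mul _).add (by simp)) ?_
    rw [← Measure.restrict_congr_set Ioo_ae_eq_Icc]
    exact hpt
  · rw [intervalIntegral.integral_undef hi, hint]
    have : 0 ≤ N (2 * r) - N r := by linarith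
    positivity

/-- The frequency controls the growth of `h` and forces asymptotic homogeneity. -/
theorem asymptotics (S : RadialSystem m R h d v e) :
    (∀ᵐ s ∂volume.restrict (Set.Ioo 0 R), h s = 0) ∨
    ((∀ r, 0 < r → 2 * r < R → 0 < ∫ s in r..(2 * r), h s) ∧ ∃ κ : ℝ,
      (∀ c > 0, Tendsto (fun r => Real.log (c * ((∫ s in r..(2 * r), h s) /
        ∫ s in r..(2 * r), s ^ m)) / (2 * Real.log r)) (𝓝[>] 0) (𝓝 κ)) ∧
      ∃ ε : ℝ → ℝ, (∀ r, 0 < r → 2 * r ≤ R / 2 → 0 ≤ ε r) ∧ Tendsto ε (𝓝[>] 0) (𝓝 0) ∧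
        ∀ r, 0 < r → 2 * r ≤ R / 2 →
          ∫ s in r..(2 * r), (s ^ 2 * e s - 2 * κ * (s * v s) + κ ^ 2 * h s) ≤
            ε r * ∫ s in r..(2 * r), h s) := by
  rcases S.height_pos_or_eq_zero with h0 | hpos
  · left
    filter_upwards [S.ae_eq_height, ae_restrict_mem measurableSet_Ioo] with s hs hm
    rw [hs, h0 s hm]
  right
  have hR := S.pos
  refine ⟨fun r hr hrR => ?_, order m R h d, fun c hc => S.tendsto_log_average hpos hc,
    fun r => Real.exp ((m + 2 * frequency m h d (R / 2)) * Real.log 2) *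
        ((frequency m h d (2 * r) - frequency m h d r) +
          (frequency m h d (2 * r) - order m R h d) ^ 2), ?_, ?_,
    fun r hr hrR => S.homogeneity_defect_le hpos hr hrR⟩
  · have := (S.average_bounds hr hrR).1
    have h1 : 0 < height m h d r / r ^ m :=
      div_pos (hpos r ⟨hr, by linarith⟩) (pow_pos hr m)
    have h2 := h1.trans_le this
    have h3 := integral_pow_pos hr m
    exact (div_pos_iff_of_pos_right h3).1 h2
  · intro r hr hrR
    have : frequency m h d r ≤ frequency m h d (2 * r) :=
      S.monotoneOn_frequency hpos ⟨hr, by linarith⟩ ⟨by linarith, by linarith⟩ (by linarith)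
    have : 0 ≤ frequency m h d (2 * r) - frequency m h d r := by linarith
    positivity
  · have h2 : Tendsto (fun r : ℝ => 2 * r) (𝓝[>] 0) (𝓝[>] 0) := by
      refine tendsto_nhdsWithin_iff.2 ⟨?_, ?_⟩
      · have : Tendsto (fun r : ℝ => 2 * r) (𝓝 0) (𝓝 (2 * 0)) := tendsto_id.const_mul 2
        rw [mul_zero] at this
        exact this.mono_left nhdsWithin_le_nhds
      · filter_upwards [self_mem_nhdsWithin] with r hr
        exact mul_pos two_pos (Set.mem_Ioi.1 hr)
    have t := S.tendsto_frequency hpos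
    have t2 := t.comp h2
    have := (((t2.sub t).add ((t2.sub_const (order m R h d)).pow 2)).const_mul
      (Real.exp ((m + 2 * frequency m h d (R / 2)) * Real.log 2)))
    simpa using this

end RadialSystem

/-! ### Polar coordinates about a point. -/

section Polar

variable {n : ℕ}

/-- The measure `r^(n-1) dr` on the half-line. -/
noncomputable def radialMeasure (n : ℕ) : Measure ℝ :=
  (volume.restrict (Set.Ioi 0)).withDensity fun r => ENNReal.ofReal (r ^ (n - 1))

theorem measurable_radialDensity (n : ℕ) :
    Measurable fun r : ℝ => ENNReal.ofReal (r ^ (n - 1)) := by fun_prop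

theorem map_volumeIoiPow (n : ℕ) :
    (Measure.volumeIoiPow (n - 1)).map Subtype.val = radialMeasure n := by
  ext A hA
  rw [Measure.map_apply measurable_subtype_coe hA, Measure.volumeIoiPow, radialMeasure,
    withDensity_apply _ (measurable_subtype_coe hA), withDensity_apply _ hA,
    Measure.restrict_restrict hA, setLIntegral_subtype measurableSet_Ioi _
      fun a : ℝ ↦ ENNReal.ofReal (a ^ (n - 1))]
  congr 2
  simp [Set.inter_comm]

instance (n : ℕ) : SFinite (radialMeasure n) := by
  unfold radialMeasure; infer_instance

/-- The density is positive on the half-line, so it creates no new null sets. -/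
theorem ae_radialMeasure {p : ℝ → Prop} :
    (∀ᵐ r ∂radialMeasure n, p r) ↔ ∀ᵐ r ∂volume.restrict (Set.Ioi 0), p r := by
  unfold radialMeasure
  rw [ae_withDensity_iff (measurable_radialDensity n)]
  constructor
  · intro h
    filter_upwards [h, ae_restrict_mem measurableSet_Ioi] with r hr hm
    apply hr
    have : 0 < r ^ (n - 1) := pow_pos hm _
    simpa using this
  · intro h
    filter_upwards [h] with r hr _ using hr

/-- The polar homeomorphism lives on the punctured space, with radii in the subtype of positive
reals. The origin is null, and `radialMeasure` is concentrated on positive radii, so the map can be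
taken on all real radii. -/
theorem measurePreserving_polar (hn : 1 ≤ n) :
    MeasurePreserving (fun p : sphere (0 : Euc n) 1 × ℝ => p.2 • (p.1 : Euc n))
      ((volume : Measure (Euc n)).toSphere.prod (radialMeasure n)) volume := by
  have hne : Nontrivial (Euc n) := by
    have : Nonempty (Fin n) := ⟨⟨0, hn⟩⟩
    infer_instance
  have h1 := ((volume : Measure (Euc n)).measurePreserving_homeomorphUnitSphereProd).symm
    (homeomorphUnitSphereProd (Euc n)).toMeasurableEquiv
  have h2 : MeasurePreserving (Subtype.val : ({(0 : Euc n)}ᶜ : Set (Euc n)) → Euc n)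
      (volume.comap Subtype.val) volume := by
    refine ⟨measurable_subtype_coe, ?_⟩
    rw [(MeasurableEmbedding.subtype_coe (measurableSet_singleton _).compl).map_comap,
      Subtype.range_coe, restrict_compl_singleton]
  have h3 := h2.comp h1
  have hfin : Module.finrank ℝ (Euc n) = n := by simp
  rw [hfin] at h3
  have hm : MeasurePreserving (Prod.map id Subtype.val :
      sphere (0 : Euc n) 1 × Set.Ioi (0 : ℝ) → sphere (0 : Euc n) 1 × ℝ)
      ((volume : Measure (Euc n)).toSphere.prod (Measure.volumeIoiPow (n - 1)))
      ((volume : Measure (Euc n)).toSphere.prod (radialMeasure n)) :=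
    (MeasurePreserving.id _).prod ⟨measurable_subtype_coe, map_volumeIoiPow n⟩
  have hmeas : Measurable (fun p : sphere (0 : Euc n) 1 × ℝ => p.2 • (p.1 : Euc n)) := by
    fun_prop
  refine ⟨hmeas, ?_⟩
  rw [← hm.map_eq, Measure.map_map hmeas hm.measurable]
  exact h3.map_eq

/-- `r^(n-1)` times the integral of `F` over the unit sphere about `x` scaled by `r`. -/
noncomputable def sphereIntegral (x : Euc n) (F : Euc n → ℝ) (r : ℝ) : ℝ :=
  r ^ (n - 1) * ∫ θ, F (x + r • (θ : Euc n)) ∂(volume : Measure (Euc n)).toSphere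

theorem integrable_polar (hn : 1 ≤ n) {G : Euc n → ℝ} (hG : Integrable G) :
    Integrable (fun p : sphere (0 : Euc n) 1 × ℝ => G (p.2 • (p.1 : Euc n)))
      ((volume : Measure (Euc n)).toSphere.prod (radialMeasure n)) :=
  (measurePreserving_polar hn).integrable_comp_of_integrable hG

theorem integral_radialMeasure (φ : ℝ → ℝ) :
    ∫ r, φ r ∂radialMeasure n = ∫ r in Set.Ioi 0, r ^ (n - 1) * φ r := by
  unfold radialMeasure
  simp only [ENNReal.ofReal]
  rw [integral_withDensity_eq_integral_smul (by fun_prop)]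
  refine setIntegral_congr_fun measurableSet_Ioi fun r hr => ?_
  rw [NNReal.smul_def, Real.coe_toNNReal _ (pow_nonneg hr.out.le _), smul_eq_mul]

theorem integrable_radialMeasure {φ : ℝ → ℝ} (h : Integrable φ (radialMeasure n)) :
    IntegrableOn (fun r => r ^ (n - 1) * φ r) (Set.Ioi 0) := by
  unfold radialMeasure at h
  simp only [ENNReal.ofReal] at h
  rw [integrable_withDensity_iff_integrable_smul (by fun_prop)] at h
  refine IntegrableOn.congr_fun h (fun r hr => ?_) measurableSet_Ioi
  rw [NNReal.smul_def, Real.coe_toNNReal _ (pow_nonneg hr.out.le _), smul_eq_mul]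

theorem indicator_ball_polar {x : Euc n} {R : ℝ} (F : Euc n → ℝ) {r : ℝ} (hr : 0 < r)
    (θ : sphere (0 : Euc n) 1) :
    (ball (0 : Euc n) R).indicator (fun z => F (x + z)) (r • (θ : Euc n)) =
      (Set.Ioo 0 R).indicator (fun r => F (x + r • (θ : Euc n))) r := by
  have h1 : ‖(θ : Euc n)‖ = 1 := by simp
  have : r • (θ : Euc n) ∈ ball (0 : Euc n) R ↔ r ∈ Set.Ioo 0 R := by
    simp [norm_smul, h1, abs_of_pos hr, hr]
  by_cases h : r ∈ Set.Ioo 0 R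
  · rw [Set.indicator_of_mem (this.2 h), Set.indicator_of_mem h]
  · rw [Set.indicator_of_notMem (fun h' => h (this.1 h')), Set.indicator_of_notMem h]

theorem integrable_indicator_translate {x : Euc n} {R : ℝ} {F : Euc n → ℝ}
    (hF : IntegrableOn F (ball x R)) :
    Integrable ((ball (0 : Euc n) R).indicator fun z => F (x + z)) := by
  have h1 : Integrable ((ball x R).indicator F) := (integrable_indicator_iff measurableSet_ball).2 hF
  have h2 := h1.comp_add_left x
  convert! h2 using 1
  ext z
  by_cases h : z ∈ ball (0 : Euc n) R
  · rw [Set.indicator_of_mem h, Set.indicator_of_mem (by simpa using h)]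
  · rw [Set.indicator_of_notMem h, Set.indicator_of_notMem (by simpa using h)]

theorem ae_integrable_sphere (hn : 1 ≤ n) {x : Euc n} {R : ℝ} {F : Euc n → ℝ}
    (hF : IntegrableOn F (ball x R)) :
    ∀ᵐ r ∂volume.restrict (Set.Ioo 0 R),
      Integrable (fun θ : sphere (0 : Euc n) 1 => F (x + r • (θ : Euc n)))
        (volume : Measure (Euc n)).toSphere := by
  have h1 := (integrable_polar hn (integrable_indicator_translate hF)).prod_left_ae
  rw [ae_radialMeasure] at h1
  filter_upwards [ae_restrict_of_ae_restrict_of_subset (Set.Ioo_subset_Ioi_self) h1,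
    ae_restrict_mem measurableSet_Ioo] with r hr hm
  refine hr.congr (ae_of_all _ fun θ => ?_)
  simp only
  rw [indicator_ball_polar F hm.1, Set.indicator_of_mem hm]

theorem integral_indicator_polar {x : Euc n} {R : ℝ} (F : Euc n → ℝ) {r : ℝ} (hr : 0 < r) :
    r ^ (n - 1) * ∫ θ : sphere (0 : Euc n) 1,
        (ball (0 : Euc n) R).indicator (fun z => F (x + z)) (r • (θ : Euc n))
          ∂(volume : Measure (Euc n)).toSphere =
      (Set.Ioo 0 R).indicator (sphereIntegral x F) r := by
  simp_rw [indicator_ball_polar F hr]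
  by_cases h : r ∈ Set.Ioo 0 R
  · simp [Set.indicator_of_mem h, sphereIntegral]
  · simp [Set.indicator_of_notMem h]

theorem integrableOn_sphereIntegral (hn : 1 ≤ n) {x : Euc n} {R : ℝ} {F : Euc n → ℝ}
    (hF : IntegrableOn F (ball x R)) : IntegrableOn (sphereIntegral x F) (Set.Ioo 0 R) := by
  have h1 := integrable_radialMeasure
    (integrable_polar hn (integrable_indicator_translate hF)).integral_prod_right
  have h2 : IntegrableOn ((Set.Ioo 0 R).indicator (sphereIntegral x F)) (Set.Ioi 0) :=
    h1.congr_fun (fun r hr => integral_indicator_polar F hr) measurableSet_Ioi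
  have h3 := h2.mono_set (show Set.Ioo 0 R ⊆ Set.Ioi 0 from fun r hr => hr.1)
  exact h3.congr_fun (fun r hr => Set.indicator_of_mem hr _) measurableSet_Ioo

theorem integral_ball_eq (hn : 1 ≤ n) {x : Euc n} {R : ℝ} {F : Euc n → ℝ}
    (hF : IntegrableOn F (ball x R)) :
    ∫ y in ball x R, F y = ∫ r in Set.Ioo 0 R, sphereIntegral x F r := by
  have hG := integrable_indicator_translate hF
  have hp := measurePreserving_polar hn
  have h1 : ∫ y in ball x R, F y =
      ∫ z, (ball (0 : Euc n) R).indicator (fun z => F (x + z)) z := by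
    rw [← integral_indicator measurableSet_ball, ← integral_add_left_eq_self _ x]
    congr 1
    ext z
    by_cases h : z ∈ ball (0 : Euc n) R
    · rw [Set.indicator_of_mem h, Set.indicator_of_mem (by simpa using h)]
    · rw [Set.indicator_of_notMem h, Set.indicator_of_notMem (by simpa using h)]
  rw [h1, ← hp.map_eq, integral_map hp.aemeasurable (by rw [hp.map_eq]; exact hG.1),
    integral_prod_symm _ (integrable_polar hn hG), integral_radialMeasure,
    setIntegral_congr_fun measurableSet_Ioi fun r hr => integral_indicator_polar F hr,
    setIntegral_indicator measurableSet_Ioo]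
  congr 2
  simp [Set.inter_eq_right, Set.Ioo_subset_Ioi_self]

theorem sphereIntegral_mul {x : Euc n} (F : Euc n → ℝ) (b : ℝ → ℝ) {r : ℝ} (hr : 0 < r) :
    sphereIntegral x (fun y => b ‖y - x‖ * F y) r = b r * sphereIntegral x F r := by
  unfold sphereIntegral
  have : ∀ θ : sphere (0 : Euc n) 1, ‖x + r • (θ : Euc n) - x‖ = r := by
    intro θ
    have h1 : ‖(θ : Euc n)‖ = 1 := by simp
    simp [norm_smul, h1, abs_of_pos hr]
  simp_rw [this, integral_const_mul]
  ring

end Polar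

/-! ### Radial test functions. -/

section RadialTest

/-- Primitive of `ζ` vanishing at `R`. -/
noncomputable def cutoffPrimitive (R : ℝ) (ζ : ℝ → ℝ) (r : ℝ) : ℝ := ∫ t in R..r, ζ t

variable {R : ℝ} {ζ : ℝ → ℝ}

theorem hasDerivAt_cutoffPrimitive (hζ : ContDiff ℝ ∞ ζ) (r : ℝ) :
    HasDerivAt (cutoffPrimitive R ζ) (ζ r) r :=
  intervalIntegral.integral_hasDerivAt_right (hζ.continuous.intervalIntegrable _ _)
    (hζ.continuous.stronglyMeasurableAtFilter _ _) hζ.continuous.continuousAt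

theorem contDiff_cutoffPrimitive (hζ : ContDiff ℝ ∞ ζ) : ContDiff ℝ ∞ (cutoffPrimitive R ζ) := by
  rw [contDiff_infty_iff_deriv]
  refine ⟨fun r => (hasDerivAt_cutoffPrimitive hζ r).differentiableAt, ?_⟩
  rwa [show deriv (cutoffPrimitive R ζ) = ζ from
    funext fun r => (hasDerivAt_cutoffPrimitive hζ r).deriv]

theorem exists_tsupport_subset_Icc (hR : 0 < R) (hc : HasCompactSupport ζ)
    (hs : tsupport ζ ⊆ Set.Ioo 0 R) :
    ∃ α β, 0 < α ∧ α < β ∧ β < R ∧ ∀ r, r ∉ Set.Icc α β → ζ r = 0 := by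
  rcases (tsupport ζ).eq_empty_or_nonempty with h0 | hne
  · refine ⟨R / 3, R / 2, by linarith, by linarith, by linarith, fun r _ => ?_⟩
    exact image_eq_zero_of_notMem_tsupport (by simp [h0])
  · obtain ⟨a, ha, hamin⟩ := hc.isCompact.exists_isLeast hne
    obtain ⟨b, hb, hbmax⟩ := hc.isCompact.exists_isGreatest hne
    have h1 := hs ha
    have h2 := hs hb
    refine ⟨a / 2, (b + R) / 2, by linarith [h1.1], ?_, by linarith [h2.2], fun r hr => ?_⟩
    · linarith [hamin hb, h2.2, h1.1]
    · refine image_eq_zero_of_notMem_tsupport fun hmem => hr ⟨?_, ?_⟩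
      · linarith [hamin hmem, h1.1]
      · linarith [hbmax hmem, h2.2]

theorem cutoffPrimitive_eq_zero {β : ℝ} (hβ : β < R) {α : ℝ}
    (h0 : ∀ r, r ∉ Set.Icc α β → ζ r = 0) {r : ℝ} (hr : β ≤ r) : cutoffPrimitive R ζ r = 0 := by
  unfold cutoffPrimitive
  rw [intervalIntegral.integral_congr_ae (g := fun _ => 0)]
  · simp
  · refine ae_of_all _ fun t ht => h0 t fun hI => ?_
    rw [Set.uIoc, Set.mem_Ioc] at ht
    have : β ≤ min R r := le_min hβ.le hr
    linarith [hI.2, ht.1]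

theorem cutoffPrimitive_eq_of_le {α β : ℝ} (h0 : ∀ r, r ∉ Set.Icc α β → ζ r = 0)
    (hζ : ContDiff ℝ ∞ ζ) {r : ℝ} (hr : r ≤ α) :
    cutoffPrimitive R ζ r = cutoffPrimitive R ζ α := by
  unfold cutoffPrimitive
  rw [← intervalIntegral.integral_add_adjacent_intervals
    (hζ.continuous.intervalIntegrable R r) (hζ.continuous.intervalIntegrable r α)]
  rw [intervalIntegral.integral_congr_ae (g := fun _ => 0) (a := r) (b := α)]
  · simp
  · have : ∀ᵐ t : ℝ, t ≠ α := by simp [ae_iff, measure_singleton]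
    filter_upwards [this] with t ht htI
    rw [Set.uIoc_of_le hr] at htI
    exact h0 t fun hI => ht (le_antisymm htI.2 hI.1)

/-- Integration by parts for absolutely continuous functions: one boundary term vanishes because
`cutoffPrimitive` is zero at `R`, the other because the primitive of `F` starts at `0`. It leaves
the arbitrary function `ζ` as the only test function, so that the fundamental lemma of the calculus
of variations applies. -/
theorem integral_cutoffPrimitive_mul (hR : 0 < R) (hζ : ContDiff ℝ ∞ ζ) {F : ℝ → ℝ}
    (hF : IntegrableOn F (Set.Ioo 0 R)) :
    ∫ r in Set.Ioo 0 R, cutoffPrimitive R ζ r * F r =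
      - ∫ r in Set.Ioo 0 R, ζ r * ∫ t in (0 : ℝ)..r, F t := by
  have hFi := RadialSystem.intervalIntegrable_of_Ioo hF le_rfl hR.le le_rfl
  have h1 : AbsolutelyContinuousOnInterval (cutoffPrimitive R ζ) 0 R :=
    (((contDiff_cutoffPrimitive hζ).of_le (by simp)).contDiffOn).absolutelyContinuousOnInterval
  have h2 : AbsolutelyContinuousOnInterval (fun s => ∫ t in (0 : ℝ)..s, F t) 0 R :=
    hFi.absolutelyContinuousOnInterval_intervalIntegral (by simp)
  have h3 := h1.integral_mul_deriv_eq_deriv_mul h2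
  simp only [intervalIntegral.integral_same, mul_zero, sub_zero] at h3
  rw [show cutoffPrimitive R ζ R = 0 by simp [cutoffPrimitive], zero_mul, zero_sub] at h3
  rw [← integral_Ioc_eq_integral_Ioo, ← integral_Ioc_eq_integral_Ioo,
    ← intervalIntegral.integral_of_le hR.le, ← intervalIntegral.integral_of_le hR.le]
  convert! h3 using 1
  · apply intervalIntegral.integral_congr_ae
    filter_upwards [hFi.ae_hasDerivAt_integral] with t ht htI
    rw [(ht (Set.uIoc_subset_uIcc htI) 0 (by simp)).deriv]
  · simp_rw [(hasDerivAt_cutoffPrimitive hζ _).deriv]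

theorem ae_eq_zero_of_integral_Ioo {F : ℝ → ℝ} (hF : IntegrableOn F (Set.Ioo 0 R))
    (h : ∀ ζ : ℝ → ℝ, ContDiff ℝ ∞ ζ → HasCompactSupport ζ → tsupport ζ ⊆ Set.Ioo 0 R →
      ∫ r in Set.Ioo 0 R, ζ r * F r = 0) :
    ∀ᵐ r ∂volume.restrict (Set.Ioo 0 R), F r = 0 := by
  rw [ae_restrict_iff' measurableSet_Ioo]
  refine isOpen_Ioo.ae_eq_zero_of_integral_contDiff_smul_eq_zero hF.locallyIntegrableOn ?_
  intro g hg hc hs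
  rw [← h g hg hc hs, setIntegral_eq_integral_of_forall_compl_eq_zero]
  · rfl
  · intro r hr
    rw [image_eq_zero_of_notMem_tsupport fun h' => hr (hs h'), zero_mul]

variable {n : ℕ}

/-- The norm is not smooth at the centre, but the profile is constant on radii below `α`. -/
theorem contDiff_radial {α β : ℝ} (hα : 0 < α) (h0 : ∀ r, r ∉ Set.Icc α β → ζ r = 0)
    (hζ : ContDiff ℝ ∞ ζ) (x : Euc n) :
    ContDiff ℝ ∞ fun y : Euc n => cutoffPrimitive R ζ ‖y - x‖ := by
  rw [contDiff_iff_contDiffAt]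
  intro y
  by_cases hy : y = x
  · subst hy
    refine (contDiffAt_const (c := cutoffPrimitive R ζ α)).congr_of_eventuallyEq ?_
    filter_upwards [ball_mem_nhds y hα] with z hz
    exact cutoffPrimitive_eq_of_le h0 hζ (by rw [mem_ball, dist_eq_norm] at hz; exact hz.le)
  · exact (contDiff_cutoffPrimitive hζ).contDiffAt.comp y
      ((contDiffAt_id.sub contDiffAt_const).norm ℝ (sub_ne_zero.2 hy))

/-- The `j`-th coordinate of the radial unit vector field about `x`. -/
noncomputable def radialDir (x : Euc n) (y : Euc n) (j : Fin n) : ℝ := (y - x) j / ‖y - x‖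

theorem abs_radialDir_le (x y : Euc n) (j : Fin n) : |radialDir x y j| ≤ 1 := by
  unfold radialDir
  rw [abs_div, abs_norm]
  exact div_le_one_of_le₀ (by simpa using PiLp.norm_apply_le (y - x) j) (norm_nonneg _)

theorem measurable_radialDir (x : Euc n) (j : Fin n) : Measurable fun y => radialDir x y j := by
  unfold radialDir
  fun_prop

theorem norm_mul_radialDir (x y : Euc n) (j : Fin n) : ‖y - x‖ * radialDir x y j = (y - x) j := by
  unfold radialDir
  by_cases h : y - x = 0
  · simp [h]
  · field_simp [norm_ne_zero_iff.2 h]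

/-- At the centre the direction is `0` by division by zero, hence not a unit vector; the factor `‖y
- x‖` makes the identity hold there as well. -/
theorem norm_mul_sum_radialDir_sq (x y : Euc n) :
    ‖y - x‖ * ∑ j, radialDir x y j * radialDir x y j = ‖y - x‖ := by
  by_cases h : y - x = 0
  · simp [h]
  · have h1 : ‖y - x‖ ≠ 0 := norm_ne_zero_iff.2 h
    have : ∑ j, radialDir x y j * radialDir x y j = 1 := by
      unfold radialDir
      simp_rw [div_mul_div_comm, ← Finset.sum_div]
      rw [div_eq_one_iff_eq (by positivity)]
      have := EuclideanSpace.norm_sq_eq (y - x)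
      simp only [Real.norm_eq_abs, sq_abs] at this
      rw [← sq, this]
      exact Finset.sum_congr rfl fun j _ => (sq _).symm
    rw [this, mul_one]

theorem fderiv_radial {α β : ℝ} (hα : 0 < α) (h0 : ∀ r, r ∉ Set.Icc α β → ζ r = 0)
    (hζ : ContDiff ℝ ∞ ζ) (x y : Euc n) (j : Fin n) :
    fderiv ℝ (fun y : Euc n => cutoffPrimitive R ζ ‖y - x‖) y (QValued.basisVec j) =
      ζ ‖y - x‖ * radialDir x y j := by
  by_cases hy : y = x
  · subst hy
    have : (fun z : Euc n => cutoffPrimitive R ζ ‖z - y‖) =ᶠ[𝓝 y]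
        fun _ => cutoffPrimitive R ζ α := by
      filter_upwards [ball_mem_nhds y hα] with z hz
      exact cutoffPrimitive_eq_of_le h0 hζ (by rw [mem_ball, dist_eq_norm] at hz; exact hz.le)
    rw [this.fderiv_eq]
    simp [radialDir]
  · have hy' : y - x ≠ 0 := sub_ne_zero.2 hy
    have hs := ((hasStrictFDerivAt_norm_sq (y - x)).hasFDerivAt.comp y
      ((hasFDerivAt_id y).sub_const x)).sqrt (by simpa using hy')
    have hs' : HasFDerivAt (fun y : Euc n => ‖y - x‖) _ y :=
      hs.congr_of_eventuallyEq (Filter.Eventually.of_forall fun z => by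
        simp [Real.sqrt_sq (norm_nonneg _)])
    have h2 := (hasDerivAt_cutoffPrimitive (R := R) hζ ‖y - x‖).comp_hasFDerivAt y hs'
    rw [show (fun y : Euc n => cutoffPrimitive R ζ ‖y - x‖) =
      cutoffPrimitive R ζ ∘ fun y => ‖y - x‖ from rfl, h2.fderiv]
    have h3 : inner ℝ (y - x) (QValued.basisVec j) = (y - x) j := by
      simp [QValued.basisVec, EuclideanSpace.inner_single_right]
    simp only [id, _root_.smul_apply, ContinuousLinearMap.comp_apply, smul_eq_mul,
      ContinuousLinearMap.coe_id', Real.sqrt_sq (norm_nonneg _), innerSL_apply_apply, h3, radialDir,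
      Function.comp, nsmul_eq_mul]
    push_cast
    field_simp

end RadialTest

/-! ### Energy densities and their variations in radial test fields. -/

/-- The densities `u = |f|²`, `V j = ⟨f, ∂ⱼ f⟩`, `M j k = ⟨∂ⱼ f, ∂ₖ f⟩` of a stationary function on
the unit ball, with the identities coming from the chain rule and from the outer and inner
variations. -/
structure EnergyDensities {n : ℕ} (u : Euc n → ℝ) (V : Euc n → Fin n → ℝ)
    (M : Euc n → Fin n → Fin n → ℝ) : Prop where
  int_u : IntegrableOn u (ball 0 1)
  int_V : ∀ j, IntegrableOn (fun y => V y j) (ball 0 1)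
  int_M : ∀ j k, IntegrableOn (fun y => M y j k) (ball 0 1)
  -- For a tuple-valued `f` this form is `∑ᵢ |Dfᵢ X + s fᵢ|²`. It contains the positivity of `u` and
  -- of `M`, and the Cauchy–Schwarz inequality that makes the frequency monotone.
  nonneg : ∀ y (X : Fin n → ℝ) (s : ℝ),
    0 ≤ ∑ j, ∑ k, M y j k * (X j * X k) + 2 * s * ∑ j, V y j * X j + s ^ 2 * u y
  grad : ∀ j, ∀ η : Euc n → ℝ, ContDiff ℝ ∞ η → HasCompactSupport η → tsupport η ⊆ ball 0 1 →
    ∫ y in ball 0 1, u y * fderiv ℝ η y (QValued.basisVec j) =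
      - ∫ y in ball 0 1, 2 * V y j * η y
  outer : ∀ η : Euc n → ℝ, ContDiff ℝ ∞ η → HasCompactSupport η → tsupport η ⊆ ball 0 1 →
    ∫ y in ball 0 1, (η y * ∑ j, M y j j +
      ∑ j, fderiv ℝ η y (QValued.basisVec j) * V y j) = 0
  inner : ∀ φ : Euc n → Euc n, ContDiff ℝ ∞ φ → HasCompactSupport φ → tsupport φ ⊆ ball 0 1 →
    2 * (∫ y in ball 0 1, ∑ j, ∑ k, (fderiv ℝ φ y (QValued.basisVec j)) k * M y j k) -
      ∫ y in ball 0 1, (∑ j, M y j j) * QValued.divergence φ y = 0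

namespace EnergyDensities

variable {n : ℕ} {u : Euc n → ℝ} {V : Euc n → Fin n → ℝ} {M : Euc n → Fin n → Fin n → ℝ}

/-- `⟨f, ∂_ν f⟩` for the radial direction `ν` about `x`. -/
noncomputable def radialV (V : Euc n → Fin n → ℝ) (x y : Euc n) : ℝ :=
  ∑ j, V y j * radialDir x y j

/-- `|∂_ν f|²` for the radial direction `ν` about `x`. -/
noncomputable def radialM (M : Euc n → Fin n → Fin n → ℝ) (x y : Euc n) : ℝ :=
  ∑ j, ∑ k, M y j k * (radialDir x y j * radialDir x y k)

theorem u_nonneg (D : EnergyDensities u V M) (y : Euc n) : 0 ≤ u y := by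
  simpa using D.nonneg y 0 1

theorem M_diag_nonneg (D : EnergyDensities u V M) (y : Euc n) (j : Fin n) : 0 ≤ M y j j := by
  simpa [Pi.single_apply] using D.nonneg y (Pi.single j 1) 0

theorem radial_nonneg (D : EnergyDensities u V M) (x y : Euc n) (s : ℝ) :
    0 ≤ radialM M x y + 2 * s * radialV V x y + s ^ 2 * u y :=
  D.nonneg y (radialDir x y) s

theorem ball_subset {x : Euc n} : ball x (1 - ‖x‖) ⊆ ball (0 : Euc n) 1 :=
  ball_subset_ball' (by simp)

variable {x : Euc n}

theorem int_u' (D : EnergyDensities u V M) : IntegrableOn u (ball x (1 - ‖x‖)) :=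
  D.int_u.mono_set ball_subset

theorem int_trace (D : EnergyDensities u V M) :
    IntegrableOn (fun y => ∑ j, M y j j) (ball x (1 - ‖x‖)) :=
  integrable_finsetSum _ fun j _ => (D.int_M j j).mono_set ball_subset

theorem int_radialV (D : EnergyDensities u V M) :
    IntegrableOn (radialV V x) (ball x (1 - ‖x‖)) := by
  refine integrable_finsetSum _ fun j _ => ?_
  exact ((D.int_V j).mono_set ball_subset).mul_bdd (c := 1)
    (measurable_radialDir x j).aestronglyMeasurable
    (ae_of_all _ fun y => by simpa using abs_radialDir_le x y j)

theorem int_radialM (D : EnergyDensities u V M) :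
    IntegrableOn (radialM M x) (ball x (1 - ‖x‖)) := by
  refine integrable_finsetSum _ fun j _ => integrable_finsetSum _ fun k _ => ?_
  refine ((D.int_M j k).mono_set ball_subset).mul_bdd (c := 1)
    ((measurable_radialDir x j).mul (measurable_radialDir x k)).aestronglyMeasurable
    (ae_of_all _ fun y => ?_)
  rw [norm_mul]
  have h1 := abs_radialDir_le x y j
  have h2 := abs_radialDir_le x y k
  exact mul_le_one₀ h1 (norm_nonneg _) h2

variable {ζ : ℝ → ℝ} {α β : ℝ}

theorem radial_support (h0 : ∀ r, r ∉ Set.Icc α β → ζ r = 0) (hβ : β < 1 - ‖x‖)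
    {E : Type*} [NormedAddCommGroup E] [NormedSpace ℝ E] {φ : Euc n → E}
    (hφ : ∀ y, cutoffPrimitive (1 - ‖x‖) ζ ‖y - x‖ = 0 → φ y = 0) :
    HasCompactSupport φ ∧ tsupport φ ⊆ ball 0 1 := by
  have h1 : tsupport φ ⊆ closedBall x β := by
    refine closure_minimal (fun y hy => ?_) isClosed_closedBall
    by_contra hn
    refine hy (hφ y (cutoffPrimitive_eq_zero hβ h0 ?_))
    rw [mem_closedBall, dist_eq_norm, not_le] at hn
    exact hn.le
  refine ⟨HasCompactSupport.of_support_subset_isCompact (isCompact_closedBall x β)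
    ((subset_tsupport φ).trans h1), h1.trans ((closedBall_subset_ball hβ).trans ball_subset)⟩

theorem setIntegral_ball_eq {F : Euc n → ℝ} (hF : ∀ y, 1 - ‖x‖ ≤ ‖y - x‖ → F y = 0) :
    ∫ y in ball 0 1, F y = ∫ y in ball x (1 - ‖x‖), F y := by
  refine setIntegral_eq_of_subset_of_forall_sdiff_eq_zero measurableSet_ball ball_subset
    fun y hy => hF y ?_
  have := hy.2
  rwa [mem_ball, dist_eq_norm, not_lt] at this

theorem zeta_eq_zero (h0 : ∀ r, r ∉ Set.Icc α β → ζ r = 0) (hβ : β < 1 - ‖x‖) {y : Euc n}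
    (hy : 1 - ‖x‖ ≤ ‖y - x‖) : ζ ‖y - x‖ = 0 :=
  h0 _ fun h => by linarith [h.2]

theorem radial_outer (D : EnergyDensities u V M) (hα : 0 < α) (hβ : β < 1 - ‖x‖)
    (h0 : ∀ r, r ∉ Set.Icc α β → ζ r = 0) (hζ : ContDiff ℝ ∞ ζ) :
    ∫ y in ball x (1 - ‖x‖), (cutoffPrimitive (1 - ‖x‖) ζ ‖y - x‖ * (∑ j, M y j j) +
      ζ ‖y - x‖ * radialV V x y) = 0 := by
  have hs := radial_support (x := x) h0 hβ
    (φ := fun y : Euc n => cutoffPrimitive (1 - ‖x‖) ζ ‖y - x‖) (fun y hy => hy)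
  have h1 := D.outer _ (contDiff_radial hα h0 hζ x) hs.1 hs.2
  rw [setIntegral_ball_eq (x := x)] at h1
  · rw [← h1]
    refine integral_congr_ae (ae_of_all _ fun y => ?_)
    simp only [fderiv_radial hα h0 hζ, radialV, Finset.mul_sum]
    congr 1
    exact Finset.sum_congr rfl fun j _ => by ring
  · intro y hy
    rw [cutoffPrimitive_eq_zero hβ h0 (hβ.le.trans hy)]
    simp [fderiv_radial hα h0 hζ, zeta_eq_zero h0 hβ hy]

theorem fderiv_radial_mul {R : ℝ} (hα : 0 < α)
    (h0 : ∀ r, r ∉ Set.Icc α β → ζ r = 0) (hζ : ContDiff ℝ ∞ ζ) (y : Euc n) (j k : Fin n) :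
    fderiv ℝ (fun y : Euc n => cutoffPrimitive R ζ ‖y - x‖ * (y - x) k) y (QValued.basisVec j) =
      (if j = k then cutoffPrimitive R ζ ‖y - x‖ else 0) +
        ζ ‖y - x‖ * ‖y - x‖ * (radialDir x y j * radialDir x y k) := by
  have h1 : HasFDerivAt (fun y : Euc n => (y - x) k) (EuclideanSpace.proj k : Euc n →L[ℝ] ℝ) y := by
    have := (EuclideanSpace.proj k : Euc n →L[ℝ] ℝ).hasFDerivAt (x := y - x)
    exact this.comp y ((hasFDerivAt_id y).sub_const x)
  have h2 : DifferentiableAt ℝ (fun y : Euc n => cutoffPrimitive R ζ ‖y - x‖) y :=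
    ((contDiff_radial hα h0 hζ x).differentiable (by simp)) y
  have h3 := h2.hasFDerivAt.mul h1
  rw [show (fun y : Euc n => cutoffPrimitive R ζ ‖y - x‖ * (y - x) k) =
    (fun y : Euc n => cutoffPrimitive R ζ ‖y - x‖) * fun y : Euc n => (y - x) k from rfl, h3.fderiv]
  simp only [_root_.add_apply, _root_.smul_apply, smul_eq_mul, fderiv_radial hα h0 hζ]
  rw [← norm_mul_radialDir x y k]
  have : (EuclideanSpace.proj k : Euc n →L[ℝ] ℝ) (QValued.basisVec j) = if j = k then 1 else 0 := by
    simp [QValued.basisVec, eq_comm]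
  rw [this]
  split_ifs <;> ring

theorem contDiff_radial_mul {R : ℝ} (hα : 0 < α)
    (h0 : ∀ r, r ∉ Set.Icc α β → ζ r = 0) (hζ : ContDiff ℝ ∞ ζ) (k : Fin n) :
    ContDiff ℝ ∞ (fun y : Euc n => cutoffPrimitive R ζ ‖y - x‖ * (y - x) k) := by
  refine (contDiff_radial hα h0 hζ x).mul ?_
  exact (EuclideanSpace.proj k : Euc n →L[ℝ] ℝ).contDiff.comp (contDiff_id.sub contDiff_const)

theorem integrableOn_mul_radial {b : ℝ → ℝ} (hb : Continuous b) {R : ℝ} {F : Euc n → ℝ}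
    (hF : IntegrableOn F (ball x R)) : IntegrableOn (fun y => b ‖y - x‖ * F y) (ball x R) := by
  have hc : Continuous fun y : Euc n => b ‖y - x‖ := by fun_prop
  obtain ⟨C, hC⟩ := (isCompact_closedBall x R).exists_bound_of_continuousOn hc.continuousOn
  exact Integrable.bdd_mul hF hc.aestronglyMeasurable
    ((ae_restrict_mem measurableSet_ball).mono fun y hy => hC y (ball_subset_closedBall hy))

/-- Each component of the field `cutoffPrimitive · (y - x)` tests the corresponding partial
derivative. Summation produces the divergence of the field on one side and the radial derivative on
the other. -/
theorem radial_grad (D : EnergyDensities u V M) (hα : 0 < α) (hβ : β < 1 - ‖x‖)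
    (h0 : ∀ r, r ∉ Set.Icc α β → ζ r = 0) (hζ : ContDiff ℝ ∞ ζ) :
    ∫ y in ball x (1 - ‖x‖),
        (n * cutoffPrimitive (1 - ‖x‖) ζ ‖y - x‖ + ζ ‖y - x‖ * ‖y - x‖) * u y =
      - ∫ y in ball x (1 - ‖x‖),
        2 * (cutoffPrimitive (1 - ‖x‖) ζ ‖y - x‖ * ‖y - x‖) * radialV V x y := by
  set R := 1 - ‖x‖ with hR
  have hj : ∀ j : Fin n, ∫ y in ball x R, (cutoffPrimitive R ζ ‖y - x‖ +
      ζ ‖y - x‖ * ‖y - x‖ * (radialDir x y j * radialDir x y j)) * u y =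
      - ∫ y in ball x R, 2 * (cutoffPrimitive R ζ ‖y - x‖ * ‖y - x‖) *
        (V y j * radialDir x y j) := by
    intro j
    have hs := radial_support (x := x) h0 hβ
      (φ := fun y : Euc n => cutoffPrimitive R ζ ‖y - x‖ * (y - x) j)
      (fun y hy => by rw [hy, zero_mul])
    have h1 := D.grad j _ (contDiff_radial_mul hα h0 hζ j) hs.1 hs.2
    rw [setIntegral_ball_eq (x := x), setIntegral_ball_eq (x := x)] at h1
    · convert! h1 using 1
      · refine integral_congr_ae (ae_of_all _ fun y => ?_)
        simp only [fderiv_radial_mul hα h0 hζ, if_true]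
        ring
      · congr 1
        refine integral_congr_ae (ae_of_all _ fun y => ?_)
        simp only [← norm_mul_radialDir x y j]
        ring
    · intro y hy
      rw [cutoffPrimitive_eq_zero hβ h0 (hβ.le.trans hy)]
      simp
    · intro y hy
      rw [fderiv_radial_mul hα h0 hζ, cutoffPrimitive_eq_zero hβ h0 (hβ.le.trans hy),
        zeta_eq_zero h0 hβ hy]
      simp
  have hcp : Continuous (cutoffPrimitive R ζ) := (contDiff_cutoffPrimitive hζ).continuous
  have hsum := Finset.sum_congr rfl fun j (_ : j ∈ Finset.univ) => hj j
  rw [Finset.sum_neg_distrib, ← integral_finsetSum, ← integral_finsetSum] at hsum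
  · convert! hsum using 1
    · refine integral_congr_ae (ae_of_all _ fun y => ?_)
      simp only [← Finset.sum_mul, Finset.sum_add_distrib, ← Finset.mul_sum, Finset.sum_const,
        Finset.card_univ, Fintype.card_fin, nsmul_eq_mul]
      rw [mul_assoc (ζ _), norm_mul_sum_radialDir_sq]
    · congr 1
      refine integral_congr_ae (ae_of_all _ fun y => ?_)
      simp only [radialV, Finset.mul_sum]
  · intro j _
    have : IntegrableOn (fun y => V y j * radialDir x y j) (ball x R) :=
      ((D.int_V j).mono_set ball_subset).mul_bdd (c := 1)
        (measurable_radialDir x j).aestronglyMeasurable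
        (ae_of_all _ fun y => by simpa using abs_radialDir_le x y j)
    exact integrableOn_mul_radial (b := fun r => 2 * (cutoffPrimitive R ζ r * r))
      (by fun_prop) this
  · intro j _
    have h1 : IntegrableOn (fun y => u y * (radialDir x y j * radialDir x y j)) (ball x R) := by
      refine D.int_u'.mul_bdd (c := 1)
        ((measurable_radialDir x j).mul (measurable_radialDir x j)).aestronglyMeasurable
        (ae_of_all _ fun y => ?_)
      rw [norm_mul]
      have h1 := abs_radialDir_le x y j
      exact mul_le_one₀ h1 (norm_nonneg _) h1
    have h2 := integrableOn_mul_radial (b := fun r => ζ r * r)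
      (by have := hζ.continuous; fun_prop) h1
    have h3 := integrableOn_mul_radial hcp (D.int_u' (x := x))
    refine (h3.add h2).congr (ae_of_all _ fun y => ?_)
    simp only [Pi.add_apply]
    ring

/-- The field is `cutoffPrimitive · (y - x)`, a cut-off generator of dilations about `x`. Its
differential is a multiple of the identity plus a multiple of `ν ⊗ ν`, so only the trace of `M` and
its radial component survive. -/
theorem radial_inner (D : EnergyDensities u V M) (hα : 0 < α) (hβ : β < 1 - ‖x‖)
    (h0 : ∀ r, r ∉ Set.Icc α β → ζ r = 0) (hζ : ContDiff ℝ ∞ ζ) :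
    2 * (∫ y in ball x (1 - ‖x‖), (cutoffPrimitive (1 - ‖x‖) ζ ‖y - x‖ * (∑ j, M y j j) +
        ζ ‖y - x‖ * ‖y - x‖ * radialM M x y)) -
      ∫ y in ball x (1 - ‖x‖), (n * cutoffPrimitive (1 - ‖x‖) ζ ‖y - x‖ + ζ ‖y - x‖ * ‖y - x‖) *
        ∑ j, M y j j = 0 := by
  set R := 1 - ‖x‖ with hR
  set φ : Euc n → Euc n := fun y => cutoffPrimitive R ζ ‖y - x‖ • (y - x)
  have hs := radial_support (x := x) h0 hβ (φ := φ) (fun y hy => by simp only [φ]; rw [hy, zero_smul])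
  have hφ : ContDiff ℝ ∞ φ :=
    (contDiff_radial hα h0 hζ x).smul (contDiff_id.sub contDiff_const)
  have hcomp : ∀ y j k, (fderiv ℝ φ y (QValued.basisVec j)) k =
      (if j = k then cutoffPrimitive R ζ ‖y - x‖ else 0) +
        ζ ‖y - x‖ * ‖y - x‖ * (radialDir x y j * radialDir x y k) := by
    intro y j k
    rw [← fderiv_radial_mul hα h0 hζ]
    have h1 := ((EuclideanSpace.proj k : Euc n →L[ℝ] ℝ).hasFDerivAt (x := φ y)).comp y
      ((hφ.differentiable (by simp)) y).hasFDerivAt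
    have h2 : (fun y : Euc n => cutoffPrimitive R ζ ‖y - x‖ * (y - x) k) =
      (EuclideanSpace.proj k : Euc n →L[ℝ] ℝ) ∘ φ := by ext y; simp [φ]
    rw [h2, h1.fderiv]
    simp
  have hdiv : ∀ y, QValued.divergence φ y =
      n * cutoffPrimitive R ζ ‖y - x‖ + ζ ‖y - x‖ * ‖y - x‖ := by
    intro y
    unfold QValued.divergence
    simp only [hcomp, if_true, Finset.sum_add_distrib, ← Finset.mul_sum, Finset.sum_const,
        Finset.card_univ, Fintype.card_fin, nsmul_eq_mul]
    rw [mul_assoc (ζ _), norm_mul_sum_radialDir_sq]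
  have h1 := D.inner φ hφ hs.1 hs.2
  rw [setIntegral_ball_eq (x := x), setIntegral_ball_eq (x := x)] at h1
  · rw [← h1]
    congr 2
    · refine integral_congr_ae (ae_of_all _ fun y => ?_)
      simp only [hcomp, add_mul, Finset.sum_add_distrib, ite_mul, zero_mul, Finset.sum_ite_eq,
        Finset.mem_univ, if_true, radialM, Finset.mul_sum]
      congr 1
      exact Finset.sum_congr rfl fun j _ => Finset.sum_congr rfl fun k _ => by ring
    · ext y
      rw [hdiv, mul_comm]
  · intro y hy
    rw [hdiv, cutoffPrimitive_eq_zero hβ h0 (hβ.le.trans hy), zeta_eq_zero h0 hβ hy]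
    simp
  · intro y hy
    simp only [hcomp]
    rw [cutoffPrimitive_eq_zero hβ h0 (hβ.le.trans hy), zeta_eq_zero h0 hβ hy]
    simp

end EnergyDensities

/-! ### Integration over annuli. -/

theorem annulus_subset_ball {n : ℕ} (x : Euc n) {r R : ℝ} (hR : 2 * r ≤ R) :
    QValued.annulus x r ⊆ ball x R :=
  Set.sdiff_subset.trans (ball_subset_ball hR)

theorem integral_annulus_eq {n : ℕ} (hn : 1 ≤ n) {x : Euc n} {r : ℝ} (hr : 0 < r)
    {F : Euc n → ℝ} (hF : IntegrableOn F (ball x (2 * r))) :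
    ∫ y in QValued.annulus x r, F y = ∫ s in r..(2 * r), sphereIntegral x F s := by
  have h2 : ball x r ⊆ ball x (2 * r) := ball_subset_ball (by linarith)
  unfold QValued.annulus
  rw [setIntegral_sdiff measurableSet_ball hF h2, integral_ball_eq hn hF,
    integral_ball_eq hn (hF.mono_set h2)]
  have hi := integrableOn_sphereIntegral hn hF
  have i1 := RadialSystem.intervalIntegrable_of_Ioo hi le_rfl hr.le (by linarith)
  have i2 := RadialSystem.intervalIntegrable_of_Ioo hi hr.le (by linarith) le_rfl
  rw [← integral_Ioc_eq_integral_Ioo, ← integral_Ioc_eq_integral_Ioo,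
    ← intervalIntegral.integral_of_le hr.le, ← intervalIntegral.integral_of_le (by linarith),
    ← intervalIntegral.integral_add_adjacent_intervals i1 i2]
  ring

theorem sphereIntegral_nonneg {n : ℕ} {x : Euc n} {F : Euc n → ℝ} (hF : ∀ y, 0 ≤ F y) {r : ℝ}
    (hr : 0 ≤ r) : 0 ≤ sphereIntegral x F r :=
  mul_nonneg (pow_nonneg hr _) (integral_nonneg fun _ => hF _)

theorem toSphere_real_univ_pos {n : ℕ} (hn : 1 ≤ n) :
    0 < (volume : Measure (Euc n)).toSphere.real Set.univ := by
  rw [Measure.toSphere_real_apply_univ]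
  have : 0 < volume.real (ball (0 : Euc n) 1) :=
    ENNReal.toReal_pos (measure_ball_pos _ _ one_pos).ne' measure_ball_lt_top.ne
  have : (0 : ℝ) < n := by exact_mod_cast hn
  simp only [finrank_euclideanSpace, Fintype.card_fin]
  positivity

theorem volume_annulus_eq {n : ℕ} (hn : 1 ≤ n) (x : Euc n) {r : ℝ} (hr : 0 < r) :
    volume.real (QValued.annulus x r) =
      (volume : Measure (Euc n)).toSphere.real Set.univ * ∫ s in r..(2 * r), s ^ (n - 1) := by
  have h1 := integral_annulus_eq hn (x := x) hr (F := fun _ => 1)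
    (integrableOn_const measure_ball_lt_top.ne)
  simp only [integral_const, MeasurableSet.univ, measureReal_restrict_apply, Set.univ_inter,
    smul_eq_mul, mul_one] at h1
  rw [h1, ← intervalIntegral.integral_const_mul]
  congr 1
  ext s
  simp [sphereIntegral, mul_comm]

/-! ### Radial reduction, unique continuation in the ball, asymptotics at a point. -/

namespace EnergyDensities

variable {n : ℕ} {u : Euc n → ℝ} {V : Euc n → Fin n → ℝ} {M : Euc n → Fin n → Fin n → ℝ}
  {x : Euc n}

theorem integral_ball_radial (hn : 1 ≤ n) {b : ℝ → ℝ} (hb : Continuous b) {R : ℝ}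
    {F : Euc n → ℝ} (hF : IntegrableOn F (ball x R)) :
    ∫ y in ball x R, b ‖y - x‖ * F y = ∫ r in Set.Ioo 0 R, b r * sphereIntegral x F r := by
  rw [integral_ball_eq hn (integrableOn_mul_radial hb hF)]
  exact setIntegral_congr_fun measurableSet_Ioo fun r hr => sphereIntegral_mul F b hr.1

theorem integrableOn_mul_Ioo {b : ℝ → ℝ} (hb : Continuous b) {R : ℝ} {F : ℝ → ℝ}
    (hF : IntegrableOn F (Set.Ioo 0 R)) : IntegrableOn (fun r => b r * F r) (Set.Ioo 0 R) := by
  obtain ⟨C, hC⟩ := (isCompact_Icc (a := (0 : ℝ)) (b := R)).exists_bound_of_continuousOn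
    hb.continuousOn
  exact Integrable.bdd_mul hF hb.aestronglyMeasurable
    ((ae_restrict_mem measurableSet_Ioo).mono fun y hy => hC y (Set.Ioo_subset_Icc_self hy))

theorem integrableOn_mul_primitive {b : ℝ → ℝ} (hb : Continuous b) {R : ℝ} (hR : 0 < R)
    {F : ℝ → ℝ} (hF : IntegrableOn F (Set.Ioo 0 R)) :
    IntegrableOn (fun r => b r * ∫ t in (0 : ℝ)..r, F t) (Set.Ioo 0 R) :=
  ((hb.continuousOn.mul (RadialSystem.continuousOn_primitive_Icc hR.le hF)).integrableOn_Icc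
    ).mono_set Set.Ioo_subset_Icc_self

theorem integral_linear_combination {α : Type*} [MeasurableSpace α] {μ : Measure α}
    {F G H : α → ℝ} (a b c : ℝ) (hF : Integrable F μ) (hG : Integrable G μ)
    (hH : Integrable H μ) :
    ∫ y, a * F y + b * G y + c * H y ∂μ = a * (∫ y, F y ∂μ) + b * (∫ y, G y ∂μ) +
      c * ∫ y, H y ∂μ := by
  rw [integral_add (f := fun y => a * F y + b * G y) ((hF.const_mul a).add (hG.const_mul b))
    (hH.const_mul c), integral_add (hF.const_mul a) (hG.const_mul b), integral_const_mul,
    integral_const_mul, integral_const_mul]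

theorem sphereIntegral_quadratic {F G H : Euc n → ℝ} {r : ℝ} (a b c : ℝ)
    (hF : Integrable (fun θ : sphere (0 : Euc n) 1 => F (x + r • (θ : Euc n)))
        (volume : Measure (Euc n)).toSphere)
    (hG : Integrable (fun θ : sphere (0 : Euc n) 1 => G (x + r • (θ : Euc n)))
        (volume : Measure (Euc n)).toSphere)
    (hH : Integrable (fun θ : sphere (0 : Euc n) 1 => H (x + r • (θ : Euc n)))
        (volume : Measure (Euc n)).toSphere) :
    sphereIntegral x (fun y => a * F y + b * G y + c * H y) r =
      a * sphereIntegral x F r + b * sphereIntegral x G r + c * sphereIntegral x H r := by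
  unfold sphereIntegral
  rw [integral_linear_combination a b c hF hG hH]
  ring

/-- The radial reduction of the variational identities. -/
theorem radialSystem (D : EnergyDensities u V M) {m : ℕ} (hm : n = m + 1)
    (hx : x ∈ ball (0 : Euc n) 1) :
    RadialSystem m (1 - ‖x‖) (sphereIntegral x u) (sphereIntegral x fun y => ∑ j, M y j j)
      (sphereIntegral x (radialV V x)) (sphereIntegral x (radialM M x)) := by
  have hn : 1 ≤ n := by omega
  have hnm : (n : ℝ) = m + 1 := by rw [hm]; push_cast; ring
  have hR : 0 < 1 - ‖x‖ := by simpa using hx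
  have iu := D.int_u' (x := x)
  have iT := D.int_trace (x := x)
  have iV := D.int_radialV (x := x)
  have iM := D.int_radialM (x := x)
  have ju := integrableOn_sphereIntegral hn iu
  have jT := integrableOn_sphereIntegral hn iT
  have jV := integrableOn_sphereIntegral hn iV
  have jM := integrableOn_sphereIntegral hn iM
  set R := 1 - ‖x‖ with hRdef
  have jrV : IntegrableOn (fun r => r * sphereIntegral x (radialV V x) r) (Set.Ioo 0 R) :=
    integrableOn_mul_Ioo (b := fun r => r) continuous_id jV
  -- This identity and the two after it arise in the same way: a radial test field, polar
  -- coordinates, and an integration by parts that moves the primitive from `ζ` to the density. As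
  -- `ζ` is arbitrary, each bracket vanishes almost everywhere.
  have hout : ∀ ζ : ℝ → ℝ, ContDiff ℝ ∞ ζ → HasCompactSupport ζ → tsupport ζ ⊆ Set.Ioo 0 R →
      ∫ r in Set.Ioo 0 R, ζ r * (sphereIntegral x (radialV V x) r -
        ∫ t in (0 : ℝ)..r, sphereIntegral x (fun y => ∑ j, M y j j) t) = 0 := by
    intro ζ hζ hc hs
    obtain ⟨α, β, hα, -, hβ, h0⟩ := exists_tsupport_subset_Icc hR hc hs
    have hcp : Continuous (cutoffPrimitive R ζ) := (contDiff_cutoffPrimitive hζ).continuous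
    have h1 := D.radial_outer hα hβ h0 hζ
    rw [← hRdef, integral_add (integrableOn_mul_radial hcp iT)
      (integrableOn_mul_radial hζ.continuous iV),
      integral_ball_radial hn hcp iT, integral_ball_radial hn hζ.continuous iV,
      integral_cutoffPrimitive_mul hR hζ jT] at h1
    simp_rw [mul_sub]
    rw [integral_sub (integrableOn_mul_Ioo hζ.continuous jV)
      (integrableOn_mul_primitive hζ.continuous hR jT)]
    linarith
  have hgrad : ∀ ζ : ℝ → ℝ, ContDiff ℝ ∞ ζ → HasCompactSupport ζ → tsupport ζ ⊆ Set.Ioo 0 R →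
      ∫ r in Set.Ioo 0 R, ζ r * (r * sphereIntegral x u r - (n * (∫ t in (0 : ℝ)..r,
        sphereIntegral x u t) + 2 * ∫ t in (0 : ℝ)..r, t * sphereIntegral x (radialV V x) t))
        = 0 := by
    intro ζ hζ hc hs
    obtain ⟨α, β, hα, -, hβ, h0⟩ := exists_tsupport_subset_Icc hR hc hs
    have hζc := hζ.continuous
    have hcp : Continuous (cutoffPrimitive R ζ) := (contDiff_cutoffPrimitive hζ).continuous
    have h1 := D.radial_grad hα hβ h0 hζ
    rw [← hRdef, integral_ball_radial hn
        (b := fun r => n * cutoffPrimitive R ζ r + ζ r * r) (by fun_prop) iu,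
      integral_ball_radial hn (b := fun r => 2 * (cutoffPrimitive R ζ r * r)) (by fun_prop) iV]
      at h1
    have e1 : ∫ r in Set.Ioo 0 R, (n * cutoffPrimitive R ζ r + ζ r * r) * sphereIntegral x u r =
        n * (∫ r in Set.Ioo 0 R, cutoffPrimitive R ζ r * sphereIntegral x u r) +
          ∫ r in Set.Ioo 0 R, ζ r * (r * sphereIntegral x u r) := by
      have := integral_linear_combination n 1 0 (integrableOn_mul_Ioo hcp ju)
        (integrableOn_mul_Ioo hζc (integrableOn_mul_Ioo (b := fun r => r) continuous_id ju))
        (integrableOn_mul_Ioo hcp ju)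
      rw [one_mul, zero_mul, add_zero] at this
      rw [← this]
      congr 1
      ext r
      ring
    have e2 : ∫ r in Set.Ioo 0 R, 2 * (cutoffPrimitive R ζ r * r) *
        sphereIntegral x (radialV V x) r =
        2 * ∫ r in Set.Ioo 0 R, cutoffPrimitive R ζ r *
          (r * sphereIntegral x (radialV V x) r) := by
      rw [← integral_const_mul]
      congr 1
      ext r
      ring
    rw [e1, e2, integral_cutoffPrimitive_mul hR hζ ju, integral_cutoffPrimitive_mul hR hζ jrV] at h1
    have k1 := integrableOn_mul_Ioo hζc (integrableOn_mul_Ioo (b := fun r => r) continuous_id ju)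
    have k2 := integrableOn_mul_primitive hζc hR ju
    have k3 := integrableOn_mul_primitive hζc hR jrV
    have e3 : ∫ r in Set.Ioo 0 R, ζ r * (r * sphereIntegral x u r - (n * (∫ t in (0 : ℝ)..r,
        sphereIntegral x u t) + 2 * ∫ t in (0 : ℝ)..r, t * sphereIntegral x (radialV V x) t)) =
        (∫ r in Set.Ioo 0 R, ζ r * (r * sphereIntegral x u r)) -
        (n * (∫ r in Set.Ioo 0 R, ζ r * ∫ t in (0 : ℝ)..r, sphereIntegral x u t) +
        2 * ∫ r in Set.Ioo 0 R, ζ r * ∫ t in (0 : ℝ)..r,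
          t * sphereIntegral x (radialV V x) t) := by
      have := integral_linear_combination 1 (-n) (-2) k1 k2 k3
      refine Eq.trans ?_ (this.trans (by ring))
      congr 1
      ext r
      ring
    rw [e3]
    linarith
  have hinn : ∀ ζ : ℝ → ℝ, ContDiff ℝ ∞ ζ → HasCompactSupport ζ → tsupport ζ ⊆ Set.Ioo 0 R →
      ∫ r in Set.Ioo 0 R, ζ r * (r * sphereIntegral x (fun y => ∑ j, M y j j) r -
        ((n - 2) * (∫ t in (0 : ℝ)..r, sphereIntegral x (fun y => ∑ j, M y j j) t) +
          2 * (r * sphereIntegral x (radialM M x) r))) = 0 := by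
    intro ζ hζ hc hs
    obtain ⟨α, β, hα, -, hβ, h0⟩ := exists_tsupport_subset_Icc hR hc hs
    have hζc := hζ.continuous
    have hcp : Continuous (cutoffPrimitive R ζ) := (contDiff_cutoffPrimitive hζ).continuous
    have h1 := D.radial_inner hα hβ h0 hζ
    rw [← hRdef, integral_add (integrableOn_mul_radial hcp iT)
      (integrableOn_mul_radial (b := fun r => ζ r * r) (by fun_prop) iM),
      integral_ball_radial hn hcp iT,
      integral_ball_radial hn (b := fun r => ζ r * r) (by fun_prop) iM,
      integral_ball_radial hn
        (b := fun r => n * cutoffPrimitive R ζ r + ζ r * r) (by fun_prop) iT] at h1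
    have k1 := integrableOn_mul_Ioo hζc (integrableOn_mul_Ioo (b := fun r => r) continuous_id jT)
    have k2 := integrableOn_mul_primitive hζc hR jT
    have k3 := integrableOn_mul_Ioo hζc (integrableOn_mul_Ioo (b := fun r => r) continuous_id jM)
    have e1 : ∫ r in Set.Ioo 0 R, (n * cutoffPrimitive R ζ r + ζ r * r) *
        sphereIntegral x (fun y => ∑ j, M y j j) r =
        n * (∫ r in Set.Ioo 0 R, cutoffPrimitive R ζ r *
          sphereIntegral x (fun y => ∑ j, M y j j) r) +
          ∫ r in Set.Ioo 0 R, ζ r * (r * sphereIntegral x (fun y => ∑ j, M y j j) r) := by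
      have := integral_linear_combination n 1 0 (integrableOn_mul_Ioo hcp jT) k1 k1
      rw [one_mul, zero_mul, add_zero] at this
      rw [← this]
      congr 1
      ext r
      ring
    rw [e1, integral_cutoffPrimitive_mul hR hζ jT] at h1
    simp_rw [mul_assoc (ζ _)] at h1
    have e3 : ∫ r in Set.Ioo 0 R, ζ r * (r * sphereIntegral x (fun y => ∑ j, M y j j) r -
        ((n - 2) * (∫ t in (0 : ℝ)..r, sphereIntegral x (fun y => ∑ j, M y j j) t) +
          2 * (r * sphereIntegral x (radialM M x) r))) =
        (∫ r in Set.Ioo 0 R, ζ r * (r * sphereIntegral x (fun y => ∑ j, M y j j) r)) -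
        (((n : ℝ) - 2) * (∫ r in Set.Ioo 0 R, ζ r * ∫ t in (0 : ℝ)..r,
          sphereIntegral x (fun y => ∑ j, M y j j) t) +
        2 * ∫ r in Set.Ioo 0 R, ζ r * (r * sphereIntegral x (radialM M x) r)) := by
      have := integral_linear_combination 1 (-((n : ℝ) - 2)) (-2) k1 k2 k3
      refine Eq.trans ?_ (this.trans (by ring))
      congr 1
      ext r
      ring
    rw [e3]
    linarith
  refine ⟨hR, ju, jT, ?_, ?_, ?_, ?_, ?_, ?_⟩
  · filter_upwards [ae_restrict_mem measurableSet_Ioo] with r hr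
    exact sphereIntegral_nonneg D.u_nonneg hr.1.le
  · filter_upwards [ae_restrict_mem measurableSet_Ioo] with r hr
    exact sphereIntegral_nonneg (fun y => Finset.sum_nonneg fun j _ => D.M_diag_nonneg y j) hr.1.le
  · have := ae_eq_zero_of_integral_Ioo (jV.sub (by
      simpa using integrableOn_mul_primitive (b := fun _ => 1) (by fun_prop) hR jT)) hout
    filter_upwards [this] with r hr
    simp only [Pi.sub_apply] at hr
    linarith
  · have k1 := integrableOn_mul_Ioo (b := fun r => r) continuous_id ju
    have k2 : IntegrableOn (fun r => ∫ t in (0 : ℝ)..r, sphereIntegral x u t) (Set.Ioo 0 R) := by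
      simpa using integrableOn_mul_primitive (b := fun _ => 1) (by fun_prop) hR ju
    have k3 : IntegrableOn (fun r => ∫ t in (0 : ℝ)..r, t * sphereIntegral x (radialV V x) t)
        (Set.Ioo 0 R) := by
      simpa using integrableOn_mul_primitive (b := fun _ => 1) (by fun_prop) hR jrV
    have := ae_eq_zero_of_integral_Ioo
      (k1.sub ((k2.const_mul (n : ℝ)).add (k3.const_mul 2))) hgrad
    filter_upwards [this] with r hr
    simp only [Pi.sub_apply, Pi.add_apply] at hr
    rw [← hnm]
    linarith
  · have k1 := integrableOn_mul_Ioo (b := fun r => r) continuous_id jT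
    have k2 : IntegrableOn (fun r => ∫ t in (0 : ℝ)..r,
        sphereIntegral x (fun y => ∑ j, M y j j) t) (Set.Ioo 0 R) := by
      simpa using integrableOn_mul_primitive (b := fun _ => 1) (by fun_prop) hR jT
    have k3 := integrableOn_mul_Ioo (b := fun r => r) continuous_id jM
    have := ae_eq_zero_of_integral_Ioo
      (k1.sub ((k2.const_mul ((n : ℝ) - 2)).add (k3.const_mul 2))) hinn
    filter_upwards [this] with r hr
    simp only [Pi.sub_apply, Pi.add_apply] at hr
    rw [show (m : ℝ) - 1 = n - 2 by rw [hnm]; ring]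
    linarith
  · filter_upwards [ae_integrable_sphere hn iu, ae_integrable_sphere hn iV,
      ae_integrable_sphere hn iM, ae_restrict_mem measurableSet_Ioo] with r h1 h2 h3 hr
    -- The nonnegative form, integrated over the sphere, is a quadratic polynomial in `s` that is
    -- never negative; the sign of its discriminant is the Cauchy–Schwarz inequality.
    have h4 : ∀ s : ℝ, 0 ≤ sphereIntegral x u r * (s * s) +
        (2 * sphereIntegral x (radialV V x) r) * s + sphereIntegral x (radialM M x) r := by
      intro s
      have := sphereIntegral_nonneg (x := x)
        (F := fun y => 1 * radialM M x y + 2 * s * radialV V x y + s ^ 2 * u y)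
        (fun y => by have := D.radial_nonneg x y s; linarith) hr.1.le
      rw [sphereIntegral_quadratic _ _ _ h3 h2 h1] at this
      linarith
    have := discrim_le_zero h4
    unfold discrim at this
    linarith

theorem ae_eq_zero_of_sphereIntegral (D : EnergyDensities u V M) (hn : 1 ≤ n)
    (h : ∀ᵐ s ∂volume.restrict (Set.Ioo 0 (1 - ‖x‖)), sphereIntegral x u s = 0) :
    ∀ᵐ y ∂volume.restrict (ball x (1 - ‖x‖)), u y = 0 := by
  have h1 := integral_ball_eq hn (D.int_u' (x := x))
  rw [integral_congr_ae h, integral_zero,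
    integral_eq_zero_iff_of_nonneg (fun y => D.u_nonneg y) D.int_u'] at h1
  exact h1

/-- Unique continuation: a function vanishing near a point of the ball vanishes. -/
theorem ae_eq_zero_of_ball (D : EnergyDensities u V M) (hn : 1 ≤ n)
    (hx : x ∈ ball (0 : Euc n) 1) {δ : ℝ} (hδ : 0 < δ)
    (h : ∀ᵐ y ∂volume.restrict (ball x δ), u y = 0) :
    ∀ᵐ y ∂volume.restrict (ball x (1 - ‖x‖)), u y = 0 := by
  obtain ⟨m, rfl⟩ : ∃ m, n = m + 1 := ⟨n - 1, by omega⟩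
  have S := D.radialSystem rfl hx
  rcases S.asymptotics with h0 | ⟨hpos, -⟩
  · exact D.ae_eq_zero_of_sphereIntegral hn h0
  · exfalso
    have hR := S.pos
    -- The annulus lies in both balls. The integral of `u` over it is zero by hypothesis and
    -- positive in the present alternative.
    set r := min δ (1 - ‖x‖) / 3
    have hm : 0 < min δ (1 - ‖x‖) := lt_min hδ hR
    have hr : 0 < r := by positivity
    have h1 : 2 * r < min δ (1 - ‖x‖) := by simp only [r]; linarith
    have h2 := hpos r hr (h1.trans_le (min_le_right _ _))
    rw [← integral_annulus_eq hn hr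
      (D.int_u'.mono_set (ball_subset_ball (h1.le.trans (min_le_right _ _))))] at h2
    have h3 := ae_restrict_of_ae_restrict_of_subset
      (annulus_subset_ball x (h1.le.trans (min_le_left _ _))) h
    rw [integral_congr_ae h3, integral_zero] at h2
    exact lt_irrefl _ h2

/-- Vanishing near a point spreads to the largest ball about that point inside the unit ball.
Connectedness carries it to the origin, whose largest ball is the whole unit ball. -/
theorem ae_eq_zero_unit_ball (D : EnergyDensities u V M) (hn : 1 ≤ n)
    (hx : x ∈ ball (0 : Euc n) 1) (h : ∀ᵐ y ∂volume.restrict (ball x (1 - ‖x‖)), u y = 0) :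
    ∀ᵐ y ∂volume.restrict (ball (0 : Euc n) 1), u y = 0 := by
  -- the vanishing set is relatively open and closed
  set Z := {y : Euc n | y ∈ ball (0 : Euc n) 1 ∧
    ∀ᵐ z ∂volume.restrict (ball y (1 - ‖y‖)), u z = 0} with hZ
  have step : ∀ y ∈ Z, ∀ z ∈ ball (0 : Euc n) 1, z ∈ ball y (1 - ‖y‖) → z ∈ Z := by
    intro y hy z hz hzy
    refine ⟨hz, ?_⟩
    obtain ⟨δ, hδ, hsub⟩ := Metric.isOpen_iff.1 isOpen_ball z hzy
    exact D.ae_eq_zero_of_ball hn hz hδ (ae_restrict_of_ae_restrict_of_subset hsub hy.2)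
  have hsub : ball (0 : Euc n) 1 ⊆ Z := by
    have hpre : IsPreconnected (ball (0 : Euc n) 1) := (convex_ball _ _).isPreconnected
    refine hpre.subset_of_closure_inter_subset ?_ ⟨x, hx, hx, h⟩ ?_
    · rw [Metric.isOpen_iff]
      intro y hy
      have h1 : 0 < 1 - ‖y‖ := by simpa using hy.1
      exact ⟨1 - ‖y‖, h1, fun z hz => step y hy z (ball_subset hz) hz⟩
    · rintro y ⟨hy1, hy2⟩
      have h1 : 0 < 1 - ‖y‖ := by simpa using hy2
      -- Half the distance from `y` to the boundary is close enough for the largest ball about `z`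
      -- to contain `y`.
      obtain ⟨z, hz, hzy⟩ := Metric.mem_closure_iff.1 hy1 ((1 - ‖y‖) / 2) (by linarith)
      refine step z hz y hy2 ?_
      rw [mem_ball]
      have h2 : ‖z‖ ≤ ‖y‖ + dist y z := by
        have := norm_le_norm_add_norm_sub y z
        rwa [← dist_eq_norm] at this
      linarith
  have := (hsub (mem_ball_self one_pos)).2
  simpa using this

/-- Asymptotics at a point for nontrivial stationary densities. -/
theorem asymptotics (D : EnergyDensities u V M) (hn : 1 ≤ n)
    (hne : ¬ ∀ᵐ y ∂volume.restrict (ball (0 : Euc n) 1), u y = 0)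
    (hx : x ∈ ball (0 : Euc n) 1) :
    ∃ κ : ℝ, (∀ r, 0 < r → 2 * r < 1 - ‖x‖ → 0 < ∫ y in QValued.annulus x r, u y) ∧
      Tendsto (fun r => Real.log ((volume.real (QValued.annulus x r))⁻¹ *
        ∫ y in QValued.annulus x r, u y) / (2 * Real.log r)) (𝓝[>] 0) (𝓝 κ) ∧
      ∃ ε : ℝ → ℝ, (∀ r, 0 < r → 2 * r ≤ (1 - ‖x‖) / 2 → 0 ≤ ε r) ∧
        Tendsto ε (𝓝[>] 0) (𝓝 0) ∧
        ∀ r, 0 < r → 2 * r ≤ (1 - ‖x‖) / 2 →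
          ∫ y in QValued.annulus x r, (∑ j, ∑ k, M y j k * ((y - x) j * (y - x) k) +
              2 * (-κ) * ∑ j, V y j * (y - x) j + (-κ) ^ 2 * u y) ≤
            ε r * ∫ y in QValued.annulus x r, u y := by
  obtain ⟨m, rfl⟩ : ∃ m, n = m + 1 := ⟨n - 1, by omega⟩
  have S := D.radialSystem rfl hx
  have hR := S.pos
  have hannu : ∀ r, 0 < r → 2 * r < 1 - ‖x‖ → ∫ y in QValued.annulus x r, u y =
      ∫ s in r..(2 * r), sphereIntegral x u s := fun r hr hrR =>
    integral_annulus_eq hn hr (D.int_u'.mono_set (ball_subset_ball hrR.le))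
  rcases S.asymptotics with h0 | ⟨hpos, κ, hlog, ε, hε0, hε, hle⟩
  · exact absurd (D.ae_eq_zero_unit_ball hn hx (D.ae_eq_zero_of_sphereIntegral hn h0)) hne
  refine ⟨κ, fun r hr hrR => ?_, ?_, ε, hε0, hε, fun r hr hrR => ?_⟩
  · rw [hannu r hr hrR]
    exact hpos r hr hrR
  · have hσ := toSphere_real_univ_pos hn
    refine (hlog _ (inv_pos.2 hσ)).congr' ?_
    filter_upwards [Ioo_mem_nhdsGT (half_pos hR)] with r hr
    rw [volume_annulus_eq hn x hr.1, hannu r hr.1 (by linarith [hr.2])]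
    congr 2
    rw [mul_inv]
    simp only [Nat.add_sub_cancel]
    ring
  · rw [hannu r hr (by linarith)]
    refine le_trans (le_of_eq ?_) (hle r hr hrR)
    have hsub : ball x (2 * r) ⊆ ball x (1 - ‖x‖) := ball_subset_ball (by linarith)
    have iu := (D.int_u' (x := x)).mono_set hsub
    have iV := (D.int_radialV (x := x)).mono_set hsub
    have iM := (D.int_radialM (x := x)).mono_set hsub
    have iM' := integrableOn_mul_radial (b := fun r => r ^ 2) (by fun_prop) iM
    have iV' := integrableOn_mul_radial (b := fun r => r) (by fun_prop) iV
    -- Since `y - x = ‖y - x‖ ν`, the form with vector `y - x` and scalar `-κ` becomes a combination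
    -- of radial densities with coefficients that are constant on spheres.
    have e1 : ∀ y, ∑ j, ∑ k, M y j k * ((y - x) j * (y - x) k) +
        2 * (-κ) * ∑ j, V y j * (y - x) j + (-κ) ^ 2 * u y =
        1 * (‖y - x‖ ^ 2 * radialM M x y) + (-(2 * κ)) * (‖y - x‖ * radialV V x y) +
          κ ^ 2 * u y := by
      intro y
      simp only [radialM, radialV, ← norm_mul_radialDir, Finset.mul_sum]
      congr 1
      · congr 1
        · exact Finset.sum_congr rfl fun j _ => Finset.sum_congr rfl fun k _ => by ring
        · exact Finset.sum_congr rfl fun j _ => by ring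
      · ring
    simp_rw [e1]
    have hI : IntegrableOn (fun y => 1 * (‖y - x‖ ^ 2 * radialM M x y) +
        (-(2 * κ)) * (‖y - x‖ * radialV V x y) + κ ^ 2 * u y) (ball x (2 * r)) :=
      ((iM'.const_mul 1).add (iV'.const_mul (-(2 * κ)))).add (iu.const_mul (κ ^ 2))
    rw [integral_annulus_eq hn hr hI]
    refine RadialSystem.integral_congr_Ioo (R := 2 * r) ?_ hr.le (by linarith) le_rfl
    filter_upwards [ae_integrable_sphere hn iu, ae_integrable_sphere hn iV',
      ae_integrable_sphere hn iM', ae_restrict_mem measurableSet_Ioo] with s h1 h2 h3 hs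
    have := sphereIntegral_quadratic (x := x) (F := fun y => ‖y - x‖ ^ 2 * radialM M x y)
      (G := fun y => ‖y - x‖ * radialV V x y) (H := u) 1 (-(2 * κ)) (κ ^ 2) h3 h2 h1
    refine this.trans ?_
    have e2 : sphereIntegral x (fun y => ‖y - x‖ ^ 2 * radialM M x y) s =
      s ^ 2 * sphereIntegral x (radialM M x) s := sphereIntegral_mul _ (fun r => r ^ 2) hs.1
    have e3 : sphereIntegral x (fun y => ‖y - x‖ * radialV V x y) s =
      s * sphereIntegral x (radialV V x) s := sphereIntegral_mul _ (fun r => r) hs.1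
    rw [e2, e3]
    ring

end EnergyDensities

/-! ### Numberings of unordered tuples and the metric. -/

namespace QValued

section OfFn

variable {α β : Type*} {Q : ℕ}

theorem coe_ofFn (v : Fin Q → α) :
    ((ofFn v : Sym α Q) : Multiset α) = (Finset.univ : Finset (Fin Q)).val.map v := rfl

theorem exists_ofFn (T : Sym α Q) : ∃ v : Fin Q → α, ofFn v = T := by
  obtain ⟨s, hs⟩ := T
  induction s using Quotient.inductionOn with
  | h l =>
    have hl : l.length = Q := by simpa using hs
    subst hl
    refine ⟨l.get, Subtype.ext ?_⟩
    change (Finset.univ : Finset (Fin l.length)).val.map l.get = (l : Multiset α)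
    rw [Fin.univ_val_map, List.ofFn_get]

theorem ofFn_comp_perm (v : Fin Q → α) (σ : Equiv.Perm (Fin Q)) : ofFn (v ∘ σ) = ofFn v := by
  apply Subtype.ext
  change (Finset.univ : Finset (Fin Q)).val.map (v ∘ σ) = (Finset.univ : Finset (Fin Q)).val.map v
  have h := congrArg Finset.val (Finset.map_univ_equiv σ)
  rw [Finset.map_val] at h
  rw [← Multiset.map_map]
  exact congrArg (Multiset.map v) h

/-- Equal multisets have fibres of equal cardinality over every point; bijections between the fibres
glue to a permutation. -/
theorem exists_perm_of_ofFn_eq {v w : Fin Q → α} (h : ofFn v = ofFn w) :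
    ∃ σ : Equiv.Perm (Fin Q), v = w ∘ σ := by
  classical
  have h1 : (Finset.univ : Finset (Fin Q)).val.map v = (Finset.univ : Finset (Fin Q)).val.map w :=
    congrArg Subtype.val h
  have hcard : ∀ a, Fintype.card {i // v i = a} = Fintype.card {i // w i = a} := by
    intro a
    have := congrArg (Multiset.count a) h1
    rw [Multiset.count_map, Multiset.count_map] at this
    rw [Fintype.card_subtype, Fintype.card_subtype]
    simpa [Finset.card, Finset.filter, eq_comm] using this
  refine ⟨Equiv.ofFiberEquiv (f := v) (g := w) fun a => Fintype.equivOfCardEq (hcard a), ?_⟩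
  ext i
  exact (Equiv.ofFiberEquiv_map _ i).symm

theorem sum_ofFn (v : Fin Q → α) (F : α → ℝ) : sum (ofFn v) F = ∑ i, F (v i) := by
  unfold sum
  rw [coe_ofFn, Multiset.map_map]
  rfl

theorem map_ofFn (v : Fin Q → α) (g : α → β) : (ofFn v).map g = ofFn (g ∘ v) := by
  apply Subtype.ext
  change ((Finset.univ : Finset (Fin Q)).val.map v).map g =
    (Finset.univ : Finset (Fin Q)).val.map (g ∘ v)
  rw [Multiset.map_map]

theorem sum_map (J : Sym α Q) (g : α → β) (F : β → ℝ) :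
    sum (J.map g) F = sum J fun a => F (g a) := by
  obtain ⟨v, rfl⟩ := exists_ofFn J
  rw [map_ofFn, sum_ofFn, sum_ofFn]
  rfl

theorem replicate_eq_ofFn (a : α) : Sym.replicate Q a = ofFn fun _ => a := by
  apply Subtype.ext
  change Multiset.replicate Q a = (Finset.univ : Finset (Fin Q)).val.map fun _ => a
  simp

end OfFn

section Dist

variable {Q m : ℕ}

/-- The `ℓ²` distance of two numbered tuples. -/
noncomputable def cost (v w : Fin Q → Euc m) : ℝ := Real.sqrt (∑ i, ‖v i - w i‖ ^ 2)

theorem cost_nonneg (v w : Fin Q → Euc m) : 0 ≤ cost v w := Real.sqrt_nonneg _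

theorem cost_sq (v w : Fin Q → Euc m) : cost v w ^ 2 = ∑ i, ‖v i - w i‖ ^ 2 :=
  Real.sq_sqrt (Finset.sum_nonneg fun _ _ => sq_nonneg _)

theorem cost_comp_perm (v w : Fin Q → Euc m) (σ : Equiv.Perm (Fin Q)) :
    cost (v ∘ σ) (w ∘ σ) = cost v w := by
  unfold cost
  congr 1
  exact Equiv.sum_comp σ fun i => ‖v i - w i‖ ^ 2

theorem cost_eq_norm (v w : Fin Q → Euc m) :
    cost v w = ‖(WithLp.toLp 2 (v - w) : PiLp 2 fun _ : Fin Q => Euc m)‖ := by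
  rw [PiLp.norm_eq_of_L2]
  rfl

theorem cost_triangle (u v w : Fin Q → Euc m) : cost u w ≤ cost u v + cost v w := by
  simp only [cost_eq_norm]
  rw [← sub_add_sub_cancel u v w, WithLp.toLp_add]
  exact norm_add_le _ _

theorem cost_comm (v w : Fin Q → Euc m) : cost v w = cost w v := by
  unfold cost
  simp_rw [norm_sub_rev]

theorem norm_sub_le_cost (v w : Fin Q → Euc m) (i : Fin Q) : ‖v i - w i‖ ≤ cost v w := by
  rw [cost]
  apply Real.le_sqrt_of_sq_le
  exact Finset.single_le_sum (f := fun i => ‖v i - w i‖ ^ 2) (fun _ _ => sq_nonneg _)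
    (Finset.mem_univ i)

theorem cost_le_sum (v w : Fin Q → Euc m) : cost v w ≤ ∑ i, ‖v i - w i‖ := by
  rw [cost]
  apply Real.sqrt_le_iff.2 ⟨Finset.sum_nonneg fun _ _ => norm_nonneg _, ?_⟩
  exact Finset.sum_sq_le_sq_sum_of_nonneg fun _ _ => norm_nonneg _

theorem dist_ofFn_le (v w : Fin Q → Euc m) : dist (ofFn v) (ofFn w) ≤ cost v w :=
  csInf_le ⟨0, by rintro d ⟨v, w, -, -, rfl⟩; exact Real.sqrt_nonneg _⟩ ⟨v, w, rfl, rfl, rfl⟩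

/-- The minimum in the definition of the distance is attained, for any numbering of the first
tuple. -/
theorem exists_dist_eq (v : Fin Q → Euc m) (T : AQ Q m) :
    ∃ w, ofFn w = T ∧ dist (ofFn v) T = cost v w := by
  obtain ⟨w₀, rfl⟩ := exists_ofFn T
  -- Permuting both numberings simultaneously leaves the cost unchanged, so the first one can be
  -- frozen. The remaining set is finite, indexed by permutations, and its infimum is attained.
  have hset : {d : ℝ | ∃ v' w : Fin Q → Euc m, ofFn v' = ofFn v ∧ ofFn w = ofFn w₀ ∧
      d = Real.sqrt (∑ i, ‖v' i - w i‖ ^ 2)} =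
      Set.range fun σ : Equiv.Perm (Fin Q) => cost v (w₀ ∘ σ) := by
    ext d
    constructor
    · rintro ⟨v', w, hv, hw, rfl⟩
      obtain ⟨σ, rfl⟩ := exists_perm_of_ofFn_eq hv
      obtain ⟨τ, rfl⟩ := exists_perm_of_ofFn_eq hw
      refine ⟨σ.symm.trans τ, ?_⟩
      change cost v (w₀ ∘ (σ.symm.trans τ)) = cost (v ∘ σ) (w₀ ∘ τ)
      rw [← cost_comp_perm v _ σ]
      congr 1
      ext i : 1
      simp
    · rintro ⟨σ, rfl⟩
      exact ⟨v, w₀ ∘ σ, rfl, ofFn_comp_perm _ _, rfl⟩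
  have hmem := (Set.finite_range fun σ : Equiv.Perm (Fin Q) => cost v (w₀ ∘ σ)).isClosed.csInf_mem
    (Set.range_nonempty _) ⟨0, by rintro _ ⟨σ, rfl⟩; exact cost_nonneg _ _⟩
  rw [← hset] at hmem
  change dist (ofFn v) (ofFn w₀) ∈ _ at hmem
  rw [hset] at hmem
  obtain ⟨σ, hσ⟩ := hmem
  exact ⟨w₀ ∘ σ, ofFn_comp_perm _ _, hσ.symm⟩

theorem dist_nonneg (S T : AQ Q m) : 0 ≤ dist S T := by
  obtain ⟨v, rfl⟩ := exists_ofFn S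
  obtain ⟨w, -, h⟩ := exists_dist_eq v T
  rw [h]
  exact cost_nonneg _ _

theorem dist_comm_le (S T : AQ Q m) : dist S T ≤ dist T S := by
  obtain ⟨v, rfl⟩ := exists_ofFn T
  obtain ⟨w, rfl, h⟩ := exists_dist_eq v S
  rw [h, cost_comm]
  exact dist_ofFn_le w v

theorem dist_comm (S T : AQ Q m) : dist S T = dist T S :=
  le_antisymm (dist_comm_le _ _) (dist_comm_le _ _)

theorem dist_self (S : AQ Q m) : dist S S = 0 := by
  obtain ⟨v, rfl⟩ := exists_ofFn S
  refine le_antisymm ((dist_ofFn_le v v).trans ?_) (dist_nonneg _ _)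
  simp [cost]

/-- Because any numbering can be frozen, the numbering of `T` that is optimal against `S` also
serves as the starting one against `U`; the two matchings then compose. -/
theorem dist_triangle (S T U : AQ Q m) : dist S U ≤ dist S T + dist T U := by
  obtain ⟨v, rfl⟩ := exists_ofFn S
  obtain ⟨w, rfl, h1⟩ := exists_dist_eq v T
  obtain ⟨z, rfl, h2⟩ := exists_dist_eq w U
  rw [h1, h2]
  exact (dist_ofFn_le v z).trans (cost_triangle v w z)

theorem abs_dist_sub_dist_le (S T U : AQ Q m) : |dist S U - dist T U| ≤ dist S T := by
  rw [abs_le]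
  constructor
  · have := dist_triangle T S U
    rw [dist_comm T S] at this
    linarith
  · have := dist_triangle S T U
    linarith

/-- A countable dense sequence of tuples. -/
noncomputable def denseTuple (Q m : ℕ) (k : ℕ) : AQ Q m :=
  ofFn (TopologicalSpace.denseSeq (Fin Q → Euc m) k)

theorem exists_denseTuple (S : AQ Q m) {ε : ℝ} (hε : 0 < ε) :
    ∃ k, dist S (denseTuple Q m k) < ε := by
  obtain ⟨v, rfl⟩ := exists_ofFn S
  have hδ : 0 < ε / (Q + 1) := by positivity
  obtain ⟨k, hk⟩ := (TopologicalSpace.denseRange_denseSeq (Fin Q → Euc m)).exists_dist_lt v hδ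
  refine ⟨k, (dist_ofFn_le _ _).trans_lt ((cost_le_sum _ _).trans_lt ?_)⟩
  set w := TopologicalSpace.denseSeq (Fin Q → Euc m) k
  have : ∀ i, ‖v i - w i‖ ≤ ε / (Q + 1) := fun i => by
    rw [← dist_eq_norm]
    exact (dist_le_pi_dist v w i).trans hk.le
  calc ∑ i, ‖v i - w i‖ ≤ ∑ _i : Fin Q, ε / (Q + 1) := Finset.sum_le_sum fun i _ => this i
    _ = Q * (ε / (Q + 1)) := by simp
    _ < ε := by
      rw [← mul_div_assoc, div_lt_iff₀ (by positivity)]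
      nlinarith

/-- Dense tuples close to `T` suffice. The metric is thus recovered from countably many functions
`𝒢(·, Tₖ)`, and hypotheses that hold for each tuple off a null set yield statements off a common
null set. -/
theorem dist_le_of_forall_denseTuple {S T : AQ Q m} {c : ℝ}
    (h : ∀ k, |dist S (denseTuple Q m k) - dist T (denseTuple Q m k)| ≤ c) : dist S T ≤ c := by
  refine le_of_forall_pos_le_add fun ε hε => ?_
  obtain ⟨k, hk⟩ := exists_denseTuple T (half_pos hε)
  have h1 := (abs_le.1 (h k)).2
  have h2 := dist_triangle S (denseTuple Q m k) T
  rw [dist_comm (denseTuple Q m k) T] at h2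
  linarith

/-- All matchings with a constant tuple cost the same. Hence `𝒢(f, Q⟦0⟧)` is a scalar Sobolev
function whose square is `|f|²`. -/
theorem dist_replicate_sq (T : AQ Q m) : dist T (Sym.replicate Q 0) ^ 2 = sqNorm T := by
  obtain ⟨v, rfl⟩ := exists_ofFn T
  obtain ⟨w, hw, h⟩ := exists_dist_eq v (Sym.replicate Q 0)
  rw [replicate_eq_ofFn] at hw
  obtain ⟨σ, rfl⟩ := exists_perm_of_ofFn_eq hw
  rw [h, cost_sq, sqNorm, sum_ofFn]
  simp

theorem sqNorm_nonneg (T : AQ Q m) : 0 ≤ sqNorm T := by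
  rw [← dist_replicate_sq]
  positivity

theorem sqNorm_eq_zero {T : AQ Q m} : sqNorm T = 0 ↔ T = Sym.replicate Q 0 := by
  obtain ⟨v, rfl⟩ := exists_ofFn T
  constructor
  · intro h
    rw [sqNorm, sum_ofFn, Finset.sum_eq_zero_iff_of_nonneg fun _ _ => sq_nonneg _] at h
    rw [replicate_eq_ofFn]
    congr 1
    ext i : 1
    simpa using h i (Finset.mem_univ i)
  · intro h
    rw [h, replicate_eq_ofFn, sqNorm, sum_ofFn]
    simp

end Dist

end QValued

/-! ### Increments of Sobolev functions along segments. -/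

section Translation

variable {n : ℕ}

/-- The shear `(s, x) ↦ (s, x + s h)` preserves the product measure. -/
theorem integrable_segment {G : Euc n → ℝ} (hG : Integrable G) (h : Euc n) :
    Integrable (fun p : ℝ × Euc n => G (p.2 + p.1 • h))
      ((volume.restrict (Set.Ioc (0 : ℝ) 1)).prod volume) := by
  have hmp : MeasurePreserving (fun p : ℝ × Euc n => (p.1, p.2 + p.1 • h))
      ((volume.restrict (Set.Ioc (0 : ℝ) 1)).prod volume)
      ((volume.restrict (Set.Ioc (0 : ℝ) 1)).prod volume) := by
    refine (MeasurePreserving.id _).skew_product (g := fun s x => x + s • h) (by fun_prop) ?_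
    exact ae_of_all _ fun s => (measurePreserving_add_right volume (s • h)).map_eq
  have h2 : Integrable (fun p : ℝ × Euc n => G p.2)
      ((volume.restrict (Set.Ioc (0 : ℝ) 1)).prod volume) := by
    have := hG.comp_snd (volume.restrict (Set.Ioc (0 : ℝ) 1))
    exact this
  exact hmp.integrable_comp_of_integrable h2

/-- The average of `G` over the segment from `x` to `x + h`. -/
noncomputable def segmentAverage (G : Euc n → ℝ) (h x : Euc n) : ℝ :=
  ∫ s in (0 : ℝ)..1, G (x + s • h)

theorem integrable_segmentAverage {G : Euc n → ℝ} (hG : Integrable G) (h : Euc n) :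
    Integrable (segmentAverage G h) := by
  have := (integrable_segment hG h).integral_prod_right
  unfold segmentAverage
  simpa only [intervalIntegral.integral_of_le zero_le_one] using this

theorem sum_basisVec (h : Euc n) : h = ∑ j, h j • QValued.basisVec j := by
  ext i
  simp [QValued.basisVec, Pi.single_apply]

theorem tsupport_translate_subset {η : Euc n → ℝ} {δ : ℝ} (hη : tsupport η ⊆ ball 0 (1 - δ))
    {k : Euc n} (hk : ‖k‖ ≤ δ) : tsupport (fun x => η (x - k)) ⊆ ball 0 1 := by
  have h1 : tsupport (fun x => η (x - k)) = (fun x => x - k) ⁻¹' tsupport η :=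
    tsupport_comp_eq_preimage η (Homeomorph.subRight k)
  rw [h1]
  intro x hx
  have h2 := hη hx
  rw [mem_ball_zero_iff] at h2 ⊢
  have := norm_le_norm_add_norm_sub k x
  calc ‖x‖ = ‖(x - k) + k‖ := by rw [sub_add_cancel]
    _ ≤ ‖x - k‖ + ‖k‖ := norm_add_le _ _
    _ < 1 := by linarith

/-- Extension by zero lets the weak partials be combined into a directional derivative under
integrals over the whole space, where translations are available. -/
theorem integral_mul_fderiv_of_isWeakPartial {w : Euc n → ℝ} {g : Fin n → Euc n → ℝ}
    (hw : Integrable w) (hg : ∀ j, Integrable (g j))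
    (hweak : ∀ j, QValued.IsWeakPartial (ball 0 1) j w (g j))
    (hw0 : ∀ x, x ∉ ball (0 : Euc n) 1 → w x = 0)
    (hg0 : ∀ j x, x ∉ ball (0 : Euc n) 1 → g j x = 0) (h : Euc n) {η : Euc n → ℝ}
    (hη : ContDiff ℝ ∞ η) (hc : HasCompactSupport η) (hs : tsupport η ⊆ ball 0 1) :
    ∫ x, w x * fderiv ℝ η x h = - ∫ x, (∑ j, h j * g j x) * η x := by
  have hcont : ∀ v, Continuous fun x => fderiv ℝ η x v := fun v =>
    (hη.continuous_fderiv (by simp)).clm_apply continuous_const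
  have hb1 : ∀ v, ∃ C, ∀ x, ‖fderiv ℝ η x v‖ ≤ C := fun v =>
    HasCompactSupport.exists_bound_of_continuous (hc.fderiv_apply ℝ v) (hcont v)
  obtain ⟨C, hC⟩ := hc.exists_bound_of_continuous hη.continuous
  have h1 : ∀ j, ∫ x, w x * fderiv ℝ η x (QValued.basisVec j) = - ∫ x, g j x * η x := by
    intro j
    have := hweak j η hη hc hs
    rwa [setIntegral_eq_integral_of_forall_compl_eq_zero,
      setIntegral_eq_integral_of_forall_compl_eq_zero] at this
    · intro x hx; rw [hg0 j x hx, zero_mul]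
    · intro x hx; rw [hw0 x hx, zero_mul]
  have h2 : ∀ x, w x * fderiv ℝ η x h =
      ∑ j, h j * (w x * fderiv ℝ η x (QValued.basisVec j)) := by
    intro x
    conv_lhs => rw [sum_basisVec h]
    rw [map_sum, Finset.mul_sum]
    refine Finset.sum_congr rfl fun j _ => ?_
    rw [map_smul, smul_eq_mul]
    ring
  simp_rw [h2, Finset.sum_mul]
  rw [integral_finsetSum, integral_finsetSum, ← Finset.sum_neg_distrib]
  · refine Finset.sum_congr rfl fun j _ => ?_
    rw [integral_const_mul, h1]
    simp_rw [mul_assoc]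
    rw [integral_const_mul]
    ring
  · intro j _
    exact ((hg j).const_mul _).mul_bdd hη.continuous.aestronglyMeasurable (ae_of_all _ hC)
  · intro j _
    obtain ⟨C', hC'⟩ := hb1 (QValued.basisVec j)
    exact (hw.mul_bdd (hcont _).aestronglyMeasurable (ae_of_all _ hC')).const_mul _

/-- The fundamental theorem of calculus along segments for a Sobolev function. -/
theorem ae_sub_eq_segmentAverage {w : Euc n → ℝ} {g : Fin n → Euc n → ℝ}
    (hw : Integrable w) (hg : ∀ j, Integrable (g j))
    (hweak : ∀ j, QValued.IsWeakPartial (ball 0 1) j w (g j))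
    (hw0 : ∀ x, x ∉ ball (0 : Euc n) 1 → w x = 0)
    (hg0 : ∀ j x, x ∉ ball (0 : Euc n) 1 → g j x = 0) {h : Euc n} {δ : ℝ} (hδ : ‖h‖ ≤ δ) :
    ∀ᵐ x, x ∈ ball (0 : Euc n) (1 - δ) →
      w (x + h) - w x = segmentAverage (fun x => ∑ j, h j * g j x) h x := by
  set G := fun x => ∑ j, h j * g j x with hG
  have hGi : Integrable G := integrable_finsetSum _ fun j _ => (hg j).const_mul _
  have hA := integrable_segmentAverage hGi h
  have hwh : Integrable fun x => w (x + h) := hw.comp_add_right h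
  have key : ∀ᵐ x, x ∈ ball (0 : Euc n) (1 - δ) →
      w (x + h) - w x - segmentAverage G h x = 0 := by
    refine isOpen_ball.ae_eq_zero_of_integral_contDiff_smul_eq_zero
      (((hwh.sub hw).sub hA).locallyIntegrable.locallyIntegrableOn _) ?_
    intro η hη hc hs
    obtain ⟨C, hC⟩ := hc.exists_bound_of_continuous hη.continuous
    have hcont : Continuous fun x => fderiv ℝ η x h :=
      (hη.continuous_fderiv (by simp)).clm_apply continuous_const
    obtain ⟨C', hC'⟩ := (hc.fderiv_apply ℝ h).exists_bound_of_continuous hcont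
    have i1 : Integrable fun x => η x * w (x + h) :=
      hwh.bdd_mul hη.continuous.aestronglyMeasurable (ae_of_all _ hC)
    have i2 : Integrable fun x => η x * w x :=
      hw.bdd_mul hη.continuous.aestronglyMeasurable (ae_of_all _ hC)
    have i3 : Integrable fun x => η x * segmentAverage G h x :=
      hA.bdd_mul hη.continuous.aestronglyMeasurable (ae_of_all _ hC)
    have e0 : ∫ x, η x • (w (x + h) - w x - segmentAverage G h x) =
        (∫ x, η x * w (x + h)) - (∫ x, η x * w x) - ∫ x, η x * segmentAverage G h x := by
      have := EnergyDensities.integral_linear_combination 1 (-1) (-1) i1 i2 i3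
      refine Eq.trans ?_ (this.trans (by ring))
      congr 1
      ext x
      rw [smul_eq_mul]
      ring
    have hηh : Continuous fun x => η (x - h) := hη.continuous.comp (by fun_prop)
    have e1 : ∫ x, η x * w (x + h) = ∫ x, η (x - h) * w x := by
      rw [← integral_sub_right_eq_self (fun x => η x * w (x + h)) h]
      simp
    -- The translation is moved to `η`, whose increment is the integral of its derivative over the
    -- segment.
    have e2 : (∫ x, η x * w (x + h)) - ∫ x, η x * w x =
        - ∫ x, ∫ s in Set.Ioc (0 : ℝ) 1, w x * fderiv ℝ η (x - s • h) h := by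
      rw [e1, ← integral_sub (hw.bdd_mul hηh.aestronglyMeasurable
        (ae_of_all _ fun x => hC (x - h))) i2, ← integral_neg]
      congr 1
      ext x
      rw [integral_const_mul, ← intervalIntegral.integral_of_le zero_le_one]
      have hd : ∀ s ∈ Set.uIcc (0 : ℝ) 1, HasDerivAt (fun s : ℝ => η (x - s • h))
          (- fderiv ℝ η (x - s • h) h) s := by
        intro s _
        have h1 : HasDerivAt (fun s : ℝ => x - s • h) (-h) s := by
          simpa using ((hasDerivAt_id s).smul_const h).const_sub x
        have h2 := ((hη.differentiable (by simp)) (x - s • h)).hasFDerivAt.comp_hasDerivAt s h1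
        rw [map_neg] at h2
        exact h2
      have hci : Continuous fun s : ℝ => - fderiv ℝ η (x - s • h) h :=
        (hcont.comp (by fun_prop : Continuous fun s : ℝ => x - s • h)).neg
      have := intervalIntegral.integral_eq_sub_of_hasDerivAt hd (hci.intervalIntegrable _ _)
      rw [intervalIntegral.integral_neg] at this
      simp only [one_smul, zero_smul, sub_zero] at this
      linear_combination (-w x) * this
    have i4 : Integrable (fun p : Euc n × ℝ => w p.1 * fderiv ℝ η (p.1 - p.2 • h) h)
        (volume.prod (volume.restrict (Set.Ioc (0 : ℝ) 1))) := by
      have := hw.comp_fst (volume.restrict (Set.Ioc (0 : ℝ) 1))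
      refine this.mul_bdd (c := C')
        (hcont.comp (by fun_prop : Continuous fun p : Euc n × ℝ => p.1 - p.2 • h)
          ).aestronglyMeasurable (ae_of_all _ fun p => hC' _)
    -- For fixed `s` the weak derivative is tested with `η(· - s h)`, whose support stays in the
    -- unit ball because `‖s h‖ ≤ δ`. Translating back puts `s h` into the argument of `G`.
    have e3 : ∫ x, ∫ s in Set.Ioc (0 : ℝ) 1, w x * fderiv ℝ η (x - s • h) h =
        ∫ s in Set.Ioc (0 : ℝ) 1, - ∫ x, η x * G (x + s • h) := by
      rw [integral_integral_swap i4]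
      refine setIntegral_congr_fun measurableSet_Ioc fun s hs' => ?_
      have hsub : ‖s • h‖ ≤ δ := by
        rw [norm_smul, Real.norm_of_nonneg hs'.1.le]
        calc s * ‖h‖ ≤ 1 * ‖h‖ := by gcongr; exact hs'.2
          _ ≤ δ := by linarith
      have hηs : ContDiff ℝ ∞ fun x => η (x - s • h) := hη.comp (contDiff_id.sub contDiff_const)
      have hcs : HasCompactSupport fun x => η (x - s • h) :=
        hc.comp_homeomorph (Homeomorph.subRight (s • h))
      have h5 := integral_mul_fderiv_of_isWeakPartial hw hg hweak hw0 hg0 h hηs hcs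
        (tsupport_translate_subset hs hsub)
      simp only [fderiv_comp_sub] at h5
      rw [h5, ← integral_add_right_eq_self _ (s • h)]
      congr 2
      ext x
      simp only [add_sub_cancel_right, hG]
      ring
    have i5 : Integrable (fun p : ℝ × Euc n => η p.2 * G (p.2 + p.1 • h))
        ((volume.restrict (Set.Ioc (0 : ℝ) 1)).prod volume) :=
      (integrable_segment hGi h).bdd_mul
        (hη.continuous.comp continuous_snd).aestronglyMeasurable (ae_of_all _ fun p => hC p.2)
    have e4 : ∫ x, η x * segmentAverage G h x =
        ∫ s in Set.Ioc (0 : ℝ) 1, ∫ x, η x * G (x + s • h) := by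
      rw [integral_integral_swap i5]
      congr 1
      ext x
      rw [integral_const_mul, segmentAverage, intervalIntegral.integral_of_le zero_le_one]
    rw [e0, e2, e3, e4, integral_neg]
    ring
  filter_upwards [key] with x hx hxb
  have := hx hxb
  linarith

/-- Translations act continuously on `L^p`. -/
theorem tendsto_eLpNorm_translate {p : ℝ≥0∞} [Fact (1 ≤ p)] (hp : p ≠ ⊤) {F : Euc n → ℝ}
    (hF : MemLp F p) :
    Tendsto (fun h => eLpNorm (fun x => F (x + h) - F x) p volume) (𝓝 0) (𝓝 0) := by
  let τ : Euc n → C(Euc n, Euc n) := fun h => ⟨fun x => x + h, by fun_prop⟩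
  have hτ : Continuous τ := by
    refine ContinuousMap.continuous_of_continuous_uncurry _ ?_
    change Continuous fun p : Euc n × Euc n => p.2 + p.1
    fun_prop
  have hmp : ∀ h, MeasurePreserving (τ h) volume volume :=
    fun h => measurePreserving_add_right volume h
  have h1 : Continuous fun h => Lp.compMeasurePreserving (τ h) (hmp h) (hF.toLp F) :=
    continuous_const.compMeasurePreservingLp hτ hmp hp
  have h2 := tendsto_iff_edist_tendsto_0.1 (h1.tendsto (0 : Euc n))
  refine h2.congr fun h => ?_
  rw [Lp.toLp_compMeasurePreserving, Lp.toLp_compMeasurePreserving, Lp.edist_toLp_toLp]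
  congr 1
  ext x
  simp [τ]

end Translation

/-! ### `L²` estimates and convergence of segment averages. -/

section L2

theorem eLpNorm_two_sq {α : Type*} [MeasurableSpace α] {μ : Measure α} (f : α → ℝ) :
    eLpNorm f 2 μ ^ 2 = ∫⁻ x, ‖f x‖ₑ ^ 2 ∂μ := by
  have := eLpNorm_nnreal_pow_eq_lintegral (f := f) (μ := μ) (p := 2) two_ne_zero
  simpa using this

theorem lintegral_mul_le_eLpNorm_two {α : Type*} [MeasurableSpace α] {μ : Measure α}
    {f g : α → ℝ} (hf : AEStronglyMeasurable f μ) (hg : AEStronglyMeasurable g μ) :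
    ∫⁻ x, ‖f x‖ₑ * ‖g x‖ₑ ∂μ ≤ eLpNorm f 2 μ * eLpNorm g 2 μ := by
  have h := ENNReal.lintegral_mul_le_Lp_mul_Lq μ (p := 2) (q := 2)
    ⟨by norm_num, by norm_num, by norm_num⟩ hf.enorm hg.enorm
  refine h.trans_eq ?_
  rw [eLpNorm_eq_lintegral_rpow_enorm_toReal two_ne_zero ENNReal.ofNat_ne_top,
    eLpNorm_eq_lintegral_rpow_enorm_toReal two_ne_zero ENNReal.ofNat_ne_top]
  rfl

theorem sq_lintegral_le {α : Type*} [MeasurableSpace α] {μ : Measure α} [IsProbabilityMeasure μ]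
    {f : α → ℝ≥0∞} (hf : AEMeasurable f μ) : (∫⁻ x, f x ∂μ) ^ 2 ≤ ∫⁻ x, f x ^ 2 ∂μ := by
  have h := ENNReal.lintegral_mul_le_Lp_mul_Lq μ (p := 2) (q := 2)
    ⟨by norm_num, by norm_num, by norm_num⟩ hf (aemeasurable_const (b := (1 : ℝ≥0∞)))
  simp only [Pi.mul_apply, mul_one, ENNReal.one_rpow, lintegral_const, measure_univ,
    ENNReal.rpow_ofNat, one_pow] at h
  calc (∫⁻ x, f x ∂μ) ^ 2 ≤ ((∫⁻ x, f x ^ 2 ∂μ) ^ ((1 : ℝ) / 2)) ^ 2 := by gcongr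
    _ = _ := by
      rw [← ENNReal.rpow_natCast, ← ENNReal.rpow_mul]
      simp

end L2

section SegmentAverage

variable {n : ℕ}

instance : IsProbabilityMeasure (volume.restrict (Set.Ioc (0 : ℝ) 1)) := ⟨by simp⟩

/-- Averages over short segments converge in `L²`. -/
theorem tendsto_eLpNorm_segmentAverage {G : Euc n → ℝ} (hm : Measurable G) (hG : MemLp G 2)
    (hGi : Integrable G) :
    Tendsto (fun h => eLpNorm (fun x => segmentAverage G h x - G x) 2 volume) (𝓝 0) (𝓝 0) := by
  rw [ENNReal.tendsto_nhds_zero]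
  intro ε hε
  have h1 := (ENNReal.tendsto_nhds_zero.1
    (tendsto_eLpNorm_translate (p := 2) ENNReal.ofNat_ne_top hG)) ε hε
  obtain ⟨δ, hδ, hball⟩ := Metric.eventually_nhds_iff.1 h1
  refine Metric.eventually_nhds_iff.2 ⟨δ, hδ, fun h hh => ?_⟩
  rw [dist_zero_right] at hh
  have hmeas : Measurable fun p : Euc n × ℝ => ‖G (p.1 + p.2 • h) - G p.1‖ₑ ^ 2 := by
    fun_prop
  rw [← ENNReal.pow_le_pow_left_iff two_ne_zero, eLpNorm_two_sq]
  have hslice := (integrable_segment hGi h).prod_left_ae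
  -- Jensen's inequality in `s`. Tonelli then leaves the translation differences `G(· + s h) - G`,
  -- all with `‖s h‖ < δ`.
  have hae : ∀ᵐ x : Euc n, ‖segmentAverage G h x - G x‖ₑ ^ 2 ≤
      ∫⁻ s in Set.Ioc (0 : ℝ) 1, ‖G (x + s • h) - G x‖ₑ ^ 2 := by
    filter_upwards [hslice] with x hx
    have e1 : segmentAverage G h x - G x = ∫ s in Set.Ioc (0 : ℝ) 1, (G (x + s • h) - G x) := by
      rw [integral_sub hx (by simp), segmentAverage,
        intervalIntegral.integral_of_le zero_le_one]
      simp
    rw [e1]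
    refine le_trans ?_ (sq_lintegral_le ?_)
    · gcongr
      exact enorm_integral_le_lintegral_enorm _
    · exact Measurable.aemeasurable (by fun_prop)
  calc ∫⁻ x, ‖segmentAverage G h x - G x‖ₑ ^ 2
      ≤ ∫⁻ x, ∫⁻ s in Set.Ioc (0 : ℝ) 1, ‖G (x + s • h) - G x‖ₑ ^ 2 := lintegral_mono_ae hae
    _ = ∫⁻ s in Set.Ioc (0 : ℝ) 1, ∫⁻ x, ‖G (x + s • h) - G x‖ₑ ^ 2 :=
      lintegral_lintegral_swap hmeas.aemeasurable
    _ ≤ ∫⁻ s in Set.Ioc (0 : ℝ) 1, ε ^ 2 := by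
      refine setLIntegral_mono' measurableSet_Ioc fun s hs => ?_
      rw [← eLpNorm_two_sq (fun x => G (x + s • h) - G x)]
      have : dist (s • h) 0 < δ := by
        rw [dist_zero_right, norm_smul, Real.norm_of_nonneg hs.1.le]
        calc s * ‖h‖ ≤ 1 * ‖h‖ := by gcongr; exact hs.2
          _ < δ := by rwa [one_mul]
      gcongr
      exact hball this
    _ = ε ^ 2 := by simp

end SegmentAverage

/-! ### Scalar Sobolev functions and the chain rule for the square. -/

/-- A real Sobolev function on the unit ball, extended by `0`, with its weak gradient. -/
structure SobolevPair {n : ℕ} (w : Euc n → ℝ) (g : Fin n → Euc n → ℝ) : Prop where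
  meas : Measurable w
  memLp : MemLp w 2
  zero : ∀ x, x ∉ ball (0 : Euc n) 1 → w x = 0
  meas_g : ∀ j, Measurable (g j)
  memLp_g : ∀ j, MemLp (g j) 2
  zero_g : ∀ j x, x ∉ ball (0 : Euc n) 1 → g j x = 0
  weak : ∀ j, QValued.IsWeakPartial (ball 0 1) j w (g j)

theorem integrable_of_memLp_two {n : ℕ} {F : Euc n → ℝ} (hF : MemLp F 2)
    (h0 : ∀ x, x ∉ ball (0 : Euc n) 1 → F x = 0) : Integrable F := by
  have h1 : IntegrableOn F (ball 0 1) := by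
    have : IsFiniteMeasure (volume.restrict (ball (0 : Euc n) 1)) :=
      ⟨by simpa using measure_ball_lt_top⟩
    exact (hF.restrict _).integrable one_le_two
  rw [← integrable_indicator_iff measurableSet_ball] at h1
  convert! h1 using 1
  ext x
  by_cases hx : x ∈ ball (0 : Euc n) 1
  · rw [Set.indicator_of_mem hx]
  · rw [Set.indicator_of_notMem hx, h0 x hx]

namespace SobolevPair

variable {n : ℕ} {w : Euc n → ℝ} {g : Fin n → Euc n → ℝ}

theorem integrable (P : SobolevPair w g) : Integrable w := integrable_of_memLp_two P.memLp P.zero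

theorem integrable_g (P : SobolevPair w g) (j : Fin n) : Integrable (g j) :=
  integrable_of_memLp_two (P.memLp_g j) (P.zero_g j)

theorem ae_sub_eq (P : SobolevPair w g) {h : Euc n} {δ : ℝ} (hδ : ‖h‖ ≤ δ) :
    ∀ᵐ x, x ∈ ball (0 : Euc n) (1 - δ) →
      w (x + h) - w x = segmentAverage (fun x => ∑ j, h j * g j x) h x :=
  ae_sub_eq_segmentAverage P.integrable P.integrable_g P.weak P.zero P.zero_g hδ

theorem ae_sub_eq_basis (P : SobolevPair w g) (j : Fin n) {t δ : ℝ} (ht : |t| ≤ δ) :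
    ∀ᵐ x, x ∈ ball (0 : Euc n) (1 - δ) →
      w (x + t • QValued.basisVec j) - w x =
        t * segmentAverage (g j) (t • QValued.basisVec j) x := by
  have h1 : ‖t • (QValued.basisVec j : Euc n)‖ ≤ δ := by
    simpa [norm_smul, QValued.basisVec] using ht
  filter_upwards [P.ae_sub_eq h1] with x hx hxb
  rw [hx hxb, segmentAverage, segmentAverage, ← intervalIntegral.integral_const_mul]
  congr 1
  ext s
  simp [QValued.basisVec]

theorem exists_tsupport_margin {η : Euc n → ℝ} (hc : HasCompactSupport η)
    (hs : tsupport η ⊆ ball 0 1) : ∃ δ > 0, tsupport η ⊆ ball 0 (1 - δ) := by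
  rcases (tsupport η).eq_empty_or_nonempty with h0 | hne
  · exact ⟨1, one_pos, by simp [h0]⟩
  · obtain ⟨x, hx, hmax⟩ := hc.isCompact.exists_isMaxOn hne continuous_norm.continuousOn
    have h1 : ‖x‖ < 1 := by simpa using hs hx
    refine ⟨(1 - ‖x‖) / 2, by linarith, fun y hy => ?_⟩
    have h2 : ‖y‖ ≤ ‖x‖ := hmax hy
    rw [mem_ball_zero_iff]
    linarith

theorem hasDerivAt_integral_translate {F : Euc n → ℝ} (hF : Integrable F) {η : Euc n → ℝ}
    (hη : ContDiff ℝ ∞ η) (hc : HasCompactSupport η) (v : Euc n) :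
    HasDerivAt (fun t : ℝ => ∫ x, F x * η (x - t • v)) (- ∫ x, F x * fderiv ℝ η x v) 0 := by
  have hcont : Continuous fun x => fderiv ℝ η x v :=
    (hη.continuous_fderiv (by simp)).clm_apply continuous_const
  obtain ⟨C, hC⟩ := hc.exists_bound_of_continuous hη.continuous
  obtain ⟨C', hC'⟩ := (hc.fderiv_apply ℝ v).exists_bound_of_continuous hcont
  have hηt : ∀ t : ℝ, Continuous fun x => η (x - t • v) := fun t =>
    hη.continuous.comp (by fun_prop)
  have hηt' : ∀ t : ℝ, Continuous fun x => fderiv ℝ η (x - t • v) v := fun t =>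
    hcont.comp (by fun_prop : Continuous fun x : Euc n => x - t • v)
  have h := hasDerivAt_integral_of_dominated_loc_of_deriv_le (μ := volume) (𝕜 := ℝ)
    (F := fun (t : ℝ) x => F x * η (x - t • v))
    (F' := fun (t : ℝ) x => F x * (- fderiv ℝ η (x - t • v) v)) (x₀ := 0) (s := Set.univ)
    (bound := fun x => ‖F x‖ * C') Filter.univ_mem
    (Eventually.of_forall fun t => hF.1.mul (hηt t).aestronglyMeasurable)
    (hF.mul_bdd (hηt 0).aestronglyMeasurable (ae_of_all _ fun x => hC _))
    (hF.1.mul (hηt' 0).neg.aestronglyMeasurable)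
    (ae_of_all _ fun x t _ => by
      rw [norm_mul, norm_neg]
      gcongr
      exact hC' _)
    (hF.norm.mul_const _)
    (ae_of_all _ fun x t _ => by
      have h1 : HasDerivAt (fun s : ℝ => x - s • v) (-v) t := by
        simpa using ((hasDerivAt_id t).smul_const v).const_sub x
      have h2 := ((hη.differentiable (by simp)) (x - t • v)).hasFDerivAt.comp_hasDerivAt t h1
      rw [map_neg] at h2
      exact h2.const_mul (F x))
  have h3 := h.2
  simp only [zero_smul, sub_zero, mul_neg, integral_neg] at h3
  exact h3

/-- The chain rule for the square of a Sobolev function. -/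
theorem integral_sq_mul_fderiv (P : SobolevPair w g) (j : Fin n) {η : Euc n → ℝ}
    (hη : ContDiff ℝ ∞ η) (hc : HasCompactSupport η) (hs : tsupport η ⊆ ball 0 1) :
    ∫ x, w x ^ 2 * fderiv ℝ η x (QValued.basisVec j) = - ∫ x, 2 * (w x * g j x) * η x := by
  set e : Euc n := QValued.basisVec j with he
  obtain ⟨δ, hδ, hsδ⟩ := exists_tsupport_margin hc hs
  obtain ⟨C, hC⟩ := hc.exists_bound_of_continuous hη.continuous
  have hC0 : 0 ≤ C := (norm_nonneg _).trans (hC 0)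
  have hw2 : Integrable fun x => w x ^ 2 := P.memLp.integrable_sq
  have hwg : Integrable fun x => w x * g j x := P.memLp.integrable_mul (P.memLp_g j)
  have hd := hasDerivAt_integral_translate hw2 hη hc e
  have hslope := hasDerivAt_iff_tendsto_slope.1 hd
  set G := g j with hGdef
  -- The derivative at `0` of `t ↦ ∫ w² η(· - t e)` is computed twice: by differentiating `η`, and
  -- as the limit of the difference quotients `S t` of `w²`.
  set S : ℝ → ℝ := fun t => ∫ x, t⁻¹ * (w (x + t • e) ^ 2 - w x ^ 2) * η x with hS
  have iη : ∀ t : ℝ, Integrable fun x => w (x + t • e) ^ 2 * η x := fun t =>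
    (hw2.comp_add_right (t • e)).mul_bdd hη.continuous.aestronglyMeasurable (ae_of_all _ hC)
  have i0 : Integrable fun x => w x ^ 2 * η x :=
    hw2.mul_bdd hη.continuous.aestronglyMeasurable (ae_of_all _ hC)
  have hSi : ∀ t, Integrable fun x => t⁻¹ * (w (x + t • e) ^ 2 - w x ^ 2) * η x := by
    intro t
    refine (((iη t).sub i0).const_mul t⁻¹).congr (ae_of_all _ fun x => ?_)
    simp only [Pi.sub_apply]
    ring
  have hslope_eq : ∀ t, slope (fun t : ℝ => ∫ x, w x ^ 2 * η (x - t • e)) 0 t = S t := by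
    intro t
    have e1 : ∫ x, w x ^ 2 * η (x - t • e) = ∫ x, w (x + t • e) ^ 2 * η x := by
      rw [← integral_add_right_eq_self _ (t • e)]
      simp
    simp only [slope, vsub_eq_sub, smul_eq_mul, sub_zero, zero_smul]
    rw [e1, ← integral_sub (iη t) i0, ← integral_const_mul]
    congr 1
    ext x
    ring
  have i2 : Integrable fun x => 2 * (w x * G x) * η x :=
    (hwg.const_mul 2).mul_bdd hη.continuous.aestronglyMeasurable (ae_of_all _ hC)
  have hte : Tendsto (fun t : ℝ => t • e) (𝓝[≠] 0) (𝓝 0) := by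
    have : Tendsto (fun t : ℝ => t • e) (𝓝 0) (𝓝 ((0 : ℝ) • e)) := tendsto_id.smul_const e
    rw [zero_smul] at this
    exact this.mono_left nhdsWithin_le_nhds
  have hT1 := (tendsto_eLpNorm_translate (p := 2) ENNReal.ofNat_ne_top P.memLp).comp hte
  have hT2 := (tendsto_eLpNorm_segmentAverage (P.meas_g j) (P.memLp_g j)
    (P.integrable_g j)).comp hte
  have hlim : Tendsto S (𝓝[≠] 0) (𝓝 (∫ x, 2 * (w x * G x) * η x)) := by
    rw [tendsto_iff_edist_tendsto_0]
    set a : ℝ → ℝ≥0∞ := fun t => eLpNorm (fun x => w (x + t • e) - w x) 2 volume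
    set b : ℝ → ℝ≥0∞ := fun t => eLpNorm (fun x => segmentAverage G (t • e) x - G x) 2 volume
    have ha : Tendsto a (𝓝[≠] 0) (𝓝 0) := hT1
    have hb : Tendsto b (𝓝[≠] 0) (𝓝 0) := hT2
    set K := ENNReal.ofReal C
    have hbound : Tendsto (fun t => K * (a t * b t + a t * eLpNorm G 2 volume +
        2 * eLpNorm w 2 volume * b t)) (𝓝[≠] 0) (𝓝 0) := by
      have t1 : Tendsto (fun t => a t * b t) (𝓝[≠] 0) (𝓝 (0 * 0)) :=
        ENNReal.Tendsto.mul ha (Or.inr ENNReal.zero_ne_top) hb (Or.inr ENNReal.zero_ne_top)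
      have t2 : Tendsto (fun t => a t * eLpNorm G 2 volume) (𝓝[≠] 0)
          (𝓝 (0 * eLpNorm G 2 volume)) :=
        ENNReal.Tendsto.mul_const ha (Or.inr (P.memLp_g j).2.ne)
      have t3 : Tendsto (fun t => 2 * eLpNorm w 2 volume * b t) (𝓝[≠] 0)
          (𝓝 (2 * eLpNorm w 2 volume * 0)) :=
        ENNReal.Tendsto.const_mul hb (Or.inr (ENNReal.mul_ne_top (by simp) P.memLp.2.ne))
      have t4 := ENNReal.Tendsto.const_mul (a := K) ((t1.add t2).add t3) (Or.inr ENNReal.ofReal_ne_top)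
      simpa using t4
    refine tendsto_of_tendsto_of_tendsto_of_le_of_le' tendsto_const_nhds hbound
      (Eventually.of_forall fun _ => bot_le) ?_
    have hev : ∀ᶠ t : ℝ in 𝓝[≠] 0, |t| ≤ δ := by
      have : ∀ᶠ t : ℝ in 𝓝 0, |t| < δ := by
        have := Metric.ball_mem_nhds (0 : ℝ) hδ
        filter_upwards [this] with t ht
        simpa using ht
      exact (this.filter_mono nhdsWithin_le_nhds).mono fun t ht => ht.le
    filter_upwards [hev, self_mem_nhdsWithin] with t ht ht0
    have ht0' : t ≠ 0 := ht0
    have hAm : AEStronglyMeasurable (segmentAverage G (t • e)) volume :=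
      (integrable_segmentAverage (P.integrable_g j) _).1
    have hwm : AEStronglyMeasurable w volume := P.memLp.1
    have hGm : AEStronglyMeasurable G volume := (P.memLp_g j).1
    have hwt : AEStronglyMeasurable (fun x => w (x + t • e) - w x) volume := by
      have := P.meas
      exact Measurable.aestronglyMeasurable (by fun_prop)
    have hAG : AEStronglyMeasurable (fun x => segmentAverage G (t • e) x - G x) volume :=
      hAm.sub hGm
    rw [edist_eq_enorm_sub, hS, ← integral_sub (hSi t) i2]
    refine (enorm_integral_le_lintegral_enorm _).trans ?_
    have hpt : ∀ᵐ x, ‖t⁻¹ * (w (x + t • e) ^ 2 - w x ^ 2) * η x - 2 * (w x * G x) * η x‖ₑ ≤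
        K * (‖w (x + t • e) - w x‖ₑ * ‖segmentAverage G (t • e) x - G x‖ₑ +
          ‖w (x + t • e) - w x‖ₑ * ‖G x‖ₑ +
          2 * (‖w x‖ₑ * ‖segmentAverage G (t • e) x - G x‖ₑ)) := by
      filter_upwards [P.ae_sub_eq_basis j ht] with x hx
      by_cases hxs : x ∈ tsupport η
      · have h1 := hx (hsδ hxs)
        rw [← he] at h1
        -- Each summand contains a factor that tends to `0` in `L²`, either the increment of `w` or
        -- the error of the segment average; Hölder's inequality handles the products.
        have e2 : t⁻¹ * (w (x + t • e) ^ 2 - w x ^ 2) * η x - 2 * (w x * G x) * η x =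
            η x * ((w (x + t • e) - w x) * (segmentAverage G (t • e) x - G x) +
            (w (x + t • e) - w x) * G x + 2 * (w x * (segmentAverage G (t • e) x - G x))) := by
          have h2 : t⁻¹ * (w (x + t • e) ^ 2 - w x ^ 2) =
              (w (x + t • e) + w x) * segmentAverage G (t • e) x := by
            have : w (x + t • e) ^ 2 - w x ^ 2 =
              (w (x + t • e) + w x) * (w (x + t • e) - w x) := by ring
            rw [this, h1, mul_left_comm, inv_mul_cancel_left₀ ht0']
          rw [h2]
          ring
        rw [e2, enorm_mul]
        gcongr
        · rw [Real.enorm_eq_ofReal_abs]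
          exact ENNReal.ofReal_le_ofReal (hC x)
        · refine (enorm_add_le _ _).trans ?_
          gcongr
          · refine (enorm_add_le _ _).trans ?_
            rw [enorm_mul, enorm_mul]
          · rw [enorm_mul, enorm_mul]
            gcongr
            simp [Real.enorm_eq_ofReal_abs]
      · rw [image_eq_zero_of_notMem_tsupport hxs]
        simp
    refine (lintegral_mono_ae hpt).trans ?_
    rw [lintegral_const_mul' _ _ ENNReal.ofReal_ne_top]
    gcongr
    have m1 : AEMeasurable (fun x =>
        ‖w (x + t • e) - w x‖ₑ * ‖segmentAverage G (t • e) x - G x‖ₑ) volume :=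
      hwt.enorm.mul hAG.enorm
    have m2 : AEMeasurable (fun x => ‖w (x + t • e) - w x‖ₑ *
        ‖segmentAverage G (t • e) x - G x‖ₑ + ‖w (x + t • e) - w x‖ₑ * ‖G x‖ₑ) volume :=
      m1.add (hwt.enorm.mul hGm.enorm)
    rw [lintegral_add_left' m2, lintegral_add_left' m1, lintegral_const_mul' _ _ (by simp),
      mul_assoc]
    gcongr
    · exact lintegral_mul_le_eLpNorm_two hwt hAG
    · exact lintegral_mul_le_eLpNorm_two hwt hGm
    · exact lintegral_mul_le_eLpNorm_two hwm hAG
  have h1 := tendsto_nhds_unique (hslope.congr hslope_eq) hlim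
  linarith

end SobolevPair

/-! ### Gradient bounds for tuple-valued Sobolev functions. -/

namespace QValued

variable {n m Q : ℕ}

/-- `Φ` bounds the weak gradients of all the functions `𝒢(f, T)`; all functions are extended
by `0` outside the unit ball. -/
structure HasGradientBound (f : Euc n → AQ Q m) (Φ : Fin n → Euc n → ℝ) : Prop where
  meas : ∀ j, Measurable (Φ j)
  nonneg : ∀ j x, 0 ≤ Φ j x
  memLp : ∀ j, MemLp (Φ j) 2
  zero : ∀ j x, x ∉ ball (0 : Euc n) 1 → Φ j x = 0
  pair : ∀ T : AQ Q m, ∃ (w : Euc n → ℝ) (g : Fin n → Euc n → ℝ), SobolevPair w g ∧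
    (∀ᵐ x, x ∈ ball (0 : Euc n) 1 → w x = dist (f x) T) ∧ ∀ j x, |g j x| ≤ Φ j x

theorem exists_measurable_extension {Ω : Set (Euc n)} (hΩ : MeasurableSet Ω) {F : Euc n → ℝ}
    (hF : MemLp F 2 (volume.restrict Ω)) :
    ∃ G : Euc n → ℝ, Measurable G ∧ MemLp G 2 ∧ (∀ x, x ∉ Ω → G x = 0) ∧
      ∀ᵐ x ∂volume.restrict Ω, G x = F x := by
  refine ⟨Ω.indicator (hF.1.mk F), hF.1.stronglyMeasurable_mk.measurable.indicator hΩ, ?_,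
    fun x hx => Set.indicator_of_notMem hx _, ?_⟩
  · rw [memLp_indicator_iff_restrict hΩ]
    exact (memLp_congr_ae hF.1.ae_eq_mk).1 hF
  · filter_upwards [hF.1.ae_eq_mk, ae_restrict_mem hΩ] with x hx hxΩ
    rw [Set.indicator_of_mem hxΩ, hx]

theorem IsWeakPartial.congr {Ω : Set (Euc n)} {j : Fin n} {u g u' g' : Euc n → ℝ}
    (h : IsWeakPartial Ω j u g) (hu : ∀ᵐ x ∂volume.restrict Ω, u' x = u x)
    (hg : ∀ᵐ x ∂volume.restrict Ω, g' x = g x) : IsWeakPartial Ω j u' g' := by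
  intro φ h1 h2 h3
  have e1 : ∫ x in Ω, u' x * fderiv ℝ φ x (basisVec j) =
      ∫ x in Ω, u x * fderiv ℝ φ x (basisVec j) := integral_congr_ae <| by
    filter_upwards [hu] with x hx
    rw [hx]
  have e2 : ∫ x in Ω, g' x * φ x = ∫ x in Ω, g x * φ x := integral_congr_ae <| by
    filter_upwards [hg] with x hx
    rw [hx]
  rw [e1, e2]
  exact h φ h1 h2 h3

/-- Passage to measurable representatives, extended by zero, for which the gradient bound holds at
every point and can therefore be integrated along any segment. -/
theorem MemW12.exists_hasGradientBound {f : Euc n → AQ Q m} (hf : MemW12 (ball 0 1) f) :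
    ∃ Φ, HasGradientBound f Φ := by
  obtain ⟨φ, hφ, hT⟩ := hf
  choose Φ hΦm hΦ2 hΦ0 hΦe using fun j => exists_measurable_extension measurableSet_ball (hφ j)
  refine ⟨fun j x => |Φ j x|, fun j => (hΦm j).abs, fun j x => abs_nonneg _,
    fun j => (hΦ2 j).abs, fun j x hx => by simp [hΦ0 j x hx], fun T => ?_⟩
  obtain ⟨hw, hg⟩ := hT T
  choose g hg2 hgw hgb using hg
  obtain ⟨w, hwm, hw2, hw0, hwe⟩ := exists_measurable_extension measurableSet_ball hw
  choose G hGm hG2 hG0 hGe using fun j => exists_measurable_extension measurableSet_ball (hg2 j)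
  -- Truncation at `±|Φ j|` enforces the bound everywhere and alters the weak derivative on a null
  -- set only.
  have hclip : ∀ j x, |max (-|Φ j x|) (min (G j x) |Φ j x|)| ≤ |Φ j x| := by
    intro j x
    have := abs_nonneg (Φ j x)
    rw [abs_le]
    exact ⟨le_max_left _ _, max_le (by linarith) (min_le_right _ _)⟩
  have hmeas : ∀ j, Measurable fun x => max (-|Φ j x|) (min (G j x) |Φ j x|) := fun j =>
    (hΦm j).abs.neg.max ((hGm j).min (hΦm j).abs)
  refine ⟨w, fun j x => max (-|Φ j x|) (min (G j x) |Φ j x|), ⟨hwm, hw2, hw0, hmeas, fun j => ?_,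
    fun j x hx => ?_, fun j => ?_⟩, (ae_restrict_iff' measurableSet_ball).1 hwe, hclip⟩
  · refine (hΦ2 j).mono (hmeas j).aestronglyMeasurable (ae_of_all _ fun x => ?_)
    exact hclip j x
  · simp [hΦ0 j x hx]
  · refine (hgw j).congr hwe ?_
    filter_upwards [hGe j, hΦe j, hgb j] with x h1 h2 h3
    rw [← h1] at h3
    rw [h2]
    have h4 : 0 ≤ φ j x := (abs_nonneg _).trans h3
    rw [abs_of_nonneg h4, ← h1, min_eq_left (abs_le.1 h3).2, max_eq_right (abs_le.1 h3).1]

namespace HasGradientBound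

variable {f : Euc n → AQ Q m} {Φ : Fin n → Euc n → ℝ}

theorem integrable (B : HasGradientBound f Φ) (j : Fin n) : Integrable (Φ j) :=
  integrable_of_memLp_two (B.memLp j) (B.zero j)

/-- A bound for the directional derivative in the direction `v`. -/
theorem ae_dist_le (B : HasGradientBound f Φ) {h : Euc n} {δ : ℝ} (hδ : ‖h‖ ≤ δ) :
    ∀ᵐ x, x ∈ ball (0 : Euc n) (1 - δ) →
      dist (f (x + h)) (f x) ≤ segmentAverage (fun x => ∑ j, |h j| * Φ j x) h x := by
  -- Countably many target tuples determine the distance, so the exceptional null sets can be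
  -- united.
  choose w g hP hw hg using fun k => B.pair (denseTuple Q m k)
  have h1 : ∀ᵐ x, ∀ k, x ∈ ball (0 : Euc n) (1 - δ) →
      w k (x + h) - w k x = segmentAverage (fun x => ∑ j, h j * g k j x) h x :=
    ae_all_iff.2 fun k => (hP k).ae_sub_eq hδ
  have h2 : ∀ᵐ x, ∀ k, x ∈ ball (0 : Euc n) 1 → w k x = dist (f x) (denseTuple Q m k) :=
    ae_all_iff.2 hw
  have h3 : ∀ᵐ x, ∀ k, x + h ∈ ball (0 : Euc n) 1 →
      w k (x + h) = dist (f (x + h)) (denseTuple Q m k) :=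
    (measurePreserving_add_right volume h).quasiMeasurePreserving.ae h2
  have hi : Integrable fun x => ∑ j, |h j| * Φ j x :=
    integrable_finsetSum _ fun j _ => (B.integrable j).const_mul _
  have h4 : ∀ᵐ x : Euc n, Integrable (fun s : ℝ => ∑ j, |h j| * Φ j (x + s • h))
      (volume.restrict (Set.Ioc 0 1)) := (integrable_segment hi h).prod_left_ae
  filter_upwards [h1, h2, h3, h4] with x e1 e2 e3 e4 hx
  have hx1 : ‖x‖ < 1 - δ := by simpa using hx
  have b1 : x ∈ ball (0 : Euc n) 1 := by
    rw [mem_ball_zero_iff]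
    linarith [norm_nonneg h]
  have b2 : x + h ∈ ball (0 : Euc n) 1 := by
    rw [mem_ball_zero_iff]
    linarith [norm_add_le x h]
  refine dist_le_of_forall_denseTuple fun k => ?_
  rw [← e2 k b1, ← e3 k b2, e1 k hx, segmentAverage, segmentAverage,
    intervalIntegral.integral_of_le zero_le_one, intervalIntegral.integral_of_le zero_le_one]
  rw [← Real.norm_eq_abs]
  refine (norm_integral_le_integral_norm _).trans ?_
  refine integral_mono_of_nonneg (ae_of_all _ fun s => norm_nonneg _) e4 (ae_of_all _ fun s => ?_)
  refine (norm_sum_le _ _).trans (Finset.sum_le_sum fun j _ => ?_)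
  rw [norm_mul, Real.norm_eq_abs, Real.norm_eq_abs]
  exact mul_le_mul_of_nonneg_left (hg k j _) (abs_nonneg _)

end HasGradientBound

end QValued

/-! ### Pointwise Lipschitz estimates by the maximal function. -/

section SegmentIntegral

variable {n : ℕ}

/-- The bound for the increment from `x` to `x + h` given by the upper gradient `ψ`. -/
noncomputable def segmentBound (ψ : Euc n → ℝ≥0∞) (x h : Euc n) : ℝ≥0∞ :=
  ‖h‖ₑ * ∫⁻ s in Set.Ioc (0 : ℝ) 1, ψ (x + s • h)

theorem measurable_segmentBound {ψ : Euc n → ℝ≥0∞} (hψ : Measurable ψ) :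
    Measurable fun p : Euc n × Euc n => segmentBound ψ p.1 p.2 := by
  unfold segmentBound
  refine Measurable.mul (by fun_prop) ?_
  exact Measurable.lintegral_prod_right'
    (f := fun p : (Euc n × Euc n) × ℝ => ψ (p.1.1 + p.2 • p.1.2)) (by fun_prop)

theorem measurable_segmentBound_sub {ψ : Euc n → ℝ≥0∞} (hψ : Measurable ψ) (x : Euc n) :
    Measurable fun z => segmentBound ψ x (z - x) := by
  unfold segmentBound
  refine Measurable.mul (by fun_prop) ?_
  exact Measurable.lintegral_prod_right'
    (f := fun p : Euc n × ℝ => ψ (x + p.2 • (p.1 - x))) (by fun_prop)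

theorem setLIntegral_closedBall_smul {ψ : Euc n → ℝ≥0∞} (hψ : Measurable ψ) (x : Euc n)
    {s r : ℝ} (hs : 0 < s) : ∫⁻ h in closedBall 0 r, ψ (x + s • h) =
      ENNReal.ofReal (s ^ n)⁻¹ * ∫⁻ h in closedBall 0 (s * r), ψ (x + h) := by
  have h1 := Measure.map_addHaar_smul (volume : Measure (Euc n)) hs.ne'
  rw [finrank_euclideanSpace_fin, abs_of_pos (by positivity)] at h1
  have h2 : (closedBall (0 : Euc n) r) = (fun h => s • h) ⁻¹' closedBall 0 (s * r) := by
    ext h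
    simp [norm_smul, abs_of_pos hs, hs]
  have hm : Measurable fun h : Euc n => s • h := by fun_prop
  rw [h2, ← setLIntegral_map (f := fun h => ψ (x + h)) measurableSet_closedBall (by fun_prop) hm,
    h1, Measure.restrict_smul, lintegral_smul_measure, smul_eq_mul]

/-- Tonelli and the substitution `h ↦ s h`: the Jacobian `s^{-n}` is compensated by the volume of
the ball of radius `s r`, on which the average of `ψ` is at most `K`. -/
theorem setLIntegral_segmentBound_le {ψ : Euc n → ℝ≥0∞} (hψ : Measurable ψ) {x : Euc n} {r : ℝ}
    {K : ℝ≥0∞} (hr : 0 < r)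
    (hK : ∀ t, 0 < t → t ≤ r → ∫⁻ h in closedBall 0 t, ψ (x + h) ≤
      K * volume (closedBall (0 : Euc n) t)) :
    ∫⁻ h in closedBall 0 r, segmentBound ψ x h ≤
      ENNReal.ofReal r * (K * volume (closedBall (0 : Euc n) r)) := by
  have hm : Measurable fun p : Euc n × ℝ => ψ (x + p.2 • p.1) := by fun_prop
  calc ∫⁻ h in closedBall 0 r, segmentBound ψ x h
      ≤ ∫⁻ h in closedBall 0 r, ENNReal.ofReal r * ∫⁻ s in Set.Ioc (0 : ℝ) 1, ψ (x + s • h) := by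
        refine setLIntegral_mono' measurableSet_closedBall fun h hh => ?_
        unfold segmentBound
        gcongr
        rw [← ofReal_norm]
        exact ENNReal.ofReal_le_ofReal (by simpa using hh)
    _ = ENNReal.ofReal r *
        ∫⁻ s in Set.Ioc (0 : ℝ) 1, ∫⁻ h in closedBall 0 r, ψ (x + s • h) := by
        rw [lintegral_const_mul' _ _ ENNReal.ofReal_ne_top,
          lintegral_lintegral_swap hm.aemeasurable]
    _ ≤ ENNReal.ofReal r *
        ∫⁻ s in Set.Ioc (0 : ℝ) 1, K * volume (closedBall (0 : Euc n) r) := by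
        refine mul_le_mul' le_rfl (setLIntegral_mono' measurableSet_Ioc fun s hs => ?_)
        rw [setLIntegral_closedBall_smul hψ x hs.1]
        have h1 := hK (s * r) (mul_pos hs.1 hr) (mul_le_of_le_one_left hr.le hs.2)
        rw [Measure.addHaar_closedBall_mul volume (0 : Euc n) hs.1.le hr.le,
          finrank_euclideanSpace_fin] at h1
        calc _ ≤ ENNReal.ofReal (s ^ n)⁻¹ *
              (K * (ENNReal.ofReal (s ^ n) * volume (closedBall (0 : Euc n) r))) := by gcongr
          _ = (ENNReal.ofReal (s ^ n)⁻¹ * ENNReal.ofReal (s ^ n)) *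
              (K * volume (closedBall (0 : Euc n) r)) := by ring
          _ = _ := by
            rw [← ENNReal.ofReal_mul (inv_nonneg.2 (pow_nonneg hs.1.le _)),
              inv_mul_cancel₀ (pow_ne_zero _ hs.1.ne'), ENNReal.ofReal_one, one_mul]
    _ = _ := by simp

/-- For each fixed `h` the increment formula holds at almost every `x`. Fubini exchanges the two
quantifiers, so that the base point can be fixed first. -/
theorem SobolevPair.ae_ae_enorm_sub_le {w : Euc n → ℝ} {g : Fin n → Euc n → ℝ}
    (P : SobolevPair w g) {ψ : Euc n → ℝ≥0∞} (hψ : Measurable ψ)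
    (hg : ∀ x, ∑ j, ‖g j x‖ₑ ≤ ψ x) :
    ∀ᵐ x, ∀ᵐ h, ‖x‖ + ‖h‖ < 1 → ‖w (x + h) - w x‖ₑ ≤ segmentBound ψ x h := by
  have hmeas : MeasurableSet {p : Euc n × Euc n | ‖p.1‖ + ‖p.2‖ < 1 →
      ‖w (p.1 + p.2) - w p.1‖ₑ ≤ segmentBound ψ p.1 p.2} := by
    have := P.meas
    have := measurable_segmentBound hψ
    refine MeasurableSet.imp ?_ ?_
    · exact measurableSet_lt (by fun_prop) (by fun_prop)
    · exact measurableSet_le (by fun_prop) this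
  rw [Measure.ae_ae_comm hmeas]
  refine ae_of_all _ fun h => ?_
  filter_upwards [P.ae_sub_eq (le_refl ‖h‖)] with x hx hxh
  rw [hx (by rw [mem_ball_zero_iff]; linarith), segmentAverage,
    intervalIntegral.integral_of_le zero_le_one]
  refine (enorm_integral_le_lintegral_enorm _).trans ?_
  rw [segmentBound, ← lintegral_const_mul' _ _ enorm_ne_top]
  refine lintegral_mono fun s => ?_
  calc ‖∑ j, h j * g j (x + s • h)‖ₑ ≤ ∑ j, ‖h j * g j (x + s • h)‖ₑ := enorm_sum_le _ _
    _ ≤ ∑ j, ‖h‖ₑ * ‖g j (x + s • h)‖ₑ := by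
      refine Finset.sum_le_sum fun j _ => ?_
      rw [enorm_mul]
      gcongr
      rw [enorm_le_iff_norm_le]
      exact PiLp.norm_apply_le h j
    _ = ‖h‖ₑ * ∑ j, ‖g j (x + s • h)‖ₑ := by rw [Finset.mul_sum]
    _ ≤ _ := by gcongr; exact hg _

theorem setLIntegral_closedBall_add (ψ : Euc n → ℝ≥0∞) (x : Euc n) (r : ℝ) :
    ∫⁻ h in closedBall 0 r, ψ (x + h) = ∫⁻ z in closedBall x r, ψ z := by
  rw [← lintegral_indicator measurableSet_closedBall,
    ← lintegral_indicator measurableSet_closedBall,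
    ← lintegral_add_left_eq_self ((closedBall x r).indicator ψ) x]
  congr 1
  ext h
  by_cases hh : h ∈ closedBall (0 : Euc n) r
  · rw [Set.indicator_of_mem hh, Set.indicator_of_mem (by simpa using hh)]
  · rw [Set.indicator_of_notMem hh, Set.indicator_of_notMem (by simpa using hh)]

theorem setLIntegral_segmentBound_sub_le {ψ : Euc n → ℝ≥0∞} (hψ : Measurable ψ) {a : Euc n}
    {r : ℝ} {K : ℝ≥0∞} (hr : 0 < r) {D : Set (Euc n)} (ha : D ⊆ closedBall a r)
    (hK : ∀ t, 0 < t → t ≤ r → ∫⁻ h in closedBall 0 t, ψ (a + h) ≤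
      K * volume (closedBall (0 : Euc n) t)) :
    ∫⁻ z in D, segmentBound ψ a (z - a) ≤
      ENNReal.ofReal r * (K * volume (closedBall (0 : Euc n) r)) := by
  refine le_trans ?_ (setLIntegral_segmentBound_le hψ hr hK)
  have := setLIntegral_closedBall_add (fun z => segmentBound ψ a (z - a)) a r
  simp only [add_sub_cancel_left] at this
  rw [this]
  exact lintegral_mono_set ha

/-- Pointwise Lipschitz estimate between two points at which the maximal function of the upper
gradient is controlled. -/
theorem enorm_sub_le_of_maximal {w : Euc n → ℝ} {ψ : Euc n → ℝ≥0∞} (hψ : Measurable ψ)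
    {x y : Euc n} {K : ℝ≥0∞} (hxy : x ≠ y) (hx1 : ‖x‖ + ‖x - y‖ < 1) (hy1 : ‖y‖ + ‖x - y‖ < 1)
    (hx : ∀ᵐ h, ‖x‖ + ‖h‖ < 1 → ‖w (x + h) - w x‖ₑ ≤ segmentBound ψ x h)
    (hy : ∀ᵐ h, ‖y‖ + ‖h‖ < 1 → ‖w (y + h) - w y‖ₑ ≤ segmentBound ψ y h)
    (hKx : ∀ t, 0 < t → t ≤ ‖x - y‖ → ∫⁻ h in closedBall 0 t, ψ (x + h) ≤
      K * volume (closedBall (0 : Euc n) t))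
    (hKy : ∀ t, 0 < t → t ≤ ‖x - y‖ → ∫⁻ h in closedBall 0 t, ψ (y + h) ≤
      K * volume (closedBall (0 : Euc n) t)) :
    ‖w x - w y‖ₑ ≤ 2 ^ (n + 1) * K * ENNReal.ofReal ‖x - y‖ := by
  set r := ‖x - y‖ with hr
  have hr0 : 0 < r := norm_pos_iff.2 (sub_ne_zero.2 hxy)
  -- This ball lies in the balls of radius `r` about `x` and about `y`. The triangle inequality
  -- through `z` is averaged over `z` in `D`; the ratio of volumes contributes `2^n`, and the two
  -- end points a further `2`.
  set D := closedBall (midpoint ℝ x y) (r / 2) with hD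
  have hDx : ∀ z ∈ D, ‖z - x‖ ≤ r := fun z hz => by
    have h1 := dist_triangle z (midpoint ℝ x y) x
    have h2 := mem_closedBall.1 hz
    rw [dist_midpoint_left, dist_eq_norm x y, ← hr, Real.norm_two] at h1
    rw [← dist_eq_norm]
    linarith
  have hDy : ∀ z ∈ D, ‖z - y‖ ≤ r := fun z hz => by
    have h1 := dist_triangle z (midpoint ℝ x y) y
    have h2 := mem_closedBall.1 hz
    rw [dist_midpoint_right, dist_eq_norm x y, ← hr, Real.norm_two] at h1
    rw [← dist_eq_norm]
    linarith
  have hb := measurable_segmentBound_sub hψ x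
  have hIx := setLIntegral_segmentBound_sub_le hψ hr0
    (fun z hz => mem_closedBall_iff_norm.2 (hDx z hz) : D ⊆ closedBall x r) hKx
  have hIy := setLIntegral_segmentBound_sub_le hψ hr0
    (fun z hz => mem_closedBall_iff_norm.2 (hDy z hz) : D ⊆ closedBall y r) hKy
  have hae : ∀ᵐ z ∂volume.restrict D,
      ‖w x - w y‖ₑ ≤ segmentBound ψ x (z - x) + segmentBound ψ y (z - y) := by
    rw [ae_restrict_iff' measurableSet_closedBall]
    have h1 := (measurePreserving_sub_right volume x).quasiMeasurePreserving.ae hx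
    have h2 := (measurePreserving_sub_right volume y).quasiMeasurePreserving.ae hy
    filter_upwards [h1, h2] with z e1 e2 hz
    have f1 := e1 (by linarith [hDx z hz])
    have f2 := e2 (by linarith [hDy z hz])
    rw [add_sub_cancel] at f1 f2
    calc ‖w x - w y‖ₑ = ‖(w z - w y) - (w z - w x)‖ₑ := by congr 1; ring
      _ ≤ ‖w z - w y‖ₑ + ‖w z - w x‖ₑ := enorm_sub_le
      _ ≤ _ := by rw [add_comm]; gcongr
  have hvol : volume (closedBall (0 : Euc n) r) = 2 ^ n * volume D := by
    rw [hD, Measure.addHaar_closedBall_center volume (midpoint ℝ x y) (r / 2)]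
    have := Measure.addHaar_closedBall_mul volume (0 : Euc n) (r := 2) (s := r / 2) (by norm_num)
      (by positivity)
    rw [mul_div_cancel₀ r two_ne_zero, finrank_euclideanSpace_fin] at this
    rw [this, ENNReal.ofReal_pow (by norm_num), ENNReal.ofReal_ofNat]
  have hDpos : volume D ≠ 0 := (measure_closedBall_pos volume _ (half_pos hr0)).ne'
  have hDfin : volume D ≠ ⊤ := measure_closedBall_lt_top.ne
  have hint : ‖w x - w y‖ₑ * volume D ≤
      (2 ^ (n + 1) * K * ENNReal.ofReal r) * volume D := by
    calc ‖w x - w y‖ₑ * volume D = ∫⁻ z in D, ‖w x - w y‖ₑ := by simp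
      _ ≤ ∫⁻ z in D, (segmentBound ψ x (z - x) + segmentBound ψ y (z - y)) :=
        lintegral_mono_ae hae
      _ = _ := lintegral_add_left hb _
      _ ≤ ENNReal.ofReal r * (K * volume (closedBall (0 : Euc n) r)) +
          ENNReal.ofReal r * (K * volume (closedBall (0 : Euc n) r)) :=
        add_le_add hIx hIy
      _ = _ := by rw [hvol]; ring
  exact (ENNReal.mul_le_mul_iff_left hDpos hDfin).1 hint

end SegmentIntegral

/-! ### Covering by sets with a controlled maximal function. -/

section MaximalSet

variable {n : ℕ}

/-- Points at which the averages of `ψ` over small balls are at most `k`. -/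
def maximalSet (ψ : Euc n → ℝ≥0∞) (k : ℕ) : Set (Euc n) :=
  {x | ‖x‖ + 1 / ((k : ℝ) + 1) < 1 ∧ ∀ q : ℚ, 0 < (q : ℝ) → (q : ℝ) < 2 / ((k : ℝ) + 1) →
    ∫⁻ h in closedBall 0 (q : ℝ), ψ (x + h) ≤ k * volume (closedBall (0 : Euc n) (q : ℝ))}

/-- The definition uses rational radii so that this is a countable intersection. -/
theorem measurableSet_maximalSet {ψ : Euc n → ℝ≥0∞} (hψ : Measurable ψ) (k : ℕ) :
    MeasurableSet (maximalSet ψ k) := by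
  have h : maximalSet ψ k = {x | ‖x‖ + 1 / ((k : ℝ) + 1) < 1} ∩ ⋂ q : ℚ, ⋂ _ : 0 < (q : ℝ),
      ⋂ _ : (q : ℝ) < 2 / ((k : ℝ) + 1), {x | ∫⁻ h in closedBall 0 (q : ℝ), ψ (x + h) ≤
        k * volume (closedBall (0 : Euc n) (q : ℝ))} := by
    ext x
    simp [maximalSet]
  rw [h]
  refine MeasurableSet.inter (measurableSet_lt (measurable_norm.add_const _) measurable_const) ?_
  refine MeasurableSet.iInter fun q => MeasurableSet.iInter fun _ => MeasurableSet.iInter fun _ => ?_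
  refine measurableSet_le ?_ measurable_const
  exact Measurable.lintegral_prod_right' (f := fun p : Euc n × Euc n => ψ (p.1 + p.2))
    (by fun_prop)

/-- A rational radius between `t` and `2 t` costs the doubling factor `2^n`. This is why the set
controls radii up to `2 / (k + 1)`. -/
theorem setLIntegral_le_of_mem_maximalSet {ψ : Euc n → ℝ≥0∞} {k : ℕ} {x : Euc n}
    (hx : x ∈ maximalSet ψ k) {t : ℝ} (ht : 0 < t) (htk : t < 1 / ((k : ℝ) + 1)) :
    ∫⁻ h in closedBall 0 t, ψ (x + h) ≤ (2 ^ n * k) * volume (closedBall (0 : Euc n) t) := by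
  obtain ⟨q, hq1, hq2⟩ := exists_rat_btwn (show t < 2 * t by linarith)
  have h2 : (q : ℝ) < 2 / ((k : ℝ) + 1) := by
    have : 2 / ((k : ℝ) + 1) = 2 * (1 / ((k : ℝ) + 1)) := by ring
    linarith
  calc ∫⁻ h in closedBall 0 t, ψ (x + h) ≤ ∫⁻ h in closedBall 0 (q : ℝ), ψ (x + h) :=
        lintegral_mono_set (closedBall_subset_closedBall hq1.le)
    _ ≤ k * volume (closedBall (0 : Euc n) (q : ℝ)) := hx.2 q (ht.trans hq1) h2
    _ ≤ k * volume (closedBall (0 : Euc n) (2 * t)) := by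
        gcongr
    _ = _ := by
        rw [Measure.addHaar_closedBall_mul volume (0 : Euc n) (by norm_num) ht.le,
          finrank_euclideanSpace_fin, ENNReal.ofReal_pow (by norm_num), ENNReal.ofReal_ofNat]
        ring

/-- Differentiation of measures: at almost every point the averages over small balls converge to a
finite limit. The index `k` is taken above a bound for them, above `2 / ρ` for the range of radii,
and above `1 / (1 - ‖x‖)` for the distance to the boundary. -/
theorem ae_mem_maximalSet {ψ : Euc n → ℝ≥0∞} (hfin : ∫⁻ x, ψ x ≠ ⊤) :
    ∀ᵐ x, x ∈ ball (0 : Euc n) 1 → ∃ k, x ∈ maximalSet ψ k := by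
  have : IsFiniteMeasure ((volume : Measure (Euc n)).withDensity ψ) := isFiniteMeasure_withDensity hfin
  filter_upwards [Besicovitch.ae_tendsto_rnDeriv (volume.withDensity ψ) (volume : Measure (Euc n)),
    Measure.rnDeriv_lt_top (volume.withDensity ψ) (volume : Measure (Euc n))] with x hx hlt hxb
  rw [mem_ball_zero_iff] at hxb
  obtain ⟨a, ha1, ha2⟩ := ENNReal.lt_iff_exists_nnreal_btwn.1 hlt
  obtain ⟨ρ, hρ, hρ2⟩ := (mem_nhdsGT_iff_exists_Ioo_subset).1 (hx.eventually (gt_mem_nhds ha1))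
  obtain ⟨k, hk⟩ := exists_nat_gt (max (a : ℝ) (max (2 / ρ) (1 / (1 - ‖x‖))))
  have hk1 := (le_max_left _ _).trans_lt hk
  have hk2 := ((le_max_left _ _).trans (le_max_right _ _)).trans_lt hk
  have hk3 := ((le_max_right _ _).trans (le_max_right _ _)).trans_lt hk
  have hρ' : 0 < ρ := hρ
  have hk0 : (0 : ℝ) ≤ k := Nat.cast_nonneg k
  refine ⟨k, ?_, fun q hq0 hq => ?_⟩
  · rw [div_lt_iff₀ (by linarith)] at hk3
    have : 1 / ((k : ℝ) + 1) < 1 - ‖x‖ := by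
      rw [div_lt_iff₀ (by positivity)]
      nlinarith
    linarith
  · have hqρ : (q : ℝ) ∈ Set.Ioo 0 ρ := by
      refine ⟨hq0, hq.trans ?_⟩
      rw [div_lt_iff₀ hρ'] at hk2
      rw [div_lt_iff₀ (by positivity)]
      nlinarith
    have h1 : volume.withDensity ψ (closedBall x (q : ℝ)) / volume (closedBall x (q : ℝ)) < a :=
      hρ2 hqρ
    have hpos : volume (closedBall x (q : ℝ)) ≠ 0 := (measure_closedBall_pos volume _ hq0).ne'
    have h2 := (ENNReal.div_le_iff hpos measure_closedBall_lt_top.ne).1 h1.le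
    rw [withDensity_apply _ measurableSet_closedBall] at h2
    have h3 : ∫⁻ h in closedBall 0 (q : ℝ), ψ (x + h) = ∫⁻ z in closedBall x (q : ℝ), ψ z := by
      exact setLIntegral_closedBall_add ψ x _
    rw [h3, ← Measure.addHaar_closedBall_center volume x]
    refine h2.trans ?_
    gcongr
    exact_mod_cast hk1.le

end MaximalSet

namespace QValued

variable {n m Q : ℕ}

/-- Lusin-type approximation: the ball is covered, up to a null set, by countably many measurable
sets on which `f` is Lipschitz. -/
theorem HasGradientBound.exists_lipschitz_cover {f : Euc n → AQ Q m} {Φ : Fin n → Euc n → ℝ}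
    (B : HasGradientBound f Φ) :
    ∃ S : ℕ → Set (Euc n), (∀ i, MeasurableSet (S i)) ∧ (∀ i, S i ⊆ ball 0 1) ∧
      (∀ i, ∃ C : ℝ, 0 ≤ C ∧ ∀ x ∈ S i, ∀ y ∈ S i, dist (f x) (f y) ≤ C * ‖x - y‖) ∧
      ∀ᵐ x, x ∈ ball (0 : Euc n) 1 → ∃ i, x ∈ S i := by
  choose w g hP hw hg using fun k => B.pair (denseTuple Q m k)
  set ψ : Euc n → ℝ≥0∞ := fun x => ∑ j, ‖Φ j x‖ₑ with hψdef
  have hψ : Measurable ψ := by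
    have := B.meas
    fun_prop
  have hfin : ∫⁻ x, ψ x ≠ ⊤ := by
    rw [hψdef, lintegral_finsetSum _ fun j _ => (B.meas j).enorm]
    exact ENNReal.sum_ne_top.2 fun j _ => (B.integrable j).2.ne
  have hgψ : ∀ k x, ∑ j, ‖g k j x‖ₑ ≤ ψ x := fun k x => by
    refine Finset.sum_le_sum fun j _ => ?_
    rw [enorm_le_iff_norm_le, Real.norm_eq_abs, Real.norm_eq_abs, abs_of_nonneg (B.nonneg j x)]
    exact hg k j x
  have hgood : ∀ᵐ x, ∀ k, (x ∈ ball (0 : Euc n) 1 → w k x = dist (f x) (denseTuple Q m k)) ∧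
      ∀ᵐ h, ‖x‖ + ‖h‖ < 1 → ‖w k (x + h) - w k x‖ₑ ≤ segmentBound ψ x h :=
    ae_all_iff.2 fun k => (hw k).and ((hP k).ae_ae_enorm_sub_le hψ (hgψ k))
  obtain ⟨N, hNsub, hNm, hN0⟩ := exists_measurable_superset_of_null hgood
  have hN : ∀ x, x ∉ N → ∀ k,
      (x ∈ ball (0 : Euc n) 1 → w k x = dist (f x) (denseTuple Q m k)) ∧
      ∀ᵐ h, ‖x‖ + ‖h‖ < 1 → ‖w k (x + h) - w k x‖ₑ ≤ segmentBound ψ x h := by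
    intro x hx
    by_contra hcon
    exact hx (hNsub hcon)
  -- Small balls about a dense sequence keep two points of the same piece at distance less than `1 /
  -- (k + 1)`, where the averages are controlled.
  set T : ℕ → ℕ → Set (Euc n) := fun k c => (maximalSet ψ k ∩ Nᶜ) ∩
    ball (TopologicalSpace.denseSeq (Euc n) c) (1 / (2 * ((k : ℝ) + 1))) with hT
  refine ⟨fun i => T i.unpair.1 i.unpair.2, fun i => ?_, fun i x hx => ?_, fun i => ?_, ?_⟩
  · exact ((measurableSet_maximalSet hψ _).inter hNm.compl).inter measurableSet_ball
  · rw [mem_ball_zero_iff]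
    have h1 : ‖x‖ + 1 / ((i.unpair.1 : ℝ) + 1) < 1 := hx.1.1.1
    have h2 : 0 < 1 / ((i.unpair.1 : ℝ) + 1) := by positivity
    linarith
  · set k := i.unpair.1
    set c := i.unpair.2
    refine ⟨2 ^ (n + 1) * (2 ^ n * k), by positivity, fun x hx y hy => ?_⟩
    rcases eq_or_ne x y with rfl | hxy
    · simp [dist_self]
    have hxy1 : ‖x - y‖ < 1 / ((k : ℝ) + 1) := by
      have h1 := mem_ball.1 hx.2
      have h2 := mem_ball.1 hy.2
      rw [← dist_eq_norm]
      have h3 := dist_triangle_right x y (TopologicalSpace.denseSeq (Euc n) c)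
      have : 1 / ((k : ℝ) + 1) = 1 / (2 * ((k : ℝ) + 1)) + 1 / (2 * ((k : ℝ) + 1)) := by
        field_simp
        ring
      linarith
    have hx1 : ‖x‖ + 1 / ((k : ℝ) + 1) < 1 := hx.1.1.1
    have hy1 : ‖y‖ + 1 / ((k : ℝ) + 1) < 1 := hy.1.1.1
    refine dist_le_of_forall_denseTuple fun l => ?_
    have hk0 : 0 ≤ ‖x - y‖ := norm_nonneg _
    rw [← (hN x hx.1.2 l).1 (by rw [mem_ball_zero_iff]; linarith),
      ← (hN y hy.1.2 l).1 (by rw [mem_ball_zero_iff]; linarith)]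
    have := enorm_sub_le_of_maximal hψ hxy (by linarith) (by linarith) (hN x hx.1.2 l).2
      (hN y hy.1.2 l).2 (K := 2 ^ n * k)
      (fun t ht htr => setLIntegral_le_of_mem_maximalSet hx.1.1 ht (htr.trans_lt hxy1))
      (fun t ht htr => setLIntegral_le_of_mem_maximalSet hy.1.1 ht (htr.trans_lt hxy1))
    rw [Real.enorm_eq_ofReal_abs] at this
    rw [← ENNReal.ofReal_le_ofReal_iff (by positivity)]
    refine this.trans_eq ?_
    rw [ENNReal.ofReal_mul (by positivity), ENNReal.ofReal_mul (by positivity),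
      ENNReal.ofReal_mul (by positivity), ENNReal.ofReal_pow (by positivity),
      ENNReal.ofReal_pow (by positivity), ENNReal.ofReal_ofNat, ENNReal.ofReal_natCast]
  · have hNae : ∀ᵐ x, x ∉ N := by
      rw [ae_iff]
      simpa using hN0
    filter_upwards [ae_mem_maximalSet hfin, hNae] with x hx hxN hxb
    obtain ⟨k, hk⟩ := hx hxb
    obtain ⟨c, hc⟩ := (TopologicalSpace.denseRange_denseSeq (Euc n)).exists_dist_lt x
      (show 0 < 1 / (2 * ((k : ℝ) + 1)) by positivity)
    refine ⟨Nat.pair k c, ?_⟩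
    simp only [Nat.unpair_pair]
    exact ⟨⟨hk, hxN⟩, hc⟩

end QValued

/-! ### Density points, first order expansions and Lipschitz functions. -/

namespace QValued

variable {n m Q : ℕ}

section Density

/-- Inclusion–exclusion in each ball: the density of the intersection is at least the sum of the two
densities minus one. -/
theorem HasDensityOne.inter {S T : Set (Euc n)} {x : Euc n} (hTm : MeasurableSet T)
    (hS : HasDensityOne S x) (hT : HasDensityOne T x) : HasDensityOne (S ∩ T) x := by
  have h1 := ENNReal.Tendsto.sub (hS.add hT) (tendsto_const_nhds (x := (1 : ℝ≥0∞)))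
    (Or.inr ENNReal.one_ne_top)
  rw [ENNReal.add_sub_cancel_right ENNReal.one_ne_top] at h1
  refine tendsto_of_tendsto_of_tendsto_of_le_of_le' h1 tendsto_const_nhds ?_ ?_
  · filter_upwards [self_mem_nhdsWithin] with r hr
    have hpos : volume (closedBall x r) ≠ 0 := (measure_closedBall_pos volume _ hr).ne'
    have hfin : volume (closedBall x r) ≠ ⊤ := measure_closedBall_lt_top.ne
    rw [tsub_le_iff_right, ← ENNReal.div_self hpos hfin, ← ENNReal.add_div, ← ENNReal.add_div]
    refine ENNReal.div_le_div_right ?_ _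
    rw [← measure_union_add_inter (S ∩ closedBall x r) (hTm.inter measurableSet_closedBall),
      add_comm]
    refine add_le_add (measure_mono ?_) (measure_mono ?_)
    · rintro y ⟨⟨h1, h2⟩, h3, -⟩
      exact ⟨⟨h1, h3⟩, h2⟩
    · rintro y (⟨-, h⟩ | ⟨-, h⟩) <;> exact h
  · exact Eventually.of_forall fun r => ENNReal.div_le_of_le_mul (by
      rw [one_mul]; exact measure_mono Set.inter_subset_right)

/-- Near a density point of `S`, every point is close to `S`. -/
theorem HasDensityOne.eventually_exists_mem {S : Set (Euc n)} {x : Euc n}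
    (hS : HasDensityOne S x) {ε : ℝ} (hε : 0 < ε) (hε1 : ε ≤ 1) :
    ∀ᶠ y in 𝓝[≠] x, ∃ z ∈ S, ‖z - y‖ ≤ ε * ‖y - x‖ := by
  -- The share of a ball of radius `ε ‖y - x‖` in one of radius `2 ‖y - x‖`. If `S` missed the small
  -- ball about `y`, its density in the large ball about `x` would be at most `1 - c`.
  set c := ENNReal.ofReal ((ε / 2) ^ n)
  have hc : c ≠ 0 := by
    simp only [c, ne_eq, ENNReal.ofReal_eq_zero, not_le]
    positivity
  have h1 : ∀ᶠ r in 𝓝[>] (0 : ℝ),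
      1 - c < volume (S ∩ closedBall x r) / volume (closedBall x r) :=
    hS.eventually (lt_mem_nhds (ENNReal.sub_lt_self ENNReal.one_ne_top one_ne_zero hc))
  have ht : Tendsto (fun y => 2 * ‖y - x‖) (𝓝[≠] x) (𝓝[>] 0) := by
    refine tendsto_nhdsWithin_iff.2 ⟨?_, ?_⟩
    · have : Continuous fun y : Euc n => 2 * ‖y - x‖ := by fun_prop
      have h2 := this.tendsto x
      simp only [sub_self, norm_zero, mul_zero] at h2
      exact h2.mono_left nhdsWithin_le_nhds
    · filter_upwards [self_mem_nhdsWithin] with y hy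
      have : 0 < ‖y - x‖ := norm_pos_iff.2 (sub_ne_zero.2 hy)
      exact Set.mem_Ioi.2 (by positivity)
  filter_upwards [ht.eventually h1, self_mem_nhdsWithin] with y hy hyx
  have hpos : 0 < ‖y - x‖ := norm_pos_iff.2 (sub_ne_zero.2 hyx)
  by_contra! hcon
  set r := 2 * ‖y - x‖ with hr
  have hr0 : 0 < r := by positivity
  have hvol : volume (closedBall y (ε * ‖y - x‖)) = c * volume (closedBall x r) := by
    rw [Measure.addHaar_closedBall_center volume x,
      show ε * ‖y - x‖ = (ε / 2) * r by rw [hr]; ring,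
      Measure.addHaar_closedBall_mul volume y (by positivity) hr0.le, finrank_euclideanSpace_fin]
  have hdisj : Disjoint (S ∩ closedBall x r) (closedBall y (ε * ‖y - x‖)) := by
    rw [Set.disjoint_left]
    intro z hz hz2
    have := hcon z hz.1
    rw [mem_closedBall_iff_norm] at hz2
    linarith
  have hsub : (S ∩ closedBall x r) ∪ closedBall y (ε * ‖y - x‖) ⊆ closedBall x r := by
    refine Set.union_subset Set.inter_subset_right (closedBall_subset_closedBall' ?_)
    rw [dist_eq_norm, hr]
    nlinarith
  have hV : volume (closedBall x r) ≠ 0 := (measure_closedBall_pos volume _ hr0).ne'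
  have hV' : volume (closedBall x r) ≠ ⊤ := measure_closedBall_lt_top.ne
  have h3 := measure_mono (μ := volume) hsub
  rw [measure_union hdisj measurableSet_closedBall, hvol] at h3
  have h4 := ENNReal.div_le_div_right h3 (volume (closedBall x r))
  rw [ENNReal.add_div, ENNReal.div_self hV hV', mul_div_assoc, ENNReal.div_self hV hV',
    mul_one] at h4
  exact (hy.trans_le (ENNReal.le_sub_of_add_le_right ENNReal.ofReal_ne_top h4)).false

end Density

section Affine

theorem dist_affine_le (J : Jet n m Q) : ∃ K : ℝ, 0 ≤ K ∧ ∀ h h' : Euc n,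
    dist (J.map fun p => p.1 + p.2 h) (J.map fun p => p.1 + p.2 h') ≤ K * ‖h - h'‖ := by
  obtain ⟨v, rfl⟩ := exists_ofFn J
  refine ⟨∑ i, ‖(v i).2‖, Finset.sum_nonneg fun _ _ => norm_nonneg _, fun h h' => ?_⟩
  rw [map_ofFn, map_ofFn]
  refine (dist_ofFn_le _ _).trans ((cost_le_sum _ _).trans ?_)
  rw [Finset.sum_mul]
  refine Finset.sum_le_sum fun i _ => ?_
  simp only [Function.comp_apply, add_sub_add_left_eq_sub, ← map_sub]
  exact (v i).2.le_opNorm _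

/-- The first order expansion of `f` at a point of approximate differentiability holds along every
set with density one there on which `f` is Lipschitz. -/
theorem IsApproxJet.isLittleO_of_lipschitz {f : Euc n → AQ Q m} {x : Euc n} {J : Jet n m Q}
    (hJ : IsApproxJet f x J) {S : Set (Euc n)} (hxS : x ∈ S)
    (hS : HasDensityOne S x) {C : ℝ} (hC : 0 ≤ C)
    (hlip : ∀ y ∈ S, ∀ z ∈ S, dist (f y) (f z) ≤ C * ‖y - z‖) :
    (fun y => dist (f y) (J.map fun p => p.1 + p.2 (y - x))) =o[𝓝[S] x] fun y => y - x := by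
  obtain ⟨hfst, -, T, hTm, -, hT, ho⟩ := hJ
  obtain ⟨K, hK, hKJ⟩ := dist_affine_le J
  rw [isLittleO_iff]
  intro c hc
  have h1 := (isLittleO_iff.1 ho) (show 0 < c / 4 by positivity)
  obtain ⟨δ, hδ, hδT⟩ := Metric.mem_nhdsWithin_iff.1 h1
  -- A point `y` of `S` is replaced by a point `z` of `S ∩ T` at distance at most `ε ‖y - x‖`. The
  -- move costs `(C + K) ε ≤ c / 2`, and the expansion at `z` costs `c / 4` times `‖z - x‖ ≤ 2 ‖y -
  -- x‖`.
  set ε := min 1 (c / (2 * (C + K + 1)))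
  have hε : 0 < ε := lt_min one_pos (by positivity)
  have hεc : (C + K) * ε ≤ c / 2 := by
    have h2 : ε ≤ c / (2 * (C + K + 1)) := min_le_right _ _
    rw [le_div_iff₀ (by positivity)] at h2
    nlinarith
  have h2 := (hS.inter hTm hT).eventually_exists_mem hε (min_le_left _ _)
  rw [eventually_nhdsWithin_iff] at h2
  have h3 : ∀ᶠ y in 𝓝 x, ‖y - x‖ < δ / 2 := by
    filter_upwards [Metric.ball_mem_nhds x (half_pos hδ)] with y hy
    rwa [mem_ball_iff_norm] at hy
  rw [eventually_nhdsWithin_iff]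
  filter_upwards [h2, h3] with y hy hyδ hyS
  rw [Real.norm_of_nonneg (dist_nonneg _ _)]
  rcases eq_or_ne y x with rfl | hyx
  · have : (J.map fun p => p.1 + p.2 (y - y)) = f y := by
      rw [← hfst]
      simp
    rw [this, dist_self]
    positivity
  · obtain ⟨z, ⟨hzS, hzT⟩, hz⟩ := hy hyx
    have hε1 : ε ≤ 1 := min_le_left _ _
    have hz2 : ‖z - x‖ ≤ 2 * ‖y - x‖ := by
      have := norm_sub_le_norm_sub_add_norm_sub z y x
      nlinarith [norm_nonneg (y - x)]
    have e1 := hlip y hyS z hzS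
    have e2 : dist (f z) (J.map fun p => p.1 + p.2 (z - x)) ≤ c / 4 * ‖z - x‖ := by
      have := hδT ⟨mem_ball_iff_norm.2 (show ‖z - x‖ < δ by linarith), hzT⟩
      rwa [Set.mem_ofPred_eq, Real.norm_of_nonneg (dist_nonneg _ _)] at this
    have e3 := hKJ (z - x) (y - x)
    rw [sub_sub_sub_cancel_right] at e3
    rw [norm_sub_rev] at e1
    have t1 := dist_triangle (f y) (f z) (J.map fun p => p.1 + p.2 (y - x))
    have t2 := dist_triangle (f z) (J.map fun p => p.1 + p.2 (z - x))
      (J.map fun p => p.1 + p.2 (y - x))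
    have f1 : C * ‖z - y‖ + K * ‖z - y‖ ≤ (C + K) * (ε * ‖y - x‖) := by
      rw [← add_mul]
      gcongr
    have f2 : (C + K) * (ε * ‖y - x‖) ≤ c / 2 * ‖y - x‖ := by
      rw [← mul_assoc]
      gcongr
    have f3 : c / 4 * ‖z - x‖ ≤ c / 4 * (2 * ‖y - x‖) := by gcongr
    linarith

end Affine

section Lipschitz

/-- `∑ᵢ F(aᵢ)` for a function `F` with values in a commutative monoid. -/
def vecSum {α E : Type*} [AddCommMonoid E] (s : Sym α Q) (F : α → E) : E :=
  ((s : Multiset α).map F).sum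

theorem vecSum_ofFn {α E : Type*} [AddCommMonoid E] (v : Fin Q → α) (F : α → E) :
    vecSum (ofFn v) F = ∑ i, F (v i) := by
  unfold vecSum
  rw [coe_ofFn, Multiset.map_map]
  rfl

theorem norm_vecSum_sub_le {E : Type*} [NormedAddCommGroup E] {F : Euc m → E} {K : ℝ≥0}
    (hF : LipschitzWith K F) (S T : AQ Q m) :
    ‖vecSum S F - vecSum T F‖ ≤ Q * K * dist S T := by
  obtain ⟨v, rfl⟩ := exists_ofFn S
  obtain ⟨w, rfl, h⟩ := exists_dist_eq v T
  rw [vecSum_ofFn, vecSum_ofFn, h, ← Finset.sum_sub_distrib]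
  calc ‖∑ i, (F (v i) - F (w i))‖ ≤ ∑ i, ‖F (v i) - F (w i)‖ := norm_sum_le _ _
    _ ≤ ∑ _i : Fin Q, K * cost v w := Finset.sum_le_sum fun i _ =>
      (hF.norm_sub_le _ _).trans (by gcongr; exact norm_sub_le_cost v w i)
    _ = _ := by simp [mul_assoc]

theorem abs_sum_sum_sub_le {θ : Euc m × Euc m → ℝ} {K : ℝ≥0} (hθ : LipschitzWith K θ)
    (S T : AQ Q m) :
    |sum S (fun p => sum S fun q => θ (p, q)) - sum T (fun p => sum T fun q => θ (p, q))| ≤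
      Q * Q * K * dist S T := by
  obtain ⟨v, rfl⟩ := exists_ofFn S
  obtain ⟨w, rfl, h⟩ := exists_dist_eq v T
  simp only [sum_ofFn]
  rw [h, ← Finset.sum_sub_distrib]
  simp_rw [← Finset.sum_sub_distrib]
  have h1 : ∀ i j, |θ (v i, v j) - θ (w i, w j)| ≤ K * cost v w := fun i j => by
    refine (hθ.norm_sub_le _ _).trans ?_
    gcongr
    exact max_le (norm_sub_le_cost v w i) (norm_sub_le_cost v w j)
  calc _ ≤ ∑ i, |∑ j, (θ (v i, v j) - θ (w i, w j))| := Finset.abs_sum_le_sum_abs _ _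
    _ ≤ ∑ i, ∑ j, |θ (v i, v j) - θ (w i, w j)| :=
      Finset.sum_le_sum fun i _ => Finset.abs_sum_le_sum_abs _ _
    _ ≤ ∑ _i : Fin Q, ∑ _j : Fin Q, K * cost v w :=
      Finset.sum_le_sum fun i _ => Finset.sum_le_sum fun j _ => h1 i j
    _ = _ := by
      simp
      ring

theorem exists_lipschitz_bump_smul {c : Euc m} (χ : ContDiffBump c) :
    ∃ K, LipschitzWith K fun P => χ P • P := by
  refine ContDiff.lipschitzWith_of_hasCompactSupport (𝕂 := ℝ) (n := 1) ?_ ?_ one_ne_zero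
  · exact χ.hasCompactSupport.smul_right
  · exact χ.contDiff.smul contDiff_id

theorem exists_lipschitz_bump_pair {c : Euc m} (χ : ContDiffBump c) :
    ∃ K, LipschitzWith K fun z : Euc m × Euc m => ‖(χ z.1 * χ z.2) • (z.1 - z.2)‖ := by
  have h : ∃ K, LipschitzWith K fun z : Euc m × Euc m => (χ z.1 * χ z.2) • (z.1 - z.2) := by
    refine ContDiff.lipschitzWith_of_hasCompactSupport (𝕂 := ℝ) (n := 1) ?_ ?_ one_ne_zero
    · refine HasCompactSupport.intro
        ((isCompact_closedBall c χ.rOut).prod (isCompact_closedBall c χ.rOut)) fun z hz => ?_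
      rw [Set.mem_prod, not_and_or] at hz
      rcases hz with hz | hz
      · rw [χ.zero_of_le_dist (le_of_not_ge hz)]
        simp
      · rw [χ.zero_of_le_dist (le_of_not_ge hz)]
        simp
    · exact ((χ.contDiff.comp contDiff_fst).mul (χ.contDiff.comp contDiff_snd)).smul
        (contDiff_fst.sub contDiff_snd)
  obtain ⟨K, hK⟩ := h
  exact ⟨1 * K, lipschitzWith_one_norm.comp hK⟩

/-- A nonnegative Lipschitz function on `S` vanishes to first order at almost all its zeros. -/
theorem ae_isLittleO_of_lipschitzOnWith {g : Euc n → ℝ} {S : Set (Euc n)} {K : ℝ≥0}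
    (hg : LipschitzOnWith K g S) (h0 : ∀ x ∈ S, 0 ≤ g x) :
    ∀ᵐ x, x ∈ S → g x = 0 → g =o[𝓝[S] x] fun y => y - x := by
  -- The absolute value of a Lipschitz extension has a minimum at each zero of `g` in `S`; where
  -- Rademacher's theorem provides a derivative, that derivative is zero.
  obtain ⟨G, hG, hGg⟩ := hg.extend_real
  have hA : LipschitzWith (1 * K) fun y => ‖G y‖ := lipschitzWith_one_norm.comp hG
  filter_upwards [hA.ae_differentiableAt (μ := volume)] with x hx hxS hx0
  have hz : ‖G x‖ = 0 := by rw [← hGg hxS, hx0, norm_zero]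
  have hmin : IsLocalMin (fun y => ‖G y‖) x :=
    Eventually.of_forall fun y => by
      change ‖G x‖ ≤ ‖G y‖
      rw [hz]
      exact norm_nonneg _
  have hd := hx.hasFDerivAt
  rw [hmin.fderiv_eq_zero] at hd
  have ho := hd.isLittleO
  simp only [_root_.zero_apply, sub_zero, hz] at ho
  refine (ho.mono nhdsWithin_le_nhds).congr' ?_ EventuallyEq.rfl
  filter_upwards [self_mem_nhdsWithin] with y hy
  rw [← hGg hy, Real.norm_of_nonneg (h0 y hy)]

end Lipschitz

end QValued

/-! ### Rademacher's theorem for tuple-valued Lipschitz maps. -/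

namespace QValued

variable {n m Q : ℕ}

/-- A countable family of bump functions: centers in a dense sequence, radii `1 / (b + 1)` and
`2 / (b + 1)`. -/
noncomputable def denseBump (m : ℕ) (a b : ℕ) :
    ContDiffBump (TopologicalSpace.denseSeq (Euc m) a) where
  rIn := 1 / ((b : ℝ) + 1)
  rOut := 2 / ((b : ℝ) + 1)
  rIn_pos := by positivity
  rIn_lt_rOut := by gcongr; norm_num

/-- At a scale small compared with the separation `s`, a centre near `P` gives a bump that isolates
the value `P` from all others. The family is countable, so almost-everywhere statements about its
members hold simultaneously, although the choice of bump depends on the point. -/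
theorem exists_denseBump {s : ℝ} (hs : 0 < s) :
    ∃ (b : ℕ) (ρ : ℝ), 0 < ρ ∧ ∀ P : Euc m, ∃ a, ∀ u : Euc m,
      (‖u - P‖ < ρ → denseBump m a b u = 1) ∧
      ∀ P', s ≤ ‖P' - P‖ → ‖u - P'‖ < ρ → denseBump m a b u = 0 := by
  obtain ⟨b, hb⟩ := exists_nat_one_div_lt (show 0 < s / 8 by positivity)
  set ρ : ℝ := 1 / ((b : ℝ) + 1) with hρ
  have hρ0 : 0 < ρ := by positivity
  have hout : (denseBump m · b |>.rOut) = fun _ => 2 * ρ := by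
    ext
    simp [denseBump, hρ]
    ring
  refine ⟨b, ρ / 2, by positivity, fun P => ?_⟩
  obtain ⟨a, ha⟩ := (TopologicalSpace.denseRange_denseSeq (Euc m)).exists_dist_lt P
    (show 0 < ρ / 2 by positivity)
  rw [_root_.dist_comm, dist_eq_norm] at ha
  set c := TopologicalSpace.denseSeq (Euc m) a
  refine ⟨a, fun u => ⟨fun hu => ?_, fun P' hP' hu => ?_⟩⟩
  · apply (denseBump m a b).one_of_mem_closedBall
    rw [mem_closedBall_iff_norm]
    change ‖u - c‖ ≤ ρ
    have := norm_sub_le_norm_sub_add_norm_sub u P c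
    rw [norm_sub_rev P c] at this
    linarith
  · apply (denseBump m a b).zero_of_le_dist
    rw [congrFun hout a, dist_eq_norm]
    change 2 * ρ ≤ ‖u - c‖
    have h1 := norm_sub_le_norm_sub_add_norm_sub P' u P
    have h2 := norm_sub_le_norm_sub_add_norm_sub u c P
    rw [norm_sub_rev P' u] at h1
    linarith

/-- The bump-weighted sum of the points of a tuple. -/
noncomputable def bumpSum (a b : ℕ) (T : AQ Q m) : Euc m :=
  vecSum T fun P => denseBump m a b P • P

/-- The bump-weighted sum of the mutual distances of the points of a tuple. -/
noncomputable def bumpSpread (a b : ℕ) (T : AQ Q m) : ℝ :=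
  sum T fun P => sum T fun P' => ‖(denseBump m a b P * denseBump m a b P') • (P - P')‖

theorem bumpSpread_nonneg (a b : ℕ) (T : AQ Q m) : 0 ≤ bumpSpread a b T := by
  obtain ⟨v, rfl⟩ := exists_ofFn T
  simp only [bumpSpread, sum_ofFn]
  positivity

theorem lipschitzOnWith_comp {E : Type*} [NormedAddCommGroup E] {f : Euc n → AQ Q m}
    {S : Set (Euc n)} {C : ℝ} (hC : 0 ≤ C)
    (hlip : ∀ y ∈ S, ∀ z ∈ S, dist (f y) (f z) ≤ C * ‖y - z‖) {F : AQ Q m → E} {K : ℝ}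
    (hK : 0 ≤ K) (hF : ∀ S T, ‖F S - F T‖ ≤ K * dist S T) :
    LipschitzOnWith (Real.toNNReal (K * C)) (fun y => F (f y)) S := by
  refine LipschitzOnWith.of_dist_le_mul fun y hy z hz => ?_
  rw [dist_eq_norm, dist_eq_norm, Real.coe_toNNReal _ (mul_nonneg hK hC), mul_assoc]
  exact (hF _ _).trans (by gcongr; exact hlip y hy z hz)

theorem exists_separation (v : Fin Q → Euc m) :
    ∃ s > 0, ∀ i j, v i ≠ v j → s ≤ ‖v i - v j‖ := by
  classical
  let A := (Finset.univ : Finset (Fin Q × Fin Q)).filter fun p => v p.1 ≠ v p.2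
  rcases A.eq_empty_or_nonempty with h | h
  · refine ⟨1, one_pos, fun i j hij => ?_⟩
    have : (i, j) ∈ A := by simp [A, hij]
    simp [h] at this
  · obtain ⟨p, hp, hmin⟩ := A.exists_min_image (fun p => ‖v p.1 - v p.2‖) h
    refine ⟨‖v p.1 - v p.2‖, ?_, fun i j hij => hmin (i, j) (by simp [A, hij])⟩
    have := (Finset.mem_filter.1 hp).2
    exact norm_pos_iff.2 (sub_ne_zero.2 this)

/-- A point differs from the mean of its cluster by no more than the sum of its distances to the
other points. So an expansion of the sum of the cluster, together with a small spread, expands every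
single point. -/
theorem norm_sub_sub_le_cluster {α : Type*} {s : Finset α} (u : α → Euc m) {i : α} (hi : i ∈ s)
    (P d : Euc m) {N : ℝ} (hN : N = s.card) :
    ‖u i - P - N⁻¹ • d‖ ≤ ‖∑ j ∈ s, u j - ∑ _j ∈ s, P - d‖ + ∑ j ∈ s, ‖u i - u j‖ := by
  have hN1 : 1 ≤ N := by
    rw [hN]
    exact_mod_cast Finset.card_pos.2 ⟨i, hi⟩
  have h1 : N • (u i - P - N⁻¹ • d) =
      (∑ j ∈ s, u j - ∑ _j ∈ s, P - d) + ∑ j ∈ s, (u i - u j) := by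
    rw [Finset.sum_sub_distrib, Finset.sum_const, Finset.sum_const, smul_sub, smul_sub,
      smul_inv_smul₀ (by positivity), hN, Nat.cast_smul_eq_nsmul, Nat.cast_smul_eq_nsmul]
    abel
  calc ‖u i - P - N⁻¹ • d‖ ≤ N * ‖u i - P - N⁻¹ • d‖ :=
        le_mul_of_one_le_left (norm_nonneg _) hN1
    _ = ‖N • (u i - P - N⁻¹ • d)‖ := by rw [norm_smul, Real.norm_of_nonneg (by positivity)]
    _ ≤ _ := by
      rw [h1]
      exact (norm_add_le _ _).trans (by gcongr; exact norm_sum_le _ _)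

/-- Existence of approximate jets from the differentiability of the localized sums. -/
theorem exists_isApproxJet_of_bump {f : Euc n → AQ Q m} {S : Set (Euc n)} (hSm : MeasurableSet S)
    {C : ℝ} (hlip : ∀ y ∈ S, ∀ z ∈ S, dist (f y) (f z) ≤ C * ‖y - z‖)
    {x : Euc n} (hxS : x ∈ S) (hS : HasDensityOne S x)
    (hE : ∀ a b, DifferentiableWithinAt ℝ (fun y => bumpSum a b (f y)) S x)
    (hW : ∀ a b, bumpSpread a b (f x) = 0 →
      (fun y => bumpSpread a b (f y)) =o[𝓝[S] x] fun y => y - x) :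
    ∃ J, IsApproxJet f x J := by
  classical
  obtain ⟨v, hv⟩ := exists_ofFn (f x)
  obtain ⟨s, hs, hsep⟩ := exists_separation v
  obtain ⟨b, ρ, hρ, hab⟩ := exists_denseBump (m := m) hs
  choose a ha using hab
  set cl : Euc m → Finset (Fin Q) := fun P => Finset.univ.filter fun j => v j = P with hcl
  set D : Euc m → (Euc n →L[ℝ] Euc m) := fun P =>
    fderivWithin ℝ (fun y => bumpSum (a P) b (f y)) S x with hD
  -- The differential of the mean of the cluster at `P`. It depends on `P` only, which makes the
  -- consistency condition of a jet automatic.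
  set L : Euc m → (Euc n →L[ℝ] Euc m) := fun P => ((cl P).card : ℝ)⁻¹ • D P with hL
  have hbump : ∀ (i j : Fin Q) (u : Euc m), ‖u - v j‖ < ρ →
      denseBump m (a (v i)) b u = if v j = v i then 1 else 0 := by
    intro i j u hu
    split_ifs with hij
    · exact (ha (v i) u).1 (hij ▸ hu)
    · exact (ha (v i) u).2 (v j) (hsep j i hij) hu
  have hsum : ∀ (i : Fin Q) (u : Fin Q → Euc m), (∀ j, ‖u j - v j‖ < ρ) →
      bumpSum (a (v i)) b (ofFn u) = ∑ j ∈ cl (v i), u j := by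
    intro i u hu
    rw [bumpSum, vecSum_ofFn, Finset.sum_filter]
    refine Finset.sum_congr rfl fun j _ => ?_
    rw [hbump i j (u j) (hu j)]
    split_ifs <;> simp
  have hspread : ∀ (i : Fin Q) (u : Fin Q → Euc m), (∀ j, ‖u j - v j‖ < ρ) →
      bumpSpread (a (v i)) b (ofFn u) = ∑ j ∈ cl (v i), ∑ k ∈ cl (v i), ‖u j - u k‖ := by
    intro i u hu
    simp only [bumpSpread, sum_ofFn]
    rw [Finset.sum_filter]
    refine Finset.sum_congr rfl fun j _ => ?_
    rw [Finset.sum_filter, hbump i j (u j) (hu j)]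
    split_ifs
    · refine Finset.sum_congr rfl fun k _ => ?_
      rw [hbump i k (u k) (hu k)]
      split_ifs <;> simp
    · simp
  have hself : ∀ j, ‖v j - v j‖ < ρ := fun j => by simpa using hρ
  have hW0 : ∀ i, bumpSpread (a (v i)) b (f x) = 0 := by
    intro i
    rw [← hv, hspread i v hself]
    refine Finset.sum_eq_zero fun j hj => Finset.sum_eq_zero fun k hk => ?_
    rw [(Finset.mem_filter.1 hj).2, (Finset.mem_filter.1 hk).2, sub_self, norm_zero]
  set R : Fin Q → Euc n → ℝ := fun i y =>
    ‖bumpSum (a (v i)) b (f y) - bumpSum (a (v i)) b (f x) - D (v i) (y - x)‖ +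
      bumpSpread (a (v i)) b (f y) with hR
  have hRo : ∀ i, R i =o[𝓝[S] x] fun y => y - x := fun i =>
    (hE (a (v i)) b).hasFDerivWithinAt.isLittleO.norm_left.add (hW _ _ (hW0 i))
  have hnear : ∀ᶠ y in 𝓝[S] x, C * ‖y - x‖ < ρ := by
    have hc : Continuous fun y => C * ‖y - x‖ := by fun_prop
    have h1 := hc.tendsto x
    simp only [sub_self, norm_zero, mul_zero] at h1
    exact (h1.eventually (gt_mem_nhds hρ)).filter_mono nhdsWithin_le_nhds
  refine ⟨(f x).map fun P => (P, L P), ?_, ?_, S, hSm, hxS, hS, ?_⟩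
  · simp
  · intro p hp q hq hpq
    obtain ⟨P, -, rfl⟩ := Sym.mem_map.1 hp
    obtain ⟨P', -, rfl⟩ := Sym.mem_map.1 hq
    simp only at hpq
    rw [hpq]
  · refine IsBigO.trans_isLittleO ?_ (IsLittleO.sum fun i (_ : i ∈ Finset.univ) => hRo i)
    refine IsBigO.of_bound 1 ?_
    filter_upwards [hnear, self_mem_nhdsWithin] with y hy hyS
    obtain ⟨u, hu, hdist⟩ := exists_dist_eq v (f y)
    have hu1 : ∀ j, ‖u j - v j‖ < ρ := fun j => by
      rw [norm_sub_rev]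
      refine (norm_sub_le_cost v u j).trans_lt ?_
      rw [← hdist, hv]
      refine (hlip x hxS y hyS).trans_lt ?_
      rwa [norm_sub_rev]
    have hterm : ∀ i, ‖u i - (v i + L (v i) (y - x))‖ ≤ R i y := by
      intro i
      have hi : i ∈ cl (v i) := by simp [hcl]
      have h1 := norm_sub_sub_le_cluster u hi (v i) (D (v i) (y - x)) rfl
      have h2 : ∑ _j ∈ cl (v i), v i = bumpSum (a (v i)) b (f x) := by
        rw [← hv, hsum i v hself]
        exact Finset.sum_congr rfl fun j hj => ((Finset.mem_filter.1 hj).2).symm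
      rw [h2, ← hsum i u hu1, hu] at h1
      have h3 : ∑ j ∈ cl (v i), ‖u i - u j‖ ≤ bumpSpread (a (v i)) b (f y) := by
        rw [← hu, hspread i u hu1]
        exact Finset.single_le_sum (f := fun j => ∑ k ∈ cl (v i), ‖u j - u k‖)
          (fun _ _ => Finset.sum_nonneg fun _ _ => norm_nonneg _) hi
      have h4 : u i - (v i + L (v i) (y - x)) =
          u i - v i - ((cl (v i)).card : ℝ)⁻¹ • D (v i) (y - x) := by
        simp only [hL, _root_.smul_apply]
        abel
      rw [h4]
      simp only [hR]
      linarith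
    have hR0 : ∀ i, 0 ≤ R i y := fun i => (norm_nonneg _).trans (hterm i)
    rw [one_mul, Real.norm_of_nonneg (dist_nonneg _ _), Finset.sum_apply,
      Real.norm_of_nonneg (Finset.sum_nonneg fun i _ => hR0 i), ← hv, map_ofFn, map_ofFn, ← hu]
    refine (dist_ofFn_le _ _).trans ((cost_le_sum _ _).trans ?_)
    exact Finset.sum_le_sum fun i _ => hterm i

theorem ae_hasDensityOne (S : Set (Euc n)) (hSm : MeasurableSet S) :
    ∀ᵐ x, x ∈ S → HasDensityOne S x :=
  (ae_restrict_iff' hSm).1 (Besicovitch.ae_tendsto_measure_inter_div volume S)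

/-- Rademacher's theorem differentiates the localized sums. The localized spreads are nonnegative
and Lipschitz, so they vanish to first order at almost all their zeros: sheets that meet at `x`
separate only at order `o(|y - x|)`. -/
theorem ae_exists_isApproxJet {f : Euc n → AQ Q m} {S : Set (Euc n)} (hSm : MeasurableSet S)
    {C : ℝ} (hC : 0 ≤ C) (hlip : ∀ y ∈ S, ∀ z ∈ S, dist (f y) (f z) ≤ C * ‖y - z‖) :
    ∀ᵐ x, x ∈ S → ∃ J, IsApproxJet f x J := by
  have hE : ∀ᵐ x, ∀ a b, x ∈ S → DifferentiableWithinAt ℝ (fun y => bumpSum a b (f y)) S x := by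
    refine ae_all_iff.2 fun a => ae_all_iff.2 fun b => ?_
    obtain ⟨K, hK⟩ := exists_lipschitz_bump_smul (denseBump m a b)
    have hF : ∀ T U : AQ Q m, ‖bumpSum a b T - bumpSum a b U‖ ≤ (Q * K : ℝ) * dist T U :=
      fun T U => norm_vecSum_sub_le hK T U
    have h := lipschitzOnWith_comp hC hlip (by positivity) hF
    exact h.ae_differentiableWithinAt_of_mem
  have hW : ∀ᵐ x, ∀ a b, x ∈ S → bumpSpread a b (f x) = 0 →
      (fun y => bumpSpread a b (f y)) =o[𝓝[S] x] fun y => y - x := by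
    refine ae_all_iff.2 fun a => ae_all_iff.2 fun b => ?_
    obtain ⟨K, hK⟩ := exists_lipschitz_bump_pair (denseBump m a b)
    have hF : ∀ T U : AQ Q m, ‖bumpSpread a b T - bumpSpread a b U‖ ≤
        (Q * Q * K : ℝ) * dist T U := fun T U => abs_sum_sum_sub_le hK T U
    have h := lipschitzOnWith_comp hC hlip (by positivity) hF
    exact ae_isLittleO_of_lipschitzOnWith h fun x _ => bumpSpread_nonneg a b _
  filter_upwards [hE, hW, ae_hasDensityOne S hSm] with x h1 h2 h3 hxS
  exact exists_isApproxJet_of_bump hSm hlip hxS (h3 hxS) (fun a b => h1 a b hxS)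
    fun a b => h2 a b hxS

theorem isApproxJet_jet {f : Euc n → AQ Q m} {x : Euc n} (h : ∃ J, IsApproxJet f x J) :
    IsApproxJet f x (jet f x) := by
  unfold jet
  rw [dif_pos h]
  exact h.choose_spec

/-- The default jet also carries the values of `f`, so there is no exceptional set. -/
theorem jet_map_fst (f : Euc n → AQ Q m) (x : Euc n) : (jet f x).map Prod.fst = f x := by
  by_cases h : ∃ J, IsApproxJet f x J
  · exact (isApproxJet_jet h).1
  · unfold jet
    rw [dif_neg h]
    simp

/-- On a set on which `f` is Lipschitz, the first order expansion of `f` given by `jet f x` holds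
along that set. -/
theorem ae_jet_isLittleO {f : Euc n → AQ Q m} {S : Set (Euc n)} (hSm : MeasurableSet S)
    {C : ℝ} (hC : 0 ≤ C) (hlip : ∀ y ∈ S, ∀ z ∈ S, dist (f y) (f z) ≤ C * ‖y - z‖) :
    ∀ᵐ x, x ∈ S →
      (fun y => dist (f y) ((jet f x).map fun p => p.1 + p.2 (y - x))) =o[𝓝[S] x]
        fun y => y - x := by
  filter_upwards [ae_exists_isApproxJet hSm hC hlip, ae_hasDensityOne S hSm] with x h1 h2 hxS
  exact (isApproxJet_jet (h1 hxS)).isLittleO_of_lipschitz hxS (h2 hxS) hC hlip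

end QValued

/-! ### Difference quotients along translations. -/

theorem exists_strictMono_ae_tendsto {α : Type*} [MeasurableSpace α] {μ : Measure α}
    {F : ℕ → α → ℝ} {p : ℝ≥0∞} (hp : p ≠ 0) (hF : ∀ k, AEStronglyMeasurable (F k) μ)
    (h : Tendsto (fun k => eLpNorm (F k) p μ) atTop (𝓝 0)) :
    ∃ φ : ℕ → ℕ, StrictMono φ ∧ ∀ᵐ x ∂μ, Tendsto (fun k => F (φ k) x) atTop (𝓝 0) := by
  have h1 : TendstoInMeasure μ F atTop (fun _ => (0 : ℝ)) := by
    refine tendstoInMeasure_of_tendsto_eLpNorm hp hF aestronglyMeasurable_const ?_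
    refine h.congr fun k => ?_
    congr 1
    ext x
    simp
  exact h1.exists_seq_tendsto_ae

/-- There are arbitrarily short translations in the direction `v` which eventually map almost
every point of `S` into `S`, and along which the segment averages converge. -/
theorem exists_translations {n : ℕ} (v : Euc n) {S : Set (Euc n)} (hS : MeasurableSet S)
    (hSfin : volume S ≠ ⊤) {G₁ G₂ : Euc n → ℝ} (hm₁ : Measurable G₁) (hm₂ : Measurable G₂)
    (h₁ : MemLp G₁ 2) (h₂ : MemLp G₂ 2) (hi₁ : Integrable G₁) (hi₂ : Integrable G₂) :
    ∃ t : ℕ → ℝ, (∀ k, 0 < t k ∧ t k ≤ 1) ∧ Tendsto t atTop (𝓝 0) ∧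
      (∀ᵐ x, x ∈ S → ∀ᶠ k in atTop, x + t k • v ∈ S) ∧
      (∀ᵐ x, Tendsto (fun k => segmentAverage G₁ (t k • v) x) atTop (𝓝 (G₁ x))) ∧
      ∀ᵐ x, Tendsto (fun k => segmentAverage G₂ (t k • v) x) atTop (𝓝 (G₂ x)) := by
  have hτ : ∀ t : ℕ → ℝ, Tendsto t atTop (𝓝 0) → Tendsto (fun k => t k • v) atTop (𝓝 0) := by
    intro t ht
    have := ht.smul_const v
    rwa [zero_smul] at this
  have hseg : ∀ {G : Euc n → ℝ}, Measurable G → MemLp G 2 → Integrable G → ∀ t : ℕ → ℝ,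
      Tendsto t atTop (𝓝 0) → ∃ φ : ℕ → ℕ, StrictMono φ ∧
        ∀ᵐ x, Tendsto (fun k => segmentAverage G (t (φ k) • v) x) atTop (𝓝 (G x)) := by
    intro G hm h2 hi t ht
    obtain ⟨φ, hφ, hx⟩ := exists_strictMono_ae_tendsto (p := 2) two_ne_zero
      (fun k => (integrable_segmentAverage hi (t k • v)).1.sub hi.1)
      ((tendsto_eLpNorm_segmentAverage hm h2 hi).comp (hτ t ht))
    refine ⟨φ, hφ, hx.mono fun x h => ?_⟩
    have := h.add_const (G x)
    simpa using this
  set t₀ : ℕ → ℝ := fun k => 1 / ((k : ℝ) + 1)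
  have ht₀ : Tendsto t₀ atTop (𝓝 0) := tendsto_one_div_add_atTop_nhds_zero_nat
  obtain ⟨φ₁, hφ₁, hx₁⟩ := hseg hm₁ h₁ hi₁ t₀ ht₀
  have ht₁ := ht₀.comp hφ₁.tendsto_atTop
  obtain ⟨φ₂, hφ₂, hx₂⟩ := hseg hm₂ h₂ hi₂ _ ht₁
  have ht₂ := ht₁.comp hφ₂.tendsto_atTop
  -- The indicator takes only the values `0` and `1`, so its convergence at a point `x` of `S` means
  -- that the translates of `x` eventually lie in `S`.
  set χ : Euc n → ℝ := S.indicator fun _ => 1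
  have hχ : Measurable χ := measurable_const.indicator hS
  have hχL : MemLp χ 1 := memLp_indicator_const 1 hS 1 (Or.inr hSfin)
  obtain ⟨φ₃, hφ₃, hx₃⟩ := exists_strictMono_ae_tendsto (p := 1) one_ne_zero
    (F := fun k x => χ (x + (t₀ (φ₁ (φ₂ k))) • v) - χ x)
    (fun k => Measurable.aestronglyMeasurable (by fun_prop))
    ((tendsto_eLpNorm_translate ENNReal.one_ne_top hχL).comp (hτ _ ht₂))
  refine ⟨fun k => t₀ (φ₁ (φ₂ (φ₃ k))), fun k => ⟨by positivity, ?_⟩,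
    ht₂.comp hφ₃.tendsto_atTop, hx₃.mono fun x hx hxS => ?_,
    hx₁.mono fun x hx => hx.comp (hφ₂.tendsto_atTop.comp hφ₃.tendsto_atTop),
    hx₂.mono fun x hx => hx.comp hφ₃.tendsto_atTop⟩
  · rw [div_le_one (by positivity)]
    linarith [Nat.cast_nonneg (α := ℝ) (φ₁ (φ₂ (φ₃ k)))]
  · filter_upwards [hx.eventually (lt_mem_nhds (show (-1 : ℝ) < 0 by norm_num))] with k hk
    by_contra hcon
    simp only [χ] at hk
    rw [Set.indicator_of_notMem hcon, Set.indicator_of_mem hxS] at hk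
    norm_num at hk

namespace QValued

variable {n m Q : ℕ}

theorem exists_separation_fst (u : Fin Q → Euc m × (Euc n →L[ℝ] Euc m)) :
    ∃ s > 0, ∀ i j, (u i).1 ≠ (u j).1 → s ≤ ‖(u i).1 - (u j).1‖ :=
  exists_separation fun i => (u i).1

/-- The metric speed of a first order expansion. -/
theorem eventually_dist_affine_eq (J : Jet n m Q) (v : Euc n) :
    ∀ᶠ t in 𝓝[>] (0 : ℝ), dist (J.map fun p => p.1 + p.2 (t • v)) (J.map Prod.fst) =
      t * Real.sqrt (sum J fun p => ‖p.2 v‖ ^ 2) := by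
  obtain ⟨u, rfl⟩ := exists_ofFn J
  obtain ⟨s, hs, hsep⟩ := exists_separation_fst u
  rw [sum_ofFn]
  set A := Real.sqrt (∑ i, ‖(u i).2 v‖ ^ 2) with hA
  have hA0 : 0 ≤ A := Real.sqrt_nonneg _
  have hAi : ∀ i, ‖(u i).2 v‖ ≤ A := fun i => by
    apply Real.le_sqrt_of_sq_le
    exact Finset.single_le_sum (f := fun i => ‖(u i).2 v‖ ^ 2) (fun _ _ => sq_nonneg _)
      (Finset.mem_univ i)
  have hid : ∀ t : ℝ, 0 ≤ t →
      cost (fun i => (u i).1 + (u i).2 (t • v)) (fun i => (u i).1) = t * A := by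
    intro t ht
    simp only [cost, add_sub_cancel_left, map_smul, norm_smul, mul_pow]
    rw [← Finset.mul_sum, Real.sqrt_mul (by positivity), Real.norm_of_nonneg ht,
      Real.sqrt_sq ht]
  have hsmall : ∀ᶠ t in 𝓝[>] (0 : ℝ), t * (2 * A) < s := by
    have hc : Continuous fun t : ℝ => t * (2 * A) := by fun_prop
    have h1 := hc.tendsto 0
    rw [zero_mul] at h1
    exact (h1.eventually (gt_mem_nhds hs)).filter_mono nhdsWithin_le_nhds
  filter_upwards [hsmall, self_mem_nhdsWithin] with t hts ht
  have ht0 : 0 < t := ht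
  rw [map_ofFn, map_ofFn]
  refine le_antisymm ((dist_ofFn_le _ _).trans_eq (hid t ht0.le)) ?_
  obtain ⟨w, hw, hd⟩ := exists_dist_eq ((fun p => p.1 + p.2 (t • v)) ∘ u) (ofFn (Prod.fst ∘ u))
  obtain ⟨σ, rfl⟩ := exists_perm_of_ofFn_eq hw
  rw [hd]
  -- A matching that respects the values costs `t A`. Any other matching moves some point across a
  -- gap of at least `s`, and costs at least `s - t A ≥ t A` for small `t`.
  by_cases h : ∀ i, (u (σ i)).1 = (u i).1
  · rw [← hid t ht0.le]
    refine le_of_eq ?_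
    congr 1
    ext i : 1
    exact (h i).symm
  · push Not at h
    obtain ⟨i, hi⟩ := h
    refine le_trans ?_ (norm_sub_le_cost _ _ i)
    have h1 := hsep (σ i) i hi
    have h2 := norm_sub_le_norm_sub_add_norm_sub (u (σ i)).1 ((u i).1 + (u i).2 (t • v)) (u i).1
    rw [add_sub_cancel_left, map_smul, norm_smul, Real.norm_of_nonneg ht0.le,
      norm_sub_rev (u (σ i)).1 (_ + _)] at h2
    have h3 : t * ‖(u i).2 v‖ ≤ t * A := by gcongr; exact hAi i
    simp only [Function.comp_apply, map_smul]
    linarith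

theorem sqNorm_affine (J : Jet n m Q) (v : Euc n) (t : ℝ) :
    sqNorm (J.map fun p => p.1 + p.2 (t • v)) = sqNorm (J.map Prod.fst) +
      2 * t * sum J (fun p => inner ℝ p.1 (p.2 v)) + t ^ 2 * sum J fun p => ‖p.2 v‖ ^ 2 := by
  obtain ⟨u, rfl⟩ := exists_ofFn J
  simp only [sqNorm, sum_map, sum_ofFn, Finset.mul_sum, ← Finset.sum_add_distrib]
  refine Finset.sum_congr rfl fun i _ => ?_
  rw [norm_add_sq_real, map_smul, inner_smul_right, norm_smul, mul_pow, Real.norm_eq_abs, sq_abs]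
  ring

section Limits

variable {f : Euc n → AQ Q m} {x : Euc n} {J : Jet n m Q} {S : Set (Euc n)} {t : ℕ → ℝ}
  {v : Euc n}

theorem tendsto_dist_affine_div
    (hJ : (fun y => dist (f y) (J.map fun p => p.1 + p.2 (y - x))) =o[𝓝[S] x] fun y => y - x)
    (ht0 : Tendsto t atTop (𝓝 0)) (hxt : ∀ᶠ k in atTop, x + t k • v ∈ S) :
    Tendsto (fun k => dist (f (x + t k • v)) (J.map fun p => p.1 + p.2 (t k • v)) / t k)
      atTop (𝓝 0) := by
  have h1 : Tendsto (fun k => x + t k • v) atTop (𝓝[S] x) := by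
    refine tendsto_nhdsWithin_iff.2 ⟨?_, hxt⟩
    have := (ht0.smul_const v).const_add x
    rwa [zero_smul, add_zero] at this
  have h2 := hJ.comp_tendsto h1
  have h3 : (fun k => dist (f (x + t k • v)) (J.map fun p => p.1 + p.2 (t k • v))) =o[atTop] t := by
    refine IsLittleO.trans_isBigO (g := fun k => t k • v) ?_ ?_
    · refine h2.congr (fun k => ?_) (fun k => ?_)
      · simp
      · simp
    · refine IsBigO.of_bound ‖v‖ (Eventually.of_forall fun k => ?_)
      rw [norm_smul, mul_comm]
  exact h3.tendsto_div_nhds_zero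

theorem tendsto_dist_div
    (hJ : (fun y => dist (f y) (J.map fun p => p.1 + p.2 (y - x))) =o[𝓝[S] x] fun y => y - x)
    (hfst : J.map Prod.fst = f x)
    (ht : ∀ k, 0 < t k) (ht0 : Tendsto t atTop (𝓝 0)) (hxt : ∀ᶠ k in atTop, x + t k • v ∈ S) :
    Tendsto (fun k => dist (f (x + t k • v)) (f x) / t k) atTop
      (𝓝 (Real.sqrt (sum J fun p => ‖p.2 v‖ ^ 2))) := by
  have h1 := tendsto_dist_affine_div hJ ht0 hxt
  have ht' : Tendsto t atTop (𝓝[>] 0) :=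
    tendsto_nhdsWithin_iff.2 ⟨ht0, Eventually.of_forall fun k => ht k⟩
  rw [tendsto_iff_dist_tendsto_zero]
  refine squeeze_zero' (Eventually.of_forall fun _ => _root_.dist_nonneg) ?_ h1
  filter_upwards [ht'.eventually (eventually_dist_affine_eq J v)] with k hk
  rw [hfst] at hk
  rw [Real.dist_eq, le_div_iff₀ (ht k), ← abs_of_pos (ht k), ← abs_mul, sub_mul, abs_of_pos (ht k),
    div_mul_cancel₀ _ (ht k).ne', mul_comm, ← hk]
  exact abs_dist_sub_dist_le _ _ _

/-- With distances to `Q⟦0⟧`, the identity `a² - b² = (a - b)(a + b)` bounds the error of replacing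
`f` by its expansion by `o(t)` times a bounded quantity. The expansion itself contributes an
explicit quadratic polynomial in `t`. -/
theorem tendsto_sqNorm_sub_div
    (hJ : (fun y => dist (f y) (J.map fun p => p.1 + p.2 (y - x))) =o[𝓝[S] x] fun y => y - x)
    (hfst : J.map Prod.fst = f x)
    (ht : ∀ k, 0 < t k) (ht0 : Tendsto t atTop (𝓝 0)) (hxt : ∀ᶠ k in atTop, x + t k • v ∈ S) :
    Tendsto (fun k => (sqNorm (f (x + t k • v)) - sqNorm (f x)) / t k) atTop
      (𝓝 (2 * sum J fun p => inner ℝ p.1 (p.2 v))) := by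
  have h1 := tendsto_dist_affine_div hJ ht0 hxt
  set O : AQ Q m := Sym.replicate Q 0
  set A : ℕ → AQ Q m := fun k => J.map fun p => p.1 + p.2 (t k • v) with hAdef
  have hb : Tendsto (fun k => sqNorm (A k)) atTop (𝓝 (sqNorm (f x))) := by
    have e : ∀ k, sqNorm (A k) = sqNorm (f x) +
      2 * t k * sum J (fun p => inner ℝ p.1 (p.2 v)) + t k ^ 2 * sum J fun p => ‖p.2 v‖ ^ 2 :=
      fun k => by rw [hAdef, sqNorm_affine, hfst]
    simp_rw [e]
    have := (tendsto_const_nhds (x := sqNorm (f x))).add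
      ((ht0.const_mul 2).mul_const (sum J fun p => inner ℝ p.1 (p.2 v)))
    have := this.add ((ht0.pow 2).mul_const (sum J fun p => ‖p.2 v‖ ^ 2))
    simpa using this
  have hdA : Tendsto (fun k => dist (A k) O) atTop (𝓝 (Real.sqrt (sqNorm (f x)))) := by
    have := hb.sqrt
    refine this.congr fun k => ?_
    rw [← dist_replicate_sq, Real.sqrt_sq (dist_nonneg _ _)]
  have hdiff : Tendsto (fun k => (dist (f (x + t k • v)) O - dist (A k) O) / t k) atTop (𝓝 0) := by
    refine squeeze_zero_norm (fun k => ?_) h1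
    rw [norm_div, Real.norm_of_nonneg (ht k).le, Real.norm_eq_abs]
    gcongr
    · exact (ht k).le
    · exact abs_dist_sub_dist_le _ _ _
  have hsum : Tendsto (fun k => (dist (f (x + t k • v)) O - dist (A k) O) / t k * t k +
      2 * dist (A k) O) atTop (𝓝 (0 * 0 + 2 * Real.sqrt (sqNorm (f x)))) :=
    (hdiff.mul ht0).add (hdA.const_mul 2)
  have h2 := hdiff.mul hsum
  have h3 : Tendsto (fun k => 2 * sum J (fun p => inner ℝ p.1 (p.2 v)) +
      t k * sum J fun p => ‖p.2 v‖ ^ 2) atTop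
      (𝓝 (2 * sum J (fun p => inner ℝ p.1 (p.2 v)) + 0 * sum J fun p => ‖p.2 v‖ ^ 2)) :=
    tendsto_const_nhds.add (ht0.mul_const _)
  have h4 := h2.add h3
  simp only [zero_mul, zero_add, add_zero] at h4
  refine h4.congr fun k => ?_
  have e1 : sqNorm (A k) = sqNorm (f x) +
      2 * t k * sum J (fun p => inner ℝ p.1 (p.2 v)) + t k ^ 2 * sum J fun p => ‖p.2 v‖ ^ 2 := by
    rw [hAdef, sqNorm_affine, hfst]
  have e2 := dist_replicate_sq (A k)
  have e3 := dist_replicate_sq (f (x + t k • v))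
  have ht1 := (ht k).ne'
  rw [← e3, show sqNorm (f x) = dist (A k) O ^ 2 - (2 * t k * sum J (fun p => inner ℝ p.1 (p.2 v)) +
    t k ^ 2 * sum J fun p => ‖p.2 v‖ ^ 2) by rw [e2, e1]; ring]
  field_simp
  ring

end Limits

end QValued

/-! ### Measurability and bounds of the approximate differentials. -/

theorem segmentAverage_const_mul {n : ℕ} (c : ℝ) (G : Euc n → ℝ) (h x : Euc n) :
    segmentAverage (fun y => c * G y) h x = c * segmentAverage G h x :=
  intervalIntegral.integral_const_mul _ _

namespace QValued

variable {n m Q : ℕ}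

/-- A countable supremum of scalar increments makes `𝒢(f(x + t v), f(x))` accessible to
measurability arguments. -/
theorem ofReal_dist_eq_iSup (S T : AQ Q m) : ENNReal.ofReal (dist S T) =
    ⨆ k, ‖dist S (denseTuple Q m k) - dist T (denseTuple Q m k)‖ₑ := by
  apply le_antisymm
  · by_contra! hcon
    have hfin := (hcon.trans ENNReal.ofReal_lt_top).ne
    set M := ⨆ k, ‖dist S (denseTuple Q m k) - dist T (denseTuple Q m k)‖ₑ
    have : dist S T ≤ M.toReal := dist_le_of_forall_denseTuple fun k => by
      rw [← ENNReal.ofReal_le_iff_le_toReal hfin, ← Real.enorm_eq_ofReal_abs]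
      exact le_iSup (fun k => ‖dist S (denseTuple Q m k) - dist T (denseTuple Q m k)‖ₑ) k
    rw [← ENNReal.ofReal_le_iff_le_toReal hfin] at this
    exact (this.trans_lt hcon).false
  · refine iSup_le fun k => ?_
    rw [Real.enorm_eq_ofReal_abs]
    exact ENNReal.ofReal_le_ofReal (abs_dist_sub_dist_le _ _ _)

theorem sum_nonneg_of_nonneg {α : Type*} (J : Sym α Q) {F : α → ℝ} (hF : ∀ a, 0 ≤ F a) :
    0 ≤ sum J F := by
  obtain ⟨u, rfl⟩ := exists_ofFn J
  rw [sum_ofFn]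
  exact Finset.sum_nonneg fun _ _ => hF _

/-- Pointwise bounds for the approximate differentials, together with their measurability. -/
structure JetControlled (f : Euc n → AQ Q m) (Φ : Fin n → Euc n → ℝ) (μ : Measure (Euc n)) :
    Prop where
  aemeasurable : ∀ v, AEMeasurable (fun x => sum (jet f x) fun p => ‖p.2 v‖ ^ 2) μ
  ae_le : ∀ v : Euc n, ∀ᵐ x ∂μ, sum (jet f x) (fun p => ‖p.2 v‖ ^ 2) ≤ (∑ j, |v j| * Φ j x) ^ 2
  ae_eq : ∀ (w : Euc n → ℝ) (g : Fin n → Euc n → ℝ), SobolevPair w g →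
    (∀ᵐ x, x ∈ ball (0 : Euc n) 1 → w x = dist (f x) (Sym.replicate Q 0)) →
    ∀ j, ∀ᵐ x ∂μ, sum (jet f x) (fun p => inner ℝ p.1 (p.2 (basisVec j))) = w x * g j x

namespace HasGradientBound

variable {f : Euc n → AQ Q m} {Φ : Fin n → Euc n → ℝ}

/-- Translations that return to `S` turn the metric quotient `𝒢(f(x + t v), f(x)) / t` into the
square root of `∑ᵢ |Dfᵢ v|²`. As a limit it is measurable, and it inherits the bound by segment
averages of the `Φ j`. Likewise the quotient of `|f|²` has the limit `2 ∑ᵢ ⟨fᵢ, ∂ⱼ fᵢ⟩` by the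
expansion, and `2 w g` by the scalar increment formula. -/
theorem jetControlled_restrict (B : HasGradientBound f Φ) {S : Set (Euc n)}
    (hSm : MeasurableSet S) (hSb : S ⊆ ball 0 1) {C : ℝ} (hC : 0 ≤ C)
    (hlip : ∀ y ∈ S, ∀ z ∈ S, dist (f y) (f z) ≤ C * ‖y - z‖) :
    JetControlled f Φ (volume.restrict S) := by
  have hSfin : volume S ≠ ⊤ := ((measure_mono hSb).trans_lt measure_ball_lt_top).ne
  have hjet := ae_jet_isLittleO hSm hC hlip
  have hΦv : ∀ v : Euc n, Measurable (fun x => ∑ j, |v j| * Φ j x) := fun v => by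
    have := B.meas
    fun_prop
  have hΦL : ∀ v : Euc n, MemLp (fun x => ∑ j, |v j| * Φ j x) 2 := fun v =>
    memLp_finsetSum _ fun j _ => (B.memLp j).const_mul _
  have hΦi : ∀ v : Euc n, Integrable (fun x => ∑ j, |v j| * Φ j x) := fun v =>
    integrable_finsetSum _ fun j _ => (B.integrable j).const_mul _
  have hmargin : ∀ (v : Euc n) (t : ℕ → ℝ), Tendsto t atTop (𝓝 0) → ∀ x ∈ S,
      ∀ᶠ k in atTop, x ∈ ball (0 : Euc n) (1 - ‖t k • v‖) := by
    intro v t ht x hx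
    have h1 : Tendsto (fun k => 1 - ‖t k • v‖) atTop (𝓝 1) := by
      have := ((ht.smul_const v).norm).const_sub 1
      simpa using this
    have h2 : ‖x‖ < 1 := by simpa using hSb hx
    filter_upwards [h1.eventually (lt_mem_nhds h2)] with k hk
    simpa using hk
  choose w g hP hw hg using fun k => B.pair (denseTuple Q m k)
  have hwall : ∀ᵐ x, ∀ k, x ∈ ball (0 : Euc n) 1 → w k x = dist (f x) (denseTuple Q m k) :=
    ae_all_iff.2 hw
  refine ⟨fun v => ?_, fun v => ?_, fun w₀ g₀ hP₀ hw₀ j => ?_⟩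
  · obtain ⟨t, htpos, ht0, htS, -, -⟩ := exists_translations v hSm hSfin (hΦv v) (hΦv v) (hΦL v)
      (hΦL v) (hΦi v) (hΦi v)
    have hlim : AEMeasurable (fun x => Real.sqrt (sum (jet f x) fun p => ‖p.2 v‖ ^ 2))
        (volume.restrict S) := by
      refine aemeasurable_of_tendsto_metrizable_ae atTop
        (f := fun k x => (⨆ l, ‖w l (x + t k • v) - w l x‖ₑ).toReal / t k) (fun k => ?_) ?_
      · have := fun l => (hP l).meas
        refine Measurable.aemeasurable ?_
        refine Measurable.div_const ?_ _
        exact (Measurable.iSup fun l => by fun_prop).ennreal_toReal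
      · rw [ae_restrict_iff' hSm]
        have hshift : ∀ᵐ x, ∀ k, ∀ l, x + t k • v ∈ ball (0 : Euc n) 1 →
            w l (x + t k • v) = dist (f (x + t k • v)) (denseTuple Q m l) :=
          ae_all_iff.2 fun k =>
            (measurePreserving_add_right volume (t k • v)).quasiMeasurePreserving.ae hwall
        filter_upwards [hjet, htS, hwall, hshift] with x e1 e2 e3 e4 hxS
        refine (tendsto_dist_div (e1 hxS) (jet_map_fst f x) (fun k => (htpos k).1) ht0
          (e2 hxS)).congr' ?_
        filter_upwards [e2 hxS] with k hk
        have h5 : ENNReal.ofReal (dist (f (x + t k • v)) (f x)) =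
            ⨆ l, ‖w l (x + t k • v) - w l x‖ₑ := by
          rw [ofReal_dist_eq_iSup]
          exact iSup_congr fun l => by rw [e3 l (hSb hxS), e4 k l (hSb hk)]
        rw [← h5, ENNReal.toReal_ofReal (dist_nonneg _ _)]
    refine (hlim.pow_const 2).congr (ae_of_all _ fun x => ?_)
    exact Real.sq_sqrt (sum_nonneg_of_nonneg _ fun p => sq_nonneg _)
  · obtain ⟨t, htpos, ht0, htS, hav, -⟩ := exists_translations v hSm hSfin (hΦv v) (hΦv v) (hΦL v)
      (hΦL v) (hΦi v) (hΦi v)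
    rw [ae_restrict_iff' hSm]
    have hle : ∀ᵐ x, ∀ k, x ∈ ball (0 : Euc n) (1 - ‖t k • v‖) →
        dist (f (x + t k • v)) (f x) ≤
          segmentAverage (fun x => ∑ j, |(t k • v) j| * Φ j x) (t k • v) x :=
      ae_all_iff.2 fun k => B.ae_dist_le le_rfl
    filter_upwards [hjet, htS, hav, hle] with x e1 e2 e3 e4 hxS
    have h1 := tendsto_dist_div (e1 hxS) (jet_map_fst f x) (fun k => (htpos k).1) ht0 (e2 hxS)
    have h2 : Real.sqrt (sum (jet f x) fun p => ‖p.2 v‖ ^ 2) ≤ ∑ j, |v j| * Φ j x := by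
      refine le_of_tendsto_of_tendsto h1 e3 ?_
      filter_upwards [hmargin v t ht0 x hxS] with k hk
      have h3 := e4 k hk
      have h4 : (fun x => ∑ j, |(t k • v) j| * Φ j x) =
          fun x => t k * ∑ j, |v j| * Φ j x := by
        ext x
        rw [Finset.mul_sum]
        refine Finset.sum_congr rfl fun j _ => ?_
        rw [PiLp.smul_apply, smul_eq_mul, abs_mul, abs_of_pos (htpos k).1, mul_assoc]
      rw [h4, segmentAverage_const_mul] at h3
      rw [div_le_iff₀ (htpos k).1, mul_comm]
      exact h3
    rw [← Real.sq_sqrt (sum_nonneg_of_nonneg (jet f x) (F := fun p => ‖p.2 v‖ ^ 2)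
      fun p => sq_nonneg _)]
    gcongr
  · obtain ⟨t, htpos, ht0, htS, hav, -⟩ := exists_translations (basisVec j) hSm hSfin (hP₀.meas_g j)
      (hP₀.meas_g j) (hP₀.memLp_g j) (hP₀.memLp_g j) (hP₀.integrable_g j) (hP₀.integrable_g j)
    rw [ae_restrict_iff' hSm]
    have hnorm : ∀ k, |t k| = ‖t k • (basisVec j : Euc n)‖ := fun k => by
      simp [norm_smul, basisVec]
    have hsub : ∀ᵐ x, ∀ k, x ∈ ball (0 : Euc n) (1 - ‖t k • (basisVec j : Euc n)‖) →
        w₀ (x + t k • basisVec j) - w₀ x = t k * segmentAverage (g₀ j) (t k • basisVec j) x :=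
      ae_all_iff.2 fun k => hP₀.ae_sub_eq_basis j (hnorm k).le
    have hshift : ∀ᵐ x, ∀ k, x + t k • basisVec j ∈ ball (0 : Euc n) 1 →
        w₀ (x + t k • basisVec j) = dist (f (x + t k • basisVec j)) (Sym.replicate Q 0) :=
      ae_all_iff.2 fun k =>
        (measurePreserving_add_right volume (t k • basisVec j)).quasiMeasurePreserving.ae hw₀
    filter_upwards [hjet, htS, hav, hsub, hw₀, hshift] with x e1 e2 e3 e4 e5 e6 hxS
    have h1 := tendsto_sqNorm_sub_div (e1 hxS) (jet_map_fst f x) (fun k => (htpos k).1) ht0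
      (e2 hxS)
    have h2 : Tendsto (fun k => (2 * w₀ x + t k * segmentAverage (g₀ j) (t k • basisVec j) x) *
        segmentAverage (g₀ j) (t k • basisVec j) x) atTop
        (𝓝 ((2 * w₀ x + 0 * g₀ j x) * g₀ j x)) :=
      ((ht0.mul e3).const_add _).mul e3
    have h3 := tendsto_nhds_unique (h1.congr' ?_) h2
    · linarith
    · filter_upwards [e2 hxS, hmargin _ t ht0 x hxS] with k hk hk2
      have h4 := e4 k hk2
      rw [← dist_replicate_sq, ← dist_replicate_sq, ← e5 (hSb hxS), ← e6 k (hSb hk),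
        div_eq_iff (htpos k).1.ne']
      have h6 : w₀ (x + t k • basisVec j) =
        w₀ x + t k * segmentAverage (g₀ j) (t k • basisVec j) x := by linarith
      rw [h6]
      ring

theorem jetControlled (B : HasGradientBound f Φ) :
    JetControlled f Φ (volume.restrict (ball 0 1)) := by
  obtain ⟨S, hSm, hSb, hlip, hcov⟩ := B.exists_lipschitz_cover
  have hS : ∀ i, JetControlled f Φ (volume.restrict (S i)) := fun i => by
    obtain ⟨C, hC, h⟩ := hlip i
    exact B.jetControlled_restrict (hSm i) (hSb i) hC h
  have hU : volume.restrict (ball (0 : Euc n) 1) = volume.restrict (⋃ i, S i) := by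
    refine Measure.restrict_congr_set ?_
    filter_upwards [hcov] with x hx
    refine propext ⟨fun h => Set.mem_iUnion.2 (hx h), fun h => ?_⟩
    obtain ⟨i, hi⟩ := Set.mem_iUnion.1 h
    exact hSb i hi
  rw [hU]
  refine ⟨fun v => aemeasurable_iUnion_iff.2 fun i => (hS i).aemeasurable v,
    fun v => (ae_restrict_iUnion_iff _ _).2 fun i => (hS i).ae_le v,
    fun w g hP hw j => (ae_restrict_iUnion_iff _ _).2 fun i => (hS i).ae_eq w g hP hw j⟩

end HasGradientBound

end QValued

/-! ### From stationarity to energy densities. -/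

namespace QValued

variable {n m Q : ℕ}

/-- `∑ᵢ ⟨fᵢ, ∂ⱼ fᵢ⟩`. -/
noncomputable def jetV (J : Jet n m Q) (j : Fin n) : ℝ :=
  sum J fun p => inner ℝ p.1 (p.2 (basisVec j))

/-- `∑ᵢ ⟨∂ⱼ fᵢ, ∂ₖ fᵢ⟩`. -/
noncomputable def jetM (J : Jet n m Q) (j k : Fin n) : ℝ :=
  sum J fun p => inner ℝ (p.2 (basisVec j)) (p.2 (basisVec k))

theorem apply_eq_sum_basisVec (L : Euc n →L[ℝ] Euc m) (X : Euc n) :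
    L X = ∑ j, X j • L (basisVec j) := by
  conv_lhs => rw [sum_basisVec X]
  rw [map_sum]
  exact Finset.sum_congr rfl fun j _ => map_smul L _ _

/-- The square is expanded sheet by sheet. With arbitrary `X` and `s` this gives the positivity of
the energy form; with `X = y - x` and `s = -κ` it is the homogeneity defect. -/
theorem sum_norm_sq_apply_add (J : Jet n m Q) (X : Euc n) (s : ℝ) :
    sum J (fun p => ‖p.2 X + s • p.1‖ ^ 2) = ∑ j, ∑ k, jetM J j k * (X j * X k) +
      2 * s * ∑ j, jetV J j * X j + s ^ 2 * sqNorm (J.map Prod.fst) := by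
  obtain ⟨u, rfl⟩ := exists_ofFn J
  simp only [jetM, jetV, sqNorm, sum_map, sum_ofFn, Finset.sum_mul, Finset.mul_sum]
  have hM : ∑ j : Fin n, ∑ k : Fin n, ∑ i : Fin Q,
      inner ℝ ((u i).2 (basisVec j)) ((u i).2 (basisVec k)) * (X j * X k) =
      ∑ i : Fin Q, ∑ j : Fin n, ∑ k : Fin n,
        inner ℝ ((u i).2 (basisVec j)) ((u i).2 (basisVec k)) * (X j * X k) := by
    rw [Finset.sum_comm]
    rw [Finset.sum_congr rfl fun k _ => Finset.sum_comm]
    rw [Finset.sum_comm]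
    exact Finset.sum_congr rfl fun i _ => Finset.sum_comm
  have hV : ∑ j : Fin n, ∑ i : Fin Q, 2 * s * (inner ℝ (u i).1 ((u i).2 (basisVec j)) * X j) =
      ∑ i : Fin Q, ∑ j : Fin n, 2 * s * (inner ℝ (u i).1 ((u i).2 (basisVec j)) * X j) :=
    Finset.sum_comm
  rw [hM, hV, ← Finset.sum_add_distrib, ← Finset.sum_add_distrib]
  refine Finset.sum_congr rfl fun i _ => ?_
  rw [norm_add_sq_real, inner_smul_right, norm_smul, mul_pow, Real.norm_eq_abs, sq_abs,
    ← real_inner_self_eq_norm_sq ((u i).2 X), apply_eq_sum_basisVec (u i).2 X]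
  simp only [sum_inner, inner_sum, real_inner_smul_left, inner_smul_right, Finset.mul_sum]
  congr 2
  · refine Finset.sum_congr rfl fun j _ => Finset.sum_congr rfl fun k _ => ?_
    rw [real_inner_comm]
    ring
  · refine Finset.sum_congr rfl fun j _ => ?_
    rw [real_inner_comm]
    ring

/-- Measurability and integrability are known for the squares `∑ᵢ |Dfᵢ v|²`; polarization transfers
them to the mixed products. -/
theorem jetM_polarization (J : Jet n m Q) (j k : Fin n) :
    jetM J j k = (sum J (fun p => ‖p.2 (basisVec j + basisVec k)‖ ^ 2) -
      sum J (fun p => ‖p.2 (basisVec j)‖ ^ 2) - sum J (fun p => ‖p.2 (basisVec k)‖ ^ 2)) / 2 := by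
  obtain ⟨u, rfl⟩ := exists_ofFn J
  simp only [jetM, sum_ofFn]
  rw [← Finset.sum_sub_distrib, ← Finset.sum_sub_distrib, Finset.sum_div]
  refine Finset.sum_congr rfl fun i _ => ?_
  rw [map_add, norm_add_sq_real]
  ring

theorem sum_hsInner_self (J : Jet n m Q) : sum J (fun p => hsInner p.2 p.2) = ∑ j, jetM J j j := by
  obtain ⟨u, rfl⟩ := exists_ofFn J
  simp only [jetM, hsInner, sum_ofFn]
  exact Finset.sum_comm

theorem sum_hsInner_comp (J : Jet n m Q) (A : Euc n →L[ℝ] Euc n) :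
    sum J (fun p => hsInner p.2 (p.2.comp A)) = ∑ j, ∑ k, (A (basisVec j)) k * jetM J j k := by
  obtain ⟨u, rfl⟩ := exists_ofFn J
  simp only [jetM, hsInner, sum_ofFn, ContinuousLinearMap.comp_apply, Finset.mul_sum]
  rw [Finset.sum_comm]
  refine Finset.sum_congr rfl fun j _ => ?_
  rw [Finset.sum_comm]
  refine Finset.sum_congr rfl fun i _ => ?_
  rw [apply_eq_sum_basisVec (u i).2 (A (basisVec j)), inner_sum]
  exact Finset.sum_congr rfl fun k _ => inner_smul_right _ _ _

theorem sum_hsInner_outer (J : Jet n m Q) (l : Euc n →L[ℝ] ℝ) (c : ℝ) :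
    sum J (fun p => hsInner p.2 (l.smulRight p.1) +
      hsInner p.2 ((c • ContinuousLinearMap.id ℝ (Euc m)).comp p.2)) =
      c * ∑ j, jetM J j j + ∑ j, l (basisVec j) * jetV J j := by
  obtain ⟨u, rfl⟩ := exists_ofFn J
  simp only [jetM, jetV, hsInner, sum_ofFn, ContinuousLinearMap.comp_apply, Finset.mul_sum,
    ContinuousLinearMap.smulRight_apply, _root_.smul_apply, ContinuousLinearMap.id_apply,
    inner_smul_right, Finset.sum_add_distrib]
  have h : ∑ j : Fin n, ∑ i : Fin Q, l (basisVec j) * inner ℝ (u i).1 ((u i).2 (basisVec j)) =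
      ∑ i : Fin Q, ∑ j : Fin n, l (basisVec j) * inner ℝ (u i).1 ((u i).2 (basisVec j)) :=
    Finset.sum_comm
  rw [h, add_comm, Finset.sum_comm]
  simp only [real_inner_comm]

/-- The test field is `ψ(x, u) = η(x) u`, whose linear growth in `u` is exactly what the growth
condition admits. -/
theorem outer_test {η : Euc n → ℝ} (hη : ContDiff ℝ ∞ η) (hc : HasCompactSupport η)
    {f : Euc n → AQ Q m} (hs : tsupport η ⊆ ball 0 1) (hf : OuterStationary (ball 0 1) f) :
    ∫ y in ball 0 1, (η y * ∑ j, jetM (jet f y) j j +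
      ∑ j, fderiv ℝ η y (basisVec j) * jetV (jet f y) j) = 0 := by
  obtain ⟨C, hC⟩ := hc.exists_bound_of_continuous hη.continuous
  obtain ⟨C', hC'⟩ := (hc.fderiv ℝ).exists_bound_of_continuous (hη.continuous_fderiv (by simp))
  have hC0 : 0 ≤ C := (norm_nonneg _).trans (hC 0)
  have hC0' : 0 ≤ C' := (norm_nonneg _).trans (hC' 0)
  have hdx : ∀ (x : Euc n) (u : Euc m), fderiv ℝ (fun y => η y • u) x =
      (fderiv ℝ η x).smulRight u := fun x u =>
    fderiv_smul_const ((hη.differentiable (by simp)) x) u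
  have hdu : ∀ (x : Euc n) (u : Euc m), fderiv ℝ (fun v : Euc m => η x • v) u =
      η x • ContinuousLinearMap.id ℝ (Euc m) := fun x u => by
    rw [fderiv_fun_const_smul differentiableAt_fun_id, fderiv_fun_id]
  have h := hf (fun z => η z.1 • z.2) ((hη.comp contDiff_fst).smul contDiff_snd)
    ⟨tsupport η, hc, hs, fun x hx u => by simp [image_eq_zero_of_notMem_tsupport hx]⟩
    ⟨C + C', fun x u => ⟨?_, ?_⟩⟩
  · simp only [hdx, hdu, sum_hsInner_outer] at h
    exact h
  · simp only [hdu]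
    rw [norm_smul]
    calc ‖η x‖ * ‖ContinuousLinearMap.id ℝ (Euc m)‖ ≤ C * 1 := by
          gcongr
          · exact hC x
          · exact ContinuousLinearMap.norm_id_le
      _ ≤ C + C' := by linarith
  · simp only [hdx]
    rw [norm_smul, ContinuousLinearMap.norm_smulRight_apply]
    have h1 := hC x
    have h2 := hC' x
    have h3 := norm_nonneg u
    nlinarith [mul_le_mul_of_nonneg_right h1 h3, mul_le_mul_of_nonneg_right h2 h3]

/-- The gradient identity is the scalar chain rule for `w = 𝒢(f, Q⟦0⟧)`, because `w² = |f|²` and the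
product of `w` with its weak partial is `∑ᵢ ⟨fᵢ, ∂ⱼ fᵢ⟩` almost everywhere. The other two identities
are the stationarity conditions, rewritten by linear algebra on jets. -/
theorem DirStationary.energyDensities {f : Euc n → AQ Q m} (hf : DirStationary (ball 0 1) f) :
    EnergyDensities (fun y => sqNorm (f y)) (fun y => jetV (jet f y))
      (fun y => jetM (jet f y)) := by
  obtain ⟨Φ, B⟩ := hf.memW12.exists_hasGradientBound
  have hJ := B.jetControlled
  obtain ⟨w, g, P, hw, -⟩ := B.pair (Sym.replicate Q 0)
  have hu : ∀ᵐ y ∂volume.restrict (ball (0 : Euc n) 1), w y ^ 2 = sqNorm (f y) := by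
    rw [ae_restrict_iff' measurableSet_ball]
    filter_upwards [hw] with y hy hyb
    rw [hy hyb, dist_replicate_sq]
  have hV : ∀ j, ∀ᵐ y ∂volume.restrict (ball (0 : Euc n) 1), w y * g j y = jetV (jet f y) j :=
    fun j => (hJ.ae_eq w g P hw j).mono fun y hy => hy.symm
  have hN : ∀ v : Euc n, IntegrableOn (fun y => sum (jet f y) fun p => ‖p.2 v‖ ^ 2)
      (ball 0 1) := by
    intro v
    have h2 : MemLp (fun x => ∑ j, |v j| * Φ j x) 2 :=
      memLp_finsetSum _ fun j _ => (B.memLp j).const_mul _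
    refine h2.integrable_sq.integrableOn.mono' (hJ.aemeasurable v).aestronglyMeasurable ?_
    filter_upwards [hJ.ae_le v] with y hy
    rwa [Real.norm_of_nonneg (sum_nonneg_of_nonneg _ fun p => sq_nonneg _)]
  refine ⟨?_, fun j => ?_, fun j k => ?_, fun y X s => ?_, fun j η hη hc hs => ?_,
    fun η hη hc hs => outer_test hη hc hs hf.outer, fun φ hφ hc hs => ?_⟩
  · exact P.memLp.integrable_sq.integrableOn.congr hu
  · exact (P.memLp.integrable_mul (P.memLp_g j)).integrableOn.congr (hV j)
  · simp only [jetM_polarization]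
    exact (((hN _).sub (hN _)).sub (hN _)).div_const 2
  · have h := sum_norm_sq_apply_add (jet f y) (WithLp.toLp 2 X) s
    rw [jet_map_fst] at h
    have h0 : 0 ≤ sum (jet f y) fun p => ‖p.2 (WithLp.toLp 2 X) + s • p.1‖ ^ 2 :=
      sum_nonneg_of_nonneg _ fun p => sq_nonneg _
    rw [h] at h0
    exact h0
  · have h1 : ∫ y in ball 0 1, sqNorm (f y) * fderiv ℝ η y (basisVec j) =
        ∫ y, w y ^ 2 * fderiv ℝ η y (basisVec j) := by
      rw [← setIntegral_eq_integral_of_forall_compl_eq_zero (s := ball (0 : Euc n) 1)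
        (f := fun y => w y ^ 2 * fderiv ℝ η y (basisVec j))
        fun y hy => by simp [P.zero y hy]]
      refine integral_congr_ae ?_
      filter_upwards [hu] with y hy
      rw [hy]
    have h2 : ∫ y in ball 0 1, 2 * jetV (jet f y) j * η y = ∫ y, 2 * (w y * g j y) * η y := by
      rw [← setIntegral_eq_integral_of_forall_compl_eq_zero (s := ball (0 : Euc n) 1)
        (f := fun y => 2 * (w y * g j y) * η y)
        fun y hy => by simp [P.zero y hy]]
      refine integral_congr_ae ?_
      filter_upwards [hV j] with y hy
      rw [hy]
    rw [h1, h2]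
    exact P.integral_sq_mul_fderiv j hη hc hs
  · have h := hf.inner φ hφ hc hs
    simp only [sum_hsInner_comp, sum_hsInner_self] at h
    exact h

theorem integrableOn_quadratic {u : Euc n → ℝ} {V : Euc n → Fin n → ℝ}
    {M : Euc n → Fin n → Fin n → ℝ} (D : EnergyDensities u V M) (x : Euc n) (s : ℝ) :
    IntegrableOn (fun y => ∑ j, ∑ k, M y j k * ((y - x) j * (y - x) k) +
      2 * s * ∑ j, V y j * (y - x) j + s ^ 2 * u y) (ball 0 1) := by
  have hb : ∀ (c : Euc n → ℝ), Continuous c → ∀ {F : Euc n → ℝ}, IntegrableOn F (ball 0 1) →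
      IntegrableOn (fun y => F y * c y) (ball 0 1) := by
    intro c hc F hF
    obtain ⟨C, hC⟩ := (isCompact_closedBall (0 : Euc n) 1).exists_bound_of_continuousOn
      hc.continuousOn
    refine Integrable.mul_bdd (c := C) hF hc.aestronglyMeasurable ?_
    filter_upwards [ae_restrict_mem measurableSet_ball] with y hy
    exact hC y (ball_subset_closedBall hy)
  refine Integrable.add (Integrable.add ?_ ?_) (D.int_u.const_mul _)
  · exact integrable_finsetSum _ fun j _ => integrable_finsetSum _ fun k _ =>
      hb (fun y => (y - x) j * (y - x) k) (by fun_prop) (D.int_M j k)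
  · exact (integrable_finsetSum _ fun j _ =>
      hb (fun y => (y - x) j) (by fun_prop) (D.int_V j)).const_mul _

/-- Positive mass on the annulus keeps the extended logarithm away from `-∞`. -/
theorem vanishingQuotient_eq {f : Euc n → AQ Q m} {x : Euc n} {r : ℝ}
    (hr : volume.real (annulus x r) ≠ 0)
    (hint : IntegrableOn (fun y => sqNorm (f y)) (annulus x r))
    (hpos : 0 < ∫ y in annulus x r, sqNorm (f y)) :
    vanishingQuotient f x r = ((Real.log ((volume.real (annulus x r))⁻¹ *
      ∫ y in annulus x r, sqNorm (f y)) / (2 * Real.log r) : ℝ) : EReal) := by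
  have hr0 : 0 < volume.real (annulus x r) := lt_of_le_of_ne measureReal_nonneg hr.symm
  have hfin : volume (annulus x r) ≠ ⊤ := by
    intro h
    exact hr (by rw [Measure.real, h, ENNReal.toReal_top])
  have h1 : ⨍⁻ y in annulus x r, ENNReal.ofReal (sqNorm (f y)) ∂volume =
      ENNReal.ofReal ((volume.real (annulus x r))⁻¹ * ∫ y in annulus x r, sqNorm (f y)) := by
    rw [setLAverage_eq, ENNReal.ofReal_mul (inv_nonneg.2 hr0.le), ENNReal.ofReal_inv_of_pos hr0,
      ofReal_measureReal hfin, ofReal_integral_eq_lintegral_ofReal hint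
        (ae_of_all _ fun y => sqNorm_nonneg _), ENNReal.div_eq_inv_mul]
  rw [vanishingQuotient, h1, ENNReal.log_ofReal_of_pos (mul_pos (inv_pos.2 hr0) hpos),
    EReal.coe_div]

end QValued

/-! ### Conclusion. -/

theorem theorem3p6 {n m Q : ℕ} (hn : 1 ≤ n) (f : Euc n → AQ Q m)
    (hf : QValued.DirStationary (ball (0 : Euc n) 1) f)
    (hne : ¬ ∀ᵐ y ∂(volume.restrict (ball (0 : Euc n) 1)), f y = Sym.replicate Q 0)
    (x : Euc n) (hx : x ∈ ball (0 : Euc n) 1) :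
    ∃ κ : ℝ, QValued.vanishingOrder f x = (κ : EReal) ∧
      Tendsto (QValued.vanishingQuotient f x) (𝓝[>] 0) (𝓝 (κ : EReal)) ∧
      ∃ (r : ℕ → ℝ) (ε : ℕ → ℝ≥0),
        (∀ j, 0 < r j ∧ ball x (2 * r j) ⊆ ball 0 1) ∧
        Tendsto r atTop (𝓝 0) ∧ Tendsto ε atTop (𝓝 0) ∧
        ∀ j, ∫⁻ y in QValued.annulus x (r j), ENNReal.ofReal
              (QValued.sum (QValued.jet f y) fun p => ‖p.2 (y - x) - κ • p.1‖ ^ 2) ≤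
            ε j * ∫⁻ y in QValued.annulus x (r j), ENNReal.ofReal (QValued.sqNorm (f y)) := by
  have D := hf.energyDensities
  obtain ⟨κ, hpos, hlog, ε, hε0, hε, hle⟩ := D.asymptotics hn
    (fun h => hne (h.mono fun y hy => QValued.sqNorm_eq_zero.1 hy)) hx
  have hR : 0 < 1 - ‖x‖ := by
    rw [mem_ball_zero_iff] at hx
    linarith
  have hsub : ∀ {r : ℝ}, 2 * r ≤ 1 - ‖x‖ → QValued.annulus x r ⊆ ball 0 1 := fun hr =>
    (annulus_subset_ball x hr).trans EnergyDensities.ball_subset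
  have hlim : Tendsto (QValued.vanishingQuotient f x) (𝓝[>] 0) (𝓝 (κ : EReal)) := by
    refine ((continuous_coe_real_ereal.tendsto κ).comp hlog).congr' ?_
    filter_upwards [Ioo_mem_nhdsGT (show 0 < (1 - ‖x‖) / 2 by linarith)] with r hr
    have hr2 : 2 * r < 1 - ‖x‖ := by linarith [hr.2]
    have hp := hpos r hr.1 hr2
    refine (QValued.vanishingQuotient_eq (fun h0 => ?_) (D.int_u.mono_set (hsub hr2.le)) hp).symm
    have h1 : volume (QValued.annulus x r) = 0 := by
      refine (measureReal_eq_zero_iff ?_).1 h0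
      exact ((measure_mono (hsub hr2.le)).trans_lt measure_ball_lt_top).ne
    rw [setIntegral_measure_zero _ h1] at hp
    exact hp.false
  -- Any radii tending to `0` with `2 r ≤ (1 - ‖x‖) / 2` would do, since the defect estimate holds
  -- for all of them.
  refine ⟨κ, hlim.limsup_eq, hlim, fun j => (1 - ‖x‖) / 4 * (1 / ((j : ℝ) + 1)),
    fun j => Real.toNNReal (ε ((1 - ‖x‖) / 4 * (1 / ((j : ℝ) + 1)))), ?_⟩
  set r : ℕ → ℝ := fun j => (1 - ‖x‖) / 4 * (1 / ((j : ℝ) + 1)) with hr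
  have hr0 : ∀ j, 0 < r j := fun j => by positivity
  have hr1 : ∀ j, 2 * r j ≤ (1 - ‖x‖) / 2 := fun j => by
    have h1 : 1 / ((j : ℝ) + 1) ≤ 1 := by
      rw [div_le_one (by positivity)]
      linarith [Nat.cast_nonneg (α := ℝ) j]
    have h2 : r j ≤ (1 - ‖x‖) / 4 * 1 := by
      simp only [hr]
      gcongr
    linarith
  have hrlim : Tendsto r atTop (𝓝 0) := by
    have := (tendsto_one_div_add_atTop_nhds_zero_nat (𝕜 := ℝ)).const_mul ((1 - ‖x‖) / 4)
    rwa [mul_zero] at this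
  have hrlim' : Tendsto r atTop (𝓝[>] 0) :=
    tendsto_nhdsWithin_iff.2 ⟨hrlim, Eventually.of_forall hr0⟩
  refine ⟨fun j => ⟨hr0 j, ?_⟩, hrlim, ?_, fun j => ?_⟩
  · exact (ball_subset_ball (by linarith [hr1 j])).trans EnergyDensities.ball_subset
  · have := (continuous_real_toNNReal.tendsto 0).comp (hε.comp hrlim')
    rwa [Real.toNNReal_zero] at this
  · have hA : QValued.annulus x (r j) ⊆ ball 0 1 := hsub (by linarith [hr1 j])
    have hq : ∀ y, (QValued.sum (QValued.jet f y) fun p => ‖p.2 (y - x) - κ • p.1‖ ^ 2) =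
        ∑ i, ∑ k, QValued.jetM (QValued.jet f y) i k * ((y - x) i * (y - x) k) +
          2 * (-κ) * ∑ i, QValued.jetV (QValued.jet f y) i * (y - x) i +
          (-κ) ^ 2 * QValued.sqNorm (f y) := fun y => by
      have h := QValued.sum_norm_sq_apply_add (QValued.jet f y) (y - x) (-κ)
      rw [QValued.jet_map_fst] at h
      simpa only [neg_smul, ← sub_eq_add_neg] using h
    have hqi := (QValued.integrableOn_quadratic D x (-κ)).mono_set hA
    have hu := D.int_u.mono_set hA
    have h := hle (r j) (hr0 j) (hr1 j)
    have hnn : ∀ y, 0 ≤ QValued.sum (QValued.jet f y) fun p => ‖p.2 (y - x) - κ • p.1‖ ^ 2 :=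
      fun y => QValued.sum_nonneg_of_nonneg _ fun p => sq_nonneg _
    simp only [hq] at hnn ⊢
    -- Both integrands are integrable and nonnegative, so the extended integrals agree with the real
    -- ones and no default value enters.
    rw [← ofReal_integral_eq_lintegral_ofReal hqi (ae_of_all _ hnn),
      ← ofReal_integral_eq_lintegral_ofReal hu (ae_of_all _ fun y => QValued.sqNorm_nonneg _)]
    refine (ENNReal.ofReal_le_ofReal h).trans_eq ?_
    rw [ENNReal.ofReal_mul (hε0 _ (hr0 j) (hr1 j))]
    rfl
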